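/- **Setting.** Let $\Delta=\{|z|>1\}\cup\{\infty\}$. For $\mathbf c>0$ let $f_{\mathbf c}\colon\Delta\to\Delta\setminus(1,1+d]$ be the unique conformal bijection with $f_{\mathbf c}(z)=e^{\mathbf c}z+O(1)$ at $\infty$, where $d=d(\mathbf c)>0$ is determined by $4e^{\mathbf c}=(d+2)^2/(d+1)$, and let $\beta=\beta(\mathbf c)\in(0,\pi)$ be given by $f_{\mathbf c}(e^{\pm i\beta})=1$, i.e. $\cos\beta=2e^{-\mathbf c}-1$. Angles are elements of $\mathbb T=\mathbb R/2\pi\mathbb Z$, and $|x-y|$ is the distance in $\mathbb T$. For angles $\theta_1,\theta_2,\dots$ put $f_j(z)=e^{i\theta_j}f_{\mathbf c}(e^{-i\theta_j}z)$ and $\Phi_n=f_1\circ\cdots\circ f_n$. For $\nu>2$ and $\sigma>0$ let $$h_{n+1}(\theta)=\frac1{Z_n}\bigl|\Phi_n'(e^{\sigma+i\theta})\bigr|^{\nu},\qquad Z_n=\int_{\mathbb T}\bigl|\Phi_n'(e^{\sigma+i\theta})\bigr|^{\nu}\,d\theta .$$ The process ALE$(0,\eta)$ with $\eta=-\nu$,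 capacity parameter $\mathbf c$ and regularisation $\sigma$ is a random sequence $(\theta_n)_{n\ge1}$ in $\mathbb T$ (with any law of $\theta_1$) such that for every $n\ge1$ the conditional distribution of $\theta_{n+1}$ given $\theta_1,\dots,\theta_n$ has density $h_{n+1}$. For $D>0$ let $$\tau_D=\inf\bigl\{n\ge2:\min\bigl(|\theta_n-(\theta_{n-1}+\beta)|,\,|\theta_n-(\theta_{n-1}-\beta)|\bigr)>D\bigr\}\qquad(\inf\emptyset=\infty).$$ **Theorem 1.3.** Let $\nu>2$ and $T>0$. There exist constants $A>0$ and $c_0>0$, depending only on $\nu$ and $T$, such that the following holds for all $0<\mathbf c<c_0$ and all $0<\sigma\le\mathbf c^{2^{2^{1/\mathbf c}}}$. Put $D=\mathbf c^{9/2}\sigma^{1/2}$ and $N=\lfloor T/\mathbf c\rfloor$, and let $(\theta_n)_{n\ge1}$ be an ALE$(0,-\nu)$ process with parameters $\mathbf c,\sigma$. Then with probability $1$, for every $n\ge1$ with $n<N\wedge\tau_D$, $$\int_{F_n}h_{n+1}(\theta)\,d\theta\le A\,\mathbf c^{4},\qquad F_n=\bigl\{\theta\in\mathbb T:|\theta-(\theta_n+\beta)|\ge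 D\text{ and }|\theta-(\theta_n-\beta)|\ge D\bigr\},$$ and $$\left|\int_{\theta_n+\beta-D}^{\theta_n+\beta+D}h_{n+1}(\theta)\,d\theta-\int_{\theta_n-\beta-D}^{\theta_n-\beta+D}h_{n+1}(\theta)\,d\theta\right|\le A\,\mathbf c^{11/4}.$$ -/

import Mathlib

open Real Set MeasureTheory ProbabilityTheory

noncomputable section

namespace ALE

/-! ### The slit map -/

/-- The finite part `{z : |z| > 1}` of the exterior disc `Δ`. -/
def extDisc : Set ℂ := {z | 1 < ‖z‖}

/-- The slit particle `(1, 1 + d]`. -/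
def slit (d : ℝ) : Set ℂ := {z | ∃ x : ℝ, 1 < x ∧ x ≤ 1 + d ∧ z = (x : ℂ)}

/-- `f` is the conformal bijection from `Δ` onto `Δ \ (1, 1 + d]` fixing `∞`, with the expansion
`f z = e ^ c * z + O(1)` at `∞` (the point `∞` is left out of the domain and described through
the expansion). -/
structure IsSlitMap (d c : ℝ) (f : ℂ → ℂ) : Prop where
  differentiableOn : DifferentiableOn ℂ f extDisc
  bijOn : BijOn f extDisc (extDisc \ slit d)
  expansion : (fun z : ℂ => f z - (Real.exp c : ℂ) * z)
    =O[Bornology.cobounded ℂ] (fun _ => (1 : ℝ))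

/-- The length `d = d(c) > 0` of the slit of logarithmic capacity `c`, i.e. the positive solution
of `4 e ^ c = (d + 2) ^ 2 / (d + 1)`. -/
def slitLength (c : ℝ) : ℝ := 2 * √(1 - Real.exp (-c)) / (1 - √(1 - Real.exp (-c)))

/-- The explicit form of the slit map of capacity `c`: the conjugate of
`m ↦ √(e ^ (-c) * (m ^ 2 + e ^ c - 1))` on the right half-plane by the Möbius map
`z ↦ (z - 1) / (z + 1)`. That it is the slit map is `isSlitMap_slitMap`. -/
def slitMap (c : ℝ) (z : ℂ) : ℂ :=
  let r : ℂ := (1 - (Real.exp (-c) : ℂ) * (1 - ((z - 1) / (z + 1)) ^ 2)) ^ (2⁻¹ : ℂ)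
  (1 + r) / (1 - r)

/-- The half-length `β = β(c) ∈ (0, π)` of the arc of the unit circle that the slit map sends to
the slit; `f (e ^ (± i β)) = 1`. -/
def beta (c : ℝ) : ℝ := Real.arccos (2 * Real.exp (-c) - 1)

lemma exp_neg_mem {c : ℝ} (hc : 0 < c) : 0 < Real.exp (-c) ∧ Real.exp (-c) < 1 :=
  ⟨Real.exp_pos _, by rw [Real.exp_lt_one_iff]; linarith⟩

lemma beta_mem {c : ℝ} (hc : 0 < c) : beta c ∈ Ioo 0 π := by
  obtain ⟨h0, h1⟩ := exp_neg_mem hc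
  constructor
  · exact Real.arccos_pos.2 (by linarith)
  · refine lt_of_le_of_ne (Real.arccos_le_pi _) fun h => ?_
    have := Real.arccos_eq_pi.1 h
    linarith

lemma slitLength_pos {c : ℝ} (hc : 0 < c) : 0 < slitLength c := by
  obtain ⟨h0, h1⟩ := exp_neg_mem hc
  have h2 : 0 < √(1 - Real.exp (-c)) := Real.sqrt_pos.2 (by linarith)
  have h3 : √(1 - Real.exp (-c)) < 1 := by
    rw [Real.sqrt_lt' one_pos]; linarith
  have : 0 < 1 - √(1 - Real.exp (-c)) := by linarith
  unfold slitLength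
  positivity

lemma slitLength_eq {c : ℝ} (hc : 0 < c) :
    4 * Real.exp c = (slitLength c + 2) ^ 2 / (slitLength c + 1) := by
  obtain ⟨h0, h1⟩ := exp_neg_mem hc
  have h3 : √(1 - Real.exp (-c)) < 1 := by
    rw [Real.sqrt_lt' one_pos]; linarith
  have hsq : √(1 - Real.exp (-c)) ^ 2 = 1 - Real.exp (-c) := Real.sq_sqrt (by linarith)
  have hp := Real.sqrt_nonneg (1 - Real.exp (-c))
  have he : Real.exp c = 1 / (1 - √(1 - Real.exp (-c)) ^ 2) := by
    rw [hsq, Real.exp_neg]; field_simp; ring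
  unfold slitLength
  set ρ := √(1 - Real.exp (-c))
  have h4 : 1 - ρ ≠ 0 := by linarith
  have h5 : 1 + ρ ≠ 0 := by linarith
  have h6 : 1 - ρ ^ 2 ≠ 0 := by
    have : 1 - ρ ^ 2 = (1 - ρ) * (1 + ρ) := by ring
    rw [this]; exact mul_ne_zero h4 h5
  have h7 : 2 * ρ / (1 - ρ) + 1 = (1 + ρ) / (1 - ρ) := by field_simp; ring
  have h8 : 2 * ρ / (1 - ρ) + 2 = 2 / (1 - ρ) := by field_simp; ring
  rw [he, h7, h8]
  have h9 : 1 - ρ ^ 2 = (1 - ρ) * (1 + ρ) := by ring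
  rw [h9]
  field_simp
  ring

/-- Möbius maps between the exterior disc and the right half-plane. -/
lemma mob_re_pos {z : ℂ} (hz : z ∈ extDisc) : 0 < ((z - 1) / (z + 1)).re := by
  have hz' : 1 < ‖z‖ := hz
  have h1 : z + 1 ≠ 0 := by
    intro h
    have : z = -1 := by linear_combination h
    rw [this] at hz'; simp at hz'
  have h2 : 1 < Complex.normSq z := by
    rw [Complex.normSq_eq_norm_sq]; nlinarith
  have h3 : 0 < Complex.normSq (z + 1) := Complex.normSq_pos.2 h1
  rw [Complex.div_re]
  rw [← add_div]
  apply div_pos _ h3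
  simp [Complex.normSq_apply] at h2 ⊢
  nlinarith

lemma extDisc_of_re_pos {r : ℂ} (hr : 0 < r.re) (h1 : r ≠ 1) :
    (1 + r) / (1 - r) ∈ extDisc := by
  have h2 : 1 - r ≠ 0 := sub_ne_zero.2 (Ne.symm h1)
  change 1 < ‖(1 + r) / (1 - r)‖
  rw [norm_div, one_lt_div (norm_pos_iff.2 h2)]
  apply lt_of_pow_lt_pow_left₀ 2 (norm_nonneg _)
  rw [← Complex.normSq_eq_norm_sq, ← Complex.normSq_eq_norm_sq]
  simp [Complex.normSq_apply]
  nlinarith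

lemma re_pos_of_sqrt {w : ℂ} (hw : w ∈ Complex.slitPlane) : 0 < (w ^ (2⁻¹ : ℂ)).re := by
  have h0 : w ≠ 0 := Complex.slitPlane_ne_zero hw
  have harg := Complex.mem_slitPlane_iff_arg.1 hw
  have h1 : w ^ (2⁻¹ : ℂ) = ((Real.exp (Real.log ‖w‖ / 2) : ℝ) : ℂ) *
      Complex.exp ((w.arg / 2 : ℝ) * Complex.I) := by
    rw [Complex.cpow_def_of_ne_zero h0, Complex.ofReal_exp, ← Complex.exp_add, Complex.log]
    congr 1
    push_cast
    ring
  rw [h1, Complex.re_ofReal_mul, Complex.exp_ofReal_mul_I_re]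
  apply mul_pos (Real.exp_pos _)
  apply Real.cos_pos_of_mem_Ioo
  have hl := Complex.neg_pi_lt_arg w
  have hu := lt_of_le_of_ne (Complex.arg_le_pi w) harg.1
  constructor <;> linarith

lemma slitPlane_of_sq {m : ℂ} (hm : 0 < m.re) : m ^ 2 ∈ Complex.slitPlane := by
  rw [Complex.mem_slitPlane_iff]
  by_cases h : m.im = 0
  · left; simp [pow_two, h]; positivity
  · right; simp [pow_two]
    have : m.re * m.im ≠ 0 := mul_ne_zero hm.ne' h
    intro h'
    apply this
    linarith

lemma slitPlane_affine {a : ℝ} (ha : 0 < a) (ha1 : a < 1) {w : ℂ} (hw : w ∈ Complex.slitPlane) :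
    1 - (a : ℂ) * (1 - w) ∈ Complex.slitPlane := by
  rw [Complex.mem_slitPlane_iff] at hw ⊢
  rcases hw with h | h
  · left
    simp
    nlinarith
  · right
    simp
    exact ⟨ha.ne', h⟩

lemma mob_ne_one (z : ℂ) : (z - 1) / (z + 1) ≠ 1 := by
  intro h
  have h1 : z + 1 ≠ 0 := by
    intro h0; rw [h0] at h; simp at h
  rw [div_eq_one_iff_eq h1] at h
  have : (2 : ℂ) = 0 := by linear_combination -h
  norm_num at this

lemma mob_left_inv {z : ℂ} (hz : z ∈ extDisc) :
    (1 + (z - 1) / (z + 1)) / (1 - (z - 1) / (z + 1)) = z := by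
  have h1 : z + 1 ≠ 0 := by
    intro h0
    have := mob_re_pos hz
    rw [h0] at this; simp at this
  have e1 : 1 + (z - 1) / (z + 1) = 2 * z / (z + 1) := by field_simp; ring
  have e2 : 1 - (z - 1) / (z + 1) = 2 / (z + 1) := by field_simp; ring
  rw [e1, e2]
  field_simp

lemma mob_right_inv {r : ℂ} (h1 : r ≠ 1) :
    ((1 + r) / (1 - r) - 1) / ((1 + r) / (1 - r) + 1) = r := by
  have h2 : 1 - r ≠ 0 := sub_ne_zero.2 (Ne.symm h1)
  have e1 : (1 + r) / (1 - r) - 1 = 2 * r / (1 - r) := by field_simp; ring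
  have e2 : (1 + r) / (1 - r) + 1 = 2 / (1 - r) := by field_simp; ring
  rw [e1, e2]
  field_simp

/-- The square root occurring in `slitMap`. -/
def slitRoot (c : ℝ) (m : ℂ) : ℂ := (1 - (Real.exp (-c) : ℂ) * (1 - m ^ 2)) ^ (2⁻¹ : ℂ)

lemma slitMap_eq (c : ℝ) (z : ℂ) :
    slitMap c z = (1 + slitRoot c ((z - 1) / (z + 1))) / (1 - slitRoot c ((z - 1) / (z + 1))) := rfl

lemma slitRoot_sq (c : ℝ) (m : ℂ) :
    slitRoot c m ^ 2 = 1 - (Real.exp (-c) : ℂ) * (1 - m ^ 2) := by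
  unfold slitRoot
  exact_mod_cast Complex.cpow_nat_inv_pow _ (two_ne_zero)

lemma slitRoot_re_pos {c : ℝ} (hc : 0 < c) {m : ℂ} (hm : 0 < m.re) : 0 < (slitRoot c m).re :=
  re_pos_of_sqrt (slitPlane_affine (exp_neg_mem hc).1 (exp_neg_mem hc).2 (slitPlane_of_sq hm))

lemma eq_of_sq_eq_of_re_pos {a b : ℂ} (ha : 0 < a.re) (hb : 0 < b.re) (h : a ^ 2 = b ^ 2) :
    a = b := by
  rcases sq_eq_sq_iff_eq_or_eq_neg.1 h with h | h
  · exact h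
  · rw [h] at ha; simp at ha; linarith

lemma slitRoot_ne_one {c : ℝ} {m : ℂ} (hm : 0 < m.re) (hm1 : m ≠ 1) :
    slitRoot c m ≠ 1 := by
  intro h
  have h1 := slitRoot_sq c m
  rw [h] at h1
  have he : (Real.exp (-c) : ℂ) ≠ 0 := by exact_mod_cast (Real.exp_pos _).ne'
  have h2 : (1 - m ^ 2) = 0 := by
    have : (Real.exp (-c) : ℂ) * (1 - m ^ 2) = 0 := by linear_combination h1
    exact (mul_eq_zero.1 this).resolve_left he
  exact hm1 (eq_of_sq_eq_of_re_pos hm (by simp) (by linear_combination -h2))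

lemma slitMap_mem_extDisc {c : ℝ} (hc : 0 < c) {z : ℂ} (hz : z ∈ extDisc) :
    slitMap c z ∈ extDisc :=
  extDisc_of_re_pos (slitRoot_re_pos hc (mob_re_pos hz))
    (slitRoot_ne_one (mob_re_pos hz) (mob_ne_one z))

/-- The slit map is multiplication by `e ^ c` in the coordinate `(z + 1) ^ 2 / z`. -/
lemma slitMap_joukowski {c : ℝ} (hc : 0 < c) {z : ℂ} (hz : z ∈ extDisc) :
    slitMap c z + 1 / slitMap c z + 2 = (Real.exp c : ℂ) * (z + 1 / z + 2) := by
  have hz0 : z ≠ 0 := by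
    rintro rfl
    have : (1 : ℝ) < ‖(0 : ℂ)‖ := hz
    simp at this
    linarith
  have h1 : z + 1 ≠ 0 := by
    intro h0
    have := mob_re_pos hz
    rw [h0] at this; simp at this
  have hr := slitRoot_re_pos hc (mob_re_pos hz)
  have hr1 := slitRoot_ne_one (c := c) (mob_re_pos hz) (mob_ne_one z)
  have hsq := slitRoot_sq c ((z - 1) / (z + 1))
  rw [slitMap_eq]
  set r := slitRoot c ((z - 1) / (z + 1)) with hrdef
  have h2 : 1 - r ≠ 0 := sub_ne_zero.2 (Ne.symm hr1)
  have h3 : 1 + r ≠ 0 := by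
    intro h
    have := congrArg Complex.re h
    simp at this
    linarith
  have hee : (Real.exp c : ℂ) * (Real.exp (-c) : ℂ) = 1 := by
    rw [← Complex.ofReal_mul, ← Real.exp_add]; simp
  have e1 : (1 - ((z - 1) / (z + 1)) ^ 2) = 4 * z / (z + 1) ^ 2 := by field_simp; ring
  rw [e1] at hsq
  have e2 : (1 - r) * (1 + r) * (Real.exp c : ℂ) = 4 * z / (z + 1) ^ 2 := by
    linear_combination (-(Real.exp c : ℂ)) * hsq + (4 * z / (z + 1) ^ 2) * hee
  have e3 : (1 - r) * (1 + r) * (Real.exp c : ℂ) * (z + 1) ^ 2 = 4 * z := by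
    rw [e2]; field_simp
  have e4 : (1 + r) / (1 - r) + 1 / ((1 + r) / (1 - r)) + 2 = 4 / ((1 - r) * (1 + r)) := by
    field_simp; ring
  rw [e4]
  have e5 : z + 1 / z + 2 = (z + 1) ^ 2 / z := by field_simp; ring
  rw [e5]
  field_simp
  linear_combination -e3

lemma differentiableOn_slitMap {c : ℝ} (hc : 0 < c) :
    DifferentiableOn ℂ (slitMap c) extDisc := by
  intro z hz
  apply DifferentiableAt.differentiableWithinAt
  have h1 : z + 1 ≠ 0 := by
    intro h0
    have := mob_re_pos hz
    rw [h0] at this; simp at this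
  have hr1 := slitRoot_ne_one (c := c) (mob_re_pos hz) (mob_ne_one z)
  have hm : DifferentiableAt ℂ (fun z : ℂ => (z - 1) / (z + 1)) z := by
    fun_prop (disch := assumption)
  have hroot : DifferentiableAt ℂ (fun z : ℂ => slitRoot c ((z - 1) / (z + 1))) z := by
    unfold slitRoot
    refine DifferentiableAt.cpow_const ?_
      (slitPlane_affine (exp_neg_mem hc).1 (exp_neg_mem hc).2 (slitPlane_of_sq (mob_re_pos hz)))
    exact ((hm.pow 2).const_sub 1 |>.const_mul _).const_sub 1
  exact (hroot.const_add 1).div (hroot.const_sub 1) (sub_ne_zero.2 (Ne.symm hr1))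

lemma one_add_slitLength {c : ℝ} (hc : 0 < c) :
    1 + slitLength c = (1 + √(1 - Real.exp (-c))) / (1 - √(1 - Real.exp (-c))) := by
  obtain ⟨h0, h1⟩ := exp_neg_mem hc
  have h3 : √(1 - Real.exp (-c)) < 1 := by
    rw [Real.sqrt_lt' one_pos]; linarith
  have h4 : 1 - √(1 - Real.exp (-c)) ≠ 0 := by linarith
  unfold slitLength
  field_simp
  ring

/-- A point of the right half-plane corresponds to a point of the slit exactly when it is a real
number in `(0, √(1 - e ^ (-c))]`. -/
lemma mem_slit_iff {c : ℝ} (hc : 0 < c) {w : ℂ} (hw : w ∈ extDisc) :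
    w ∈ slit (slitLength c) ↔
      ∃ t : ℝ, 0 < t ∧ t ^ 2 ≤ 1 - Real.exp (-c) ∧ (w - 1) / (w + 1) = (t : ℂ) := by
  obtain ⟨h0, h1⟩ := exp_neg_mem hc
  have h3 : √(1 - Real.exp (-c)) < 1 := by
    rw [Real.sqrt_lt' one_pos]; linarith
  have hsq : √(1 - Real.exp (-c)) ^ 2 = 1 - Real.exp (-c) := Real.sq_sqrt (by linarith)
  have hp := Real.sqrt_nonneg (1 - Real.exp (-c))
  have hL := one_add_slitLength hc
  constructor
  · rintro ⟨x, hx1, hx2, rfl⟩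
    rw [hL] at hx2
    set ρ := √(1 - Real.exp (-c))
    refine ⟨(x - 1) / (x + 1), div_pos (by linarith) (by linarith), ?_, by push_cast; rfl⟩
    rw [← hsq]
    have hx0 : 0 < x + 1 := by linarith
    apply pow_le_pow_left₀ (div_nonneg (by linarith) hx0.le)
    rw [le_div_iff₀ (by linarith)] at hx2
    rw [div_le_iff₀ hx0]
    nlinarith
  · rintro ⟨t, ht0, ht, he⟩
    have htρ : t ≤ √(1 - Real.exp (-c)) := Real.le_sqrt_of_sq_le ht
    have ht1 : t < 1 := lt_of_le_of_lt htρ h3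
    refine ⟨(1 + t) / (1 - t), ?_, ?_, ?_⟩
    · rw [one_lt_div (by linarith)]; linarith
    · rw [hL]
      rw [div_le_div_iff₀ (by linarith) (by linarith)]
      nlinarith
    · have := mob_left_inv hw
      rw [he] at this
      rw [← this]
      push_cast
      rfl

lemma bijOn_slitMap {c : ℝ} (hc : 0 < c) :
    BijOn (slitMap c) extDisc (extDisc \ slit (slitLength c)) := by
  have hc' := exp_neg_mem hc
  have he : (Real.exp (-c) : ℂ) ≠ 0 := by exact_mod_cast (Real.exp_pos _).ne'
  have key : ∀ z ∈ extDisc, (slitMap c z - 1) / (slitMap c z + 1)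
      = slitRoot c ((z - 1) / (z + 1)) := fun z hz =>
    mob_right_inv (slitRoot_ne_one (mob_re_pos hz) (mob_ne_one z))
  refine ⟨fun z hz => ⟨slitMap_mem_extDisc hc hz, fun hs => ?_⟩, ?_, ?_⟩
  · obtain ⟨t, ht0, ht, hte⟩ := (mem_slit_iff hc (slitMap_mem_extDisc hc hz)).1 hs
    rw [key z hz] at hte
    have hsq := slitRoot_sq c ((z - 1) / (z + 1))
    rw [hte] at hsq
    have hm := slitPlane_of_sq (mob_re_pos hz)
    have h2 : ((z - 1) / (z + 1)) ^ 2
        = (((t ^ 2 - (1 - Real.exp (-c))) / Real.exp (-c) : ℝ) : ℂ) := by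
      push_cast [-Complex.ofReal_exp]
      rw [eq_div_iff he]
      linear_combination -hsq
    rw [h2, Complex.ofReal_mem_slitPlane] at hm
    have := (div_pos_iff_of_pos_right hc'.1).1 hm
    linarith
  · intro z hz w hw h
    have h1 : slitRoot c ((z - 1) / (z + 1)) = slitRoot c ((w - 1) / (w + 1)) := by
      rw [← key z hz, ← key w hw, h]
    have h2 := slitRoot_sq c ((z - 1) / (z + 1))
    rw [h1, slitRoot_sq] at h2
    have h3 : ((z - 1) / (z + 1)) ^ 2 = ((w - 1) / (w + 1)) ^ 2 := by
      apply mul_left_cancel₀ he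
      linear_combination -h2
    have h4 := eq_of_sq_eq_of_re_pos (mob_re_pos hz) (mob_re_pos hw) h3
    rw [← mob_left_inv hz, ← mob_left_inv hw, h4]
  · rintro w ⟨hw, hws⟩
    set r := (w - 1) / (w + 1) with hr
    have hr0 : 0 < r.re := mob_re_pos hw
    have hr1 : r ≠ 1 := mob_ne_one w
    obtain ⟨q, hq⟩ : ∃ q : ℂ, q = 1 - (1 - r ^ 2) / (Real.exp (-c) : ℂ) := ⟨_, rfl⟩
    have hqe : (Real.exp (-c) : ℂ) * q = r ^ 2 - ((1 - Real.exp (-c) : ℝ) : ℂ) := by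
      rw [hq]; push_cast [-Complex.ofReal_exp]; field_simp; ring
    have hre : Real.exp (-c) * q.re = (r ^ 2).re - (1 - Real.exp (-c)) := by
      have := congrArg Complex.re hqe
      rwa [Complex.re_ofReal_mul, Complex.sub_re, Complex.ofReal_re] at this
    have him : Real.exp (-c) * q.im = (r ^ 2).im := by
      have := congrArg Complex.im hqe
      rwa [Complex.im_ofReal_mul, Complex.sub_im, Complex.ofReal_im, sub_zero] at this
    have hqs : q ∈ Complex.slitPlane := by
      by_contra hcon
      rw [Complex.mem_slitPlane_iff, not_or, not_lt, not_not] at hcon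
      obtain ⟨hqr, hqi⟩ := hcon
      have hrim : r.im = 0 := by
        rw [hqi, mul_zero] at him
        have h' : 2 * (r.re * r.im) = 0 := by
          have : (r ^ 2).im = 2 * (r.re * r.im) := by simp [pow_two]; ring
          rw [← this, ← him]
        have := (mul_eq_zero.1 h').resolve_left two_ne_zero
        exact (mul_eq_zero.1 this).resolve_left hr0.ne'
      have hr2 : (r ^ 2).re = r.re ^ 2 := by simp [pow_two, hrim]
      apply hws
      rw [mem_slit_iff hc hw]
      refine ⟨r.re, hr0, ?_, Complex.ext (by simp [hr]) (by simpa [hr] using hrim)⟩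
      rw [← hr2]
      nlinarith [hc'.1]
    have hm0 := re_pos_of_sqrt hqs
    set m := q ^ (2⁻¹ : ℂ) with hm
    have hmsq : m ^ 2 = q := by
      rw [hm]; exact_mod_cast Complex.cpow_nat_inv_pow q (two_ne_zero)
    have hm1 : m ≠ 1 := by
      intro h
      rw [h] at hmsq
      have h5 : (1 - r ^ 2) / (Real.exp (-c) : ℂ) = 0 := by
        rw [hq] at hmsq; linear_combination hmsq
      have h6 := (div_eq_zero_iff.1 h5).resolve_right he
      exact hr1 (eq_of_sq_eq_of_re_pos hr0 (by simp) (by linear_combination -h6))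
    refine ⟨(1 + m) / (1 - m), extDisc_of_re_pos hm0 hm1, ?_⟩
    rw [slitMap_eq, mob_right_inv hm1]
    have h7 : slitRoot c m = r := by
      apply eq_of_sq_eq_of_re_pos (slitRoot_re_pos hc hm0) hr0
      rw [slitRoot_sq, hmsq, hq]
      field_simp
      ring
    rw [h7, hr, mob_left_inv hw]

/-- The explicit map `slitMap c` is the slit map of capacity `c`. -/
theorem isSlitMap_slitMap {c : ℝ} (hc : 0 < c) : IsSlitMap (slitLength c) c (slitMap c) where
  differentiableOn := differentiableOn_slitMap hc
  bijOn := bijOn_slitMap hc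
  expansion := by
    apply Asymptotics.IsBigO.of_bound (3 * Real.exp c + 3)
    have hev : ∀ᶠ z : ℂ in Bornology.cobounded ℂ, z ∈ extDisc :=
      (tendsto_norm_cobounded_atTop (E := ℂ)).eventually (Filter.eventually_gt_atTop (1 : ℝ))
    filter_upwards [hev] with z hz
    have hz1 : 1 < ‖z‖ := hz
    have hw1 : 1 < ‖slitMap c z‖ := slitMap_mem_extDisc hc hz
    have h := slitMap_joukowski hc hz
    have e : slitMap c z - (Real.exp c : ℂ) * z
        = (Real.exp c : ℂ) * (1 / z + 2) - (1 / slitMap c z + 2) := by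
      linear_combination h
    have hi1 : ‖1 / z + 2‖ ≤ 3 := by
      refine (norm_add_le _ _).trans ?_
      have : ‖1 / z‖ ≤ 1 := by
        rw [norm_div, norm_one, div_le_one (by linarith)]; exact hz1.le
      rw [Complex.norm_two]; linarith
    have hi2 : ‖1 / slitMap c z + 2‖ ≤ 3 := by
      refine (norm_add_le _ _).trans ?_
      have : ‖1 / slitMap c z‖ ≤ 1 := by
        rw [norm_div, norm_one, div_le_one (by linarith)]; exact hw1.le
      rw [Complex.norm_two]; linarith
    rw [e, norm_one, mul_one]
    refine (norm_sub_le _ _).trans ?_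
    rw [norm_mul, Complex.norm_real, Real.norm_of_nonneg (Real.exp_pos c).le]
    nlinarith [Real.exp_pos c]

/-- `e ^ (i β) = 2 e ^ (-c) - 1 + 2 i e ^ (-c) √(e ^ c - 1)`. -/
lemma exp_beta {c : ℝ} (hc : 0 < c) :
    Complex.exp (Complex.I * beta c) = ((2 * Real.exp (-c) - 1 : ℝ) : ℂ)
      + ((2 * Real.exp (-c) * √(Real.exp c - 1) : ℝ) : ℂ) * Complex.I := by
  obtain ⟨h0, h1⟩ := exp_neg_mem hc
  rw [mul_comm, Complex.exp_mul_I, ← Complex.ofReal_cos, ← Complex.ofReal_sin, beta,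
    Real.cos_arccos (by linarith) (by linarith), Real.sin_arccos]
  congr 3
  have h2 : Real.exp c * Real.exp (-c) = 1 := by rw [← Real.exp_add]; simp
  have h3 : (1 : ℝ) ≤ Real.exp c := Real.one_le_exp hc.le
  rw [Real.sqrt_eq_iff_mul_self_eq (by nlinarith) (by positivity)]
  have h4 : √(Real.exp c - 1) * √(Real.exp c - 1) = Real.exp c - 1 :=
    Real.mul_self_sqrt (by linarith)
  linear_combination (-4 * Real.exp (-c) ^ 2) * h4 - (4 * Real.exp (-c)) * h2

/-- `f (e ^ (± i β)) = 1`. -/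
lemma slitMap_exp_beta {c : ℝ} (hc : 0 < c) :
    slitMap c (Complex.exp (Complex.I * beta c)) = 1 ∧
      slitMap c (Complex.exp (-(Complex.I * beta c))) = 1 := by
  obtain ⟨h0, h1⟩ := exp_neg_mem hc
  set u := Complex.exp (Complex.I * beta c) with hu
  have hu0 : u ≠ 0 := Complex.exp_ne_zero _
  have hsum : u + u⁻¹ = 2 * ((2 * Real.exp (-c) - 1 : ℝ) : ℂ) := by
    have h2 : Real.cos (beta c) = 2 * Real.exp (-c) - 1 :=
      Real.cos_arccos (by linarith) (by linarith)
    rw [← h2, hu, ← Complex.exp_neg, Complex.ofReal_cos, Complex.two_cos, mul_comm, neg_mul]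
  have he : (Real.exp (-c) : ℂ) ≠ 0 := by exact_mod_cast (Real.exp_pos _).ne'
  have main : ∀ v : ℂ, v ≠ 0 → v + v⁻¹ = 2 * ((2 * Real.exp (-c) - 1 : ℝ) : ℂ) →
      slitMap c v = 1 := by
    intro v hv0 hv
    have h2 : (v + 1) ^ 2 = 4 * (Real.exp (-c) : ℂ) * v := by
      push_cast [-Complex.ofReal_exp] at hv
      field_simp at hv
      linear_combination hv
    have hv1 : v + 1 ≠ 0 := by
      intro h
      rw [h] at h2
      have : 4 * (Real.exp (-c) : ℂ) * v ≠ 0 := by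
        refine mul_ne_zero (mul_ne_zero (by norm_num) he) hv0
      exact this (by rw [← h2]; ring)
    have h3 : 1 - (Real.exp (-c) : ℂ) * (1 - ((v - 1) / (v + 1)) ^ 2) = 0 := by
      field_simp
      linear_combination h2
    rw [slitMap_eq]
    unfold slitRoot
    rw [h3, Complex.zero_cpow (by norm_num)]
    norm_num
  refine ⟨main u hu0 hsum, ?_⟩
  rw [Complex.exp_neg]
  exact main _ (inv_ne_zero hu0) (by rw [inv_inv, add_comm]; exact hsum)

/-! ### The aggregate Loewner evolution with `α = 0` -/

instance fact_two_pi_pos : Fact (0 < 2 * π) := ⟨Real.two_pi_pos⟩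

/-- The circle of angles `ℝ / 2πℤ`, with the arc-length distance `‖x - y‖` and with the Lebesgue
measure of total mass `2π`. -/
abbrev Torus : Type := AddCircle (2 * π)

/-- The point `e ^ (s + i x)` of the plane. -/
def circlePoint (s : ℝ) (x : Torus) : ℂ := (Real.exp s : ℂ) * (AddCircle.toCircle x : ℂ)

/-- The map `z ↦ e ^ (i x) f (e ^ (- i x) z)`, which attaches a slit at `e ^ (i x)`. -/
def rotMap (c : ℝ) (x : Torus) (z : ℂ) : ℂ :=
  circlePoint 0 x * slitMap c (circlePoint 0 (-x) * z)

/-- The cluster map `Φ_n = f_1 ∘ ⋯ ∘ f_n`, where `f_j` attaches a slit of capacity `c` at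
`e ^ (i θ_j)`. The angles are `θ 1, θ 2, …`; the value `θ 0` is not used. -/
def clusterMap (c : ℝ) (θ : ℕ → Torus) : ℕ → ℂ → ℂ
  | 0 => id
  | n + 1 => clusterMap c θ n ∘ rotMap c (θ (n + 1))

/-- The normalising factor `Z_n = ∫ |Φ_n'(e ^ (σ + i x))| ^ (-η) dx`. -/
def partitionFn (c η σ : ℝ) (θ : ℕ → Torus) (n : ℕ) : ℝ :=
  ∫ x : Torus, ‖deriv (clusterMap c θ n) (circlePoint σ x)‖ ^ (-η)

/-- The density `h_{n+1}(x) = |Φ_n'(e ^ (σ + i x))| ^ (-η) / Z_n` of `θ_{n+1}` given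
`θ_1, …, θ_n`. -/
def stepDensity (c η σ : ℝ) (θ : ℕ → Torus) (n : ℕ) (x : Torus) : ℝ :=
  ‖deriv (clusterMap c θ n) (circlePoint σ x)‖ ^ (-η) / partitionFn c η σ θ n

/-- The random angles `θ_1, θ_2, …` are those of an `ALE(0, η)` process with capacity parameter
`c` and regularisation `σ`: for `n ≥ 1`, conditionally on `θ_1, …, θ_n`, the angle `θ_{n+1}` has
the density `h_{n+1}`. The law of the first angle is left free. -/
structure IsALE {Ω : Type*} [MeasurableSpace Ω] (P : Measure Ω) (c η σ : ℝ)
    (θ : ℕ → Ω → Torus) : Prop where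
  measurable : ∀ n, 1 ≤ n → Measurable (θ n)
  condDensity : ∀ n, 1 ≤ n → ∀ E : Set Torus, MeasurableSet E →
    P⟦θ (n + 1) ⁻¹' E | ⨆ i ∈ Finset.Icc 1 n, MeasurableSpace.comap (θ i) inferInstance⟧
      =ᵐ[P] fun ω => ∫ x in E, stepDensity c η σ (fun k => θ k ω) n x

/-- The stopping time
`τ_D = inf {n ≥ 2 : min (|θ_n - (θ_{n-1} + β)|, |θ_n - (θ_{n-1} - β)|) > D}`, which is `⊤` if
there is no such `n`; here `b` stands for `β`. -/
def stopTime (b D : ℝ) (θ : ℕ → Torus) : ℕ∞ :=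
  sInf {m : ℕ∞ | ∃ n : ℕ, m = n ∧ 2 ≤ n ∧
    D < min ‖θ n - (θ (n - 1) + (b : Torus))‖ ‖θ n - (θ (n - 1) - (b : Torus))‖}

/-- The set `F_n` of the angles at distance at least `D` from both of `x + β` and `x - β`, where
`x = θ_n`; here `b` stands for `β`. -/
def farSet (b D : ℝ) (x : Torus) : Set Torus :=
  {y | D ≤ ‖y - (x + (b : Torus))‖ ∧ D ≤ ‖y - (x - (b : Torus))‖}

end ALE

end

/-!
The almost sure claim holds for every sequence of angles: `n < τ_D` says that each of the angles
`θ 2, …, θ n` lies within `D` of one of the two singular angles `θ (m - 1) ± β` of the preceding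
slit map, and this alone determines the density `h_{n+1}` well enough.

At distance `d` from a singular point the slit map `f` satisfies `|f'| ≈ d ^ (-1/2)` and
`|f - 1| ≈ d ^ (1/2)` up to powers of `c`. Both facts are read off from the algebraic identities
`slitMap_sub_one_sq` and `deriv_slitMap_sq`. As the base of each slit is a singular point of the
preceding one up to `D`, a point at distance `d` from the singular points of the slit `n` is carried
by the maps `f_n, f_{n-1}, …` along points at distances of order `d ^ (1/2), d ^ (1/4), …` from the
singular points, whence `|Φ_n'| ≈ d ^ (-(1 - 2 ^ (-n)))` (`norm_deriv_clusterMap_near`). In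
particular `Z_n` is at least of order `σ ^ (1 - ν (1 - 2 ^ (-n)))` (`le_partitionFn`).

For the far set, the orbit of a point either never comes close to a singular point, or it does so
for the first time at some slit `k`, and then `|Φ_n'| ≲ d_k ^ (-(1 - 2 ^ (-k)))`
(`norm_deriv_clusterMap_rpow_le`). On the far set the slit `k = n` contributes only from
distances at least of order `D`, which is much larger than `σ`. For `k < n` the distance `d_k` is
`|g - p|` with `g = f_{k+1} ∘ ⋯ ∘ f_n` and a point `p` of the unit circle. The Poisson kernel
`(|g|² - 1) / |g - p|²` is a positive harmonic function with value `1` at `∞`, so its integral over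
the circle is exactly `2π`; since `|g| ≥ e ^ σ` by the Schwarz lemma, this bounds
`∫ |g - p| ^ (-q)` by `σ ^ (1 - q)` or by `σ ^ (-q / 2)` (`integral_singularSum_le`). In each case
the result is smaller than `Z_n` by a factor `σ ^ (γ / 2 ^ n)` with `γ > 0`, which beats all
constants because `σ` is doubly exponentially small while `n ≤ T / c`.

For the balance of the two arcs, two points symmetric about `θ n` are equally far from the singular
points of the slit `n`. Along their orbits the logarithms of the distances to the singular points
stay within `O(c ^ 4)` of each other: each slit map halves the discrepancy, and the deviation `D`
of the next angle adds `O(c ^ 4)` to it, as `D` is that much smaller than the distances involved.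
Summing over at most `T / c` slits shows that the densities agree up to a factor `1 + O(c ^ 3)`
(`abs_log_norm_deriv_clusterMap_sub_le`).
-/

noncomputable section

namespace ALE

/-! ### The slit map near and away from its two singular points -/

lemma ne_zero_of_mem_extDisc {z : ℂ} (hz : z ∈ extDisc) : z ≠ 0 := by
  rintro rfl
  have : (1 : ℝ) < ‖(0 : ℂ)‖ := hz
  simp at this
  linarith

lemma add_one_ne_zero_of_mem_extDisc {z : ℂ} (hz : z ∈ extDisc) : z + 1 ≠ 0 := by
  intro h
  have h1 : (1 : ℝ) < ‖z‖ := hz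
  rw [eq_neg_of_add_eq_zero_left h] at h1
  simp at h1

lemma sub_one_ne_zero_of_mem_extDisc {z : ℂ} (hz : z ∈ extDisc) : z - 1 ≠ 0 := by
  intro h
  have h1 : (1 : ℝ) < ‖z‖ := hz
  rw [sub_eq_zero.1 h] at h1
  simp at h1

lemma isOpen_extDisc : IsOpen extDisc := isOpen_lt continuous_const continuous_norm

/-- The singular point `e ^ (i β)` of the slit map, which it sends to the base `1` of the slit. -/
def pole (c : ℝ) : ℂ := Complex.exp (Complex.I * beta c)

/-- The singular point `e ^ (- i β)` of the slit map. -/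
def pole' (c : ℝ) : ℂ := Complex.exp (-(Complex.I * beta c))

lemma norm_pole (c : ℝ) : ‖pole c‖ = 1 := by
  rw [pole, mul_comm]; exact Complex.norm_exp_ofReal_mul_I _

lemma norm_pole' (c : ℝ) : ‖pole' c‖ = 1 := by
  rw [pole', Complex.exp_neg, norm_inv, ← pole, norm_pole, inv_one]

lemma conj_pole (c : ℝ) : (starRingEnd ℂ) (pole c) = pole' c := by
  rw [pole, pole', ← Complex.exp_conj]; simp

lemma pole_mul_pole' (c : ℝ) : pole c * pole' c = 1 := by
  rw [pole, pole', ← Complex.exp_add]; simp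

lemma pole_add_pole' {c : ℝ} (hc : 0 < c) :
    pole c + pole' c = 4 * (Real.exp (-c) : ℂ) - 2 := by
  obtain ⟨h0, h1⟩ := exp_neg_mem hc
  have h2 : Real.cos (beta c) = 2 * Real.exp (-c) - 1 :=
    Real.cos_arccos (by linarith) (by linarith)
  have h3 := Complex.two_cos (beta c : ℂ)
  rw [← Complex.ofReal_cos, h2] at h3
  rw [pole, pole', mul_comm Complex.I, ← neg_mul, ← h3]
  push_cast
  ring

lemma sub_pole_mul_sub_pole' {c : ℝ} (hc : 0 < c) (z : ℂ) :
    (z - pole c) * (z - pole' c) = (z + 1) ^ 2 - 4 * (Real.exp (-c) : ℂ) * z := by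
  linear_combination (-z) * pole_add_pole' hc + pole_mul_pole' c

/-- The slit map, squared out: it turns the distance to the singular points into the distance of
the image to the base of the slit. -/
lemma slitMap_sub_one_sq {c : ℝ} (hc : 0 < c) {z : ℂ} (hz : z ∈ extDisc) :
    (slitMap c z - 1) ^ 2 * (z + 1) ^ 2
      = (z - pole c) * (z - pole' c) * (slitMap c z + 1) ^ 2 := by
  have hw := slitMap_mem_extDisc hc hz
  have h := slitMap_joukowski hc hz
  have hz0 := ne_zero_of_mem_extDisc hz
  have hw0 := ne_zero_of_mem_extDisc hw
  have hee : (Real.exp c : ℂ) * (Real.exp (-c) : ℂ) = 1 := by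
    rw [← Complex.ofReal_mul, ← Real.exp_add]; simp
  rw [sub_pole_mul_sub_pole' hc]
  set w := slitMap c z
  set E := (Real.exp c : ℂ)
  set a := (Real.exp (-c) : ℂ)
  have h1 : (w + 1) ^ 2 * z = E * (z + 1) ^ 2 * w := by
    field_simp at h
    linear_combination h
  linear_combination 4 * a * h1 + 4 * w * (z + 1) ^ 2 * hee

lemma differentiableAt_slitMap {c : ℝ} (hc : 0 < c) {z : ℂ} (hz : z ∈ extDisc) :
    DifferentiableAt ℂ (slitMap c) z :=
  (differentiableOn_slitMap hc).differentiableAt (isOpen_extDisc.mem_nhds hz)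

lemma deriv_slitMap_sq {c : ℝ} (hc : 0 < c) {z : ℂ} (hz : z ∈ extDisc) :
    deriv (slitMap c) z ^ 2 * z ^ 2 * ((z - pole c) * (z - pole' c))
      = slitMap c z ^ 2 * (z - 1) ^ 2 := by
  have hw := slitMap_mem_extDisc hc hz
  have hz0 := ne_zero_of_mem_extDisc hz
  have hw0 := ne_zero_of_mem_extDisc hw
  have hz1 := add_one_ne_zero_of_mem_extDisc hz
  have hw1 := add_one_ne_zero_of_mem_extDisc hw
  have hA := slitMap_sub_one_sq hc hz
  have h := slitMap_joukowski hc hz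
  have hd := (differentiableAt_slitMap hc hz).hasDerivAt
  -- the derivative of the identity `w + 1 / w + 2 = e ^ c * (z + 1 / z + 2)`
  have hd1 : HasDerivAt (fun z => slitMap c z + (slitMap c z)⁻¹ + 2)
      (deriv (slitMap c) z + -deriv (slitMap c) z / slitMap c z ^ 2) z :=
    (hd.add (hd.inv hw0)).add_const 2
  have hd2 : HasDerivAt (fun z : ℂ => (Real.exp c : ℂ) * (z + z⁻¹ + 2))
      ((Real.exp c : ℂ) * (1 + -(z ^ 2)⁻¹)) z :=
    (((hasDerivAt_id z).add (hasDerivAt_inv hz0)).add_const 2).const_mul _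
  have heq : (fun z => slitMap c z + (slitMap c z)⁻¹ + 2)
      =ᶠ[nhds z] fun z : ℂ => (Real.exp c : ℂ) * (z + z⁻¹ + 2) := by
    filter_upwards [isOpen_extDisc.mem_nhds hz] with x hx
    simpa [one_div] using slitMap_joukowski hc hx
  have hD := hd1.unique (hd2.congr_of_eventuallyEq heq)
  set w := slitMap c z
  set w' := deriv (slitMap c) z
  set E := (Real.exp c : ℂ)
  have h1 : (w + 1) ^ 2 * z = E * (z + 1) ^ 2 * w := by
    field_simp at h
    linear_combination h
  have h2 : w' * (w - 1) * (w + 1) * z ^ 2 = E * (z - 1) * (z + 1) * w ^ 2 := by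
    field_simp at hD
    linear_combination hD
  have h3 : w' * (w - 1) * z * (z + 1) = w * (w + 1) * (z - 1) := by
    have : (w' * (w - 1) * z * (z + 1)) * ((w + 1) * z)
        = (w * (w + 1) * (z - 1)) * ((w + 1) * z) := by
      linear_combination (z + 1) * h2 - w * (z - 1) * h1
    exact mul_right_cancel₀ (mul_ne_zero hw1 hz0) this
  have h4 : (w' ^ 2 * z ^ 2 * ((z - pole c) * (z - pole' c))) * (w + 1) ^ 2
      = (w ^ 2 * (z - 1) ^ 2) * (w + 1) ^ 2 := by
    linear_combination (w' * (w - 1) * z * (z + 1) + w * (w + 1) * (z - 1)) * h3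
      - w' ^ 2 * z ^ 2 * hA
  exact mul_right_cancel₀ (pow_ne_zero 2 hw1) h4

/-- The slit map in the coordinate `1 / z`, extended by `0 ↦ 0`. -/
def discMap (c : ℝ) (ζ : ℂ) : ℂ :=
  (1 - slitRoot c ((1 - ζ) / (1 + ζ))) / (1 + slitRoot c ((1 - ζ) / (1 + ζ)))

lemma cayley_re_pos {ζ : ℂ} (hζ : ‖ζ‖ < 1) : 0 < ((1 - ζ) / (1 + ζ)).re := by
  have h1 : 1 + ζ ≠ 0 := by
    intro h
    have : ζ = -1 := by linear_combination h
    rw [this] at hζ; simp at hζ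
  have h2 : Complex.normSq ζ < 1 := by
    rw [Complex.normSq_eq_norm_sq]; nlinarith [norm_nonneg ζ]
  rw [Complex.div_re, ← add_div]
  apply div_pos _ (Complex.normSq_pos.2 h1)
  simp [Complex.normSq_apply] at h2 ⊢
  nlinarith

lemma discMap_zero (c : ℝ) : discMap c 0 = 0 := by
  simp [discMap, slitRoot]

lemma discMap_inv {c : ℝ} {z : ℂ} (hz : z ∈ extDisc) : discMap c z⁻¹ = (slitMap c z)⁻¹ := by
  have hz0 := ne_zero_of_mem_extDisc hz
  have h1 := add_one_ne_zero_of_mem_extDisc hz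
  rw [discMap, slitMap_eq, inv_div]
  have : (1 - z⁻¹) / (1 + z⁻¹) = (z - 1) / (z + 1) := by
    field_simp
  rw [this]

lemma one_add_slitRoot_ne_zero {c : ℝ} (hc : 0 < c) {m : ℂ} (hm : 0 < m.re) :
    1 + slitRoot c m ≠ 0 := by
  intro h
  have := congrArg Complex.re h
  have h1 := slitRoot_re_pos hc hm
  simp at this
  linarith

lemma differentiableOn_discMap {c : ℝ} (hc : 0 < c) :
    DifferentiableOn ℂ (discMap c) (Metric.ball 0 1) := by
  intro ζ hζ
  have hζ' : ‖ζ‖ < 1 := by simpa using hζ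
  apply DifferentiableAt.differentiableWithinAt
  have h1 : 1 + ζ ≠ 0 := by
    intro h
    have : ζ = -1 := by linear_combination h
    rw [this] at hζ'; simp at hζ'
  have hm : DifferentiableAt ℂ (fun z : ℂ => (1 - z) / (1 + z)) ζ := by
    fun_prop (disch := assumption)
  have hroot : DifferentiableAt ℂ (fun z : ℂ => slitRoot c ((1 - z) / (1 + z))) ζ := by
    unfold slitRoot
    refine DifferentiableAt.cpow_const ?_
      (slitPlane_affine (exp_neg_mem hc).1 (exp_neg_mem hc).2 (slitPlane_of_sq (cayley_re_pos hζ')))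
    exact ((hm.pow 2).const_sub 1 |>.const_mul _).const_sub 1
  exact (hroot.const_sub 1).div (hroot.const_add 1)
    (one_add_slitRoot_ne_zero hc (cayley_re_pos hζ'))

lemma inv_mem_extDisc {ζ : ℂ} (h0 : ζ ≠ 0) (h : ‖ζ‖ < 1) : ζ⁻¹ ∈ extDisc := by
  change 1 < ‖ζ⁻¹‖
  rw [norm_inv]
  exact (one_lt_inv₀ (norm_pos_iff.2 h0)).2 h

lemma norm_inv_lt_one {z : ℂ} (hz : z ∈ extDisc) : ‖z⁻¹‖ < 1 := by
  rw [norm_inv]; exact inv_lt_one_of_one_lt₀ hz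

lemma mapsTo_discMap {c : ℝ} (hc : 0 < c) :
    MapsTo (discMap c) (Metric.ball 0 1) (Metric.ball 0 1) := by
  intro ζ hζ
  have hζ' : ‖ζ‖ < 1 := by simpa using hζ
  by_cases h0 : ζ = 0
  · rw [h0, discMap_zero]; simp
  · have hz := inv_mem_extDisc h0 hζ'
    have := discMap_inv (c := c) hz
    rw [inv_inv] at this
    rw [this]
    simpa using norm_inv_lt_one (slitMap_mem_extDisc hc hz)

/-- By the Schwarz lemma, attaching a slit pushes points away from the disc. -/
lemma norm_le_norm_slitMap {c : ℝ} (hc : 0 < c) {z : ℂ} (hz : z ∈ extDisc) :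
    ‖z‖ ≤ ‖slitMap c z‖ := by
  have h := Complex.norm_le_norm_of_mapsTo_ball (differentiableOn_discMap hc)
    ((mapsTo_discMap hc).mono_right Metric.ball_subset_closedBall) (discMap_zero c)
    (norm_inv_lt_one hz)
  rw [discMap_inv hz, norm_inv, norm_inv] at h
  have h0 : 0 < ‖z‖ := lt_trans one_pos hz
  have h1 : 0 < ‖slitMap c z‖ := lt_trans one_pos (slitMap_mem_extDisc hc hz)
  exact (inv_le_inv₀ h1 h0).1 h

lemma norm_slitMap_le {c : ℝ} (hc : 0 < c) (hc1 : c ≤ 1) {z : ℂ} (hz : z ∈ extDisc) :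
    ‖slitMap c z‖ ≤ 15 * ‖z‖ := by
  have hz1 : 1 < ‖z‖ := hz
  have hw1 : 1 < ‖slitMap c z‖ := slitMap_mem_extDisc hc hz
  have h := slitMap_joukowski hc hz
  have e : slitMap c z = (Real.exp c : ℂ) * (z + 1 / z + 2) - (1 / slitMap c z + 2) := by
    linear_combination h
  have he : Real.exp c ≤ 3 := by
    have := Real.exp_le_exp.2 hc1
    linarith [Real.exp_one_lt_d9]
  have h3 : ∀ y : ℂ, 1 < ‖y‖ → ‖1 / y + 2‖ ≤ 3 := by
    intro y hy
    refine (norm_add_le _ _).trans ?_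
    have : ‖1 / y‖ ≤ 1 := by
      rw [norm_div, norm_one, div_le_one (by linarith)]; exact hy.le
    rw [Complex.norm_two]; linarith
  have h4 : ‖z + 1 / z + 2‖ ≤ ‖z‖ + 3 := by
    rw [add_assoc]; exact (norm_add_le _ _).trans (by linarith [h3 z hz1])
  rw [e]
  refine (norm_sub_le _ _).trans ?_
  rw [norm_mul, Complex.norm_real, Real.norm_of_nonneg (Real.exp_pos c).le]
  have h5 := h3 _ hw1
  have : Real.exp c * ‖z + 1 / z + 2‖ ≤ 3 * (‖z‖ + 3) :=
    mul_le_mul he h4 (norm_nonneg _) (by norm_num)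
  linarith

/-! ### Distances to the singular points -/

/-- The distance of `u` to the two singular points of the slit map. -/
def poleDist (c : ℝ) (u : ℂ) : ℝ := min ‖u - pole c‖ ‖u - pole' c‖

/-- The distance of `u` to the farther of the two singular points of the slit map. -/
def poleFar (c : ℝ) (u : ℂ) : ℝ := max ‖u - pole c‖ ‖u - pole' c‖

lemma poleDist_mul_poleFar (c : ℝ) (u : ℂ) :
    poleDist c u * poleFar c u = ‖u - pole c‖ * ‖u - pole' c‖ := min_mul_max _ _

lemma poleDist_le_poleFar (c : ℝ) (u : ℂ) : poleDist c u ≤ poleFar c u := min_le_max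

lemma poleDist_nonneg (c : ℝ) (u : ℂ) : 0 ≤ poleDist c u := le_min (norm_nonneg _) (norm_nonneg _)

lemma le_poleDist {c s : ℝ} {u : ℂ} (hu : 1 + s ≤ ‖u‖) : s ≤ poleDist c u := by
  refine le_min ?_ ?_
  · have := norm_sub_norm_le u (pole c); rw [norm_pole] at this; linarith
  · have := norm_sub_norm_le u (pole' c); rw [norm_pole'] at this; linarith

lemma poleDist_pos {c : ℝ} {u : ℂ} (hu : u ∈ extDisc) : 0 < poleDist c u := by
  have h : 1 < ‖u‖ := hu
  have := le_poleDist (c := c) (s := ‖u‖ - 1) (u := u) (by linarith)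
  linarith

lemma abs_poleFar_sub_le (c : ℝ) (u : ℂ) :
    |poleFar c u - ‖pole c - pole' c‖| ≤ poleDist c u := by
  unfold poleFar poleDist
  have h1 : ‖pole c - pole' c‖ ≤ ‖u - pole c‖ + ‖u - pole' c‖ := by
    rw [norm_sub_rev u (pole c)]; exact norm_sub_le_norm_sub_add_norm_sub _ _ _
  have h2 : ‖u - pole c‖ ≤ ‖u - pole' c‖ + ‖pole c - pole' c‖ := by
    rw [norm_sub_rev (pole c)]; exact norm_sub_le_norm_sub_add_norm_sub _ _ _
  have h3 : ‖u - pole' c‖ ≤ ‖u - pole c‖ + ‖pole c - pole' c‖ :=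
    norm_sub_le_norm_sub_add_norm_sub _ _ _
  rw [abs_le]
  rcases le_total ‖u - pole c‖ ‖u - pole' c‖ with h | h
  · rw [max_eq_right h, min_eq_left h]; constructor <;> linarith
  · rw [max_eq_left h, min_eq_right h]; constructor <;> linarith

lemma norm_pole_sub_one_sq {c : ℝ} (hc : 0 < c) :
    ‖pole c - 1‖ ^ 2 = 4 * (1 - Real.exp (-c)) := by
  obtain ⟨h0, h1⟩ := exp_neg_mem hc
  have h2 : Real.cos (beta c) = 2 * Real.exp (-c) - 1 :=
    Real.cos_arccos (by linarith) (by linarith)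
  rw [pole, Complex.norm_exp_I_mul_ofReal_sub_one, Real.norm_eq_abs, sq_abs, mul_pow,
    Real.sin_sq_eq_half_sub]
  rw [show 2 * (beta c / 2) = beta c by ring, h2]
  ring

lemma norm_pole'_sub_one (c : ℝ) : ‖pole' c - 1‖ = ‖pole c - 1‖ := by
  rw [← conj_pole, ← Complex.norm_conj (pole c - 1)]; simp

lemma one_sub_exp_neg_bounds {c : ℝ} (hc : 0 < c) (hc1 : c ≤ 1 / 10) :
    c / 2 ≤ 1 - Real.exp (-c) ∧ 1 - Real.exp (-c) ≤ c := by
  constructor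
  · have h1 : Real.exp (-c) ≤ 1 / (1 + c) := by
      rw [Real.exp_neg, ← one_div]
      exact one_div_le_one_div_of_le (by linarith) (by linarith [Real.add_one_le_exp c])
    have h2 : 1 / (1 + c) ≤ 1 - c / 2 := by
      rw [div_le_iff₀ (by linarith)]; nlinarith
    linarith
  · linarith [Real.add_one_le_exp (-c)]

lemma norm_pole_sub_one_bounds {c : ℝ} (hc : 0 < c) (hc1 : c ≤ 1 / 10) :
    √c ≤ ‖pole c - 1‖ ∧ ‖pole c - 1‖ ≤ 2 * √c := by
  obtain ⟨h1, h2⟩ := one_sub_exp_neg_bounds hc hc1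
  have h := norm_pole_sub_one_sq hc
  have hs := Real.sq_sqrt hc.le
  constructor
  · apply le_of_pow_le_pow_left₀ two_ne_zero (norm_nonneg _); linarith
  · apply le_of_pow_le_pow_left₀ two_ne_zero (by positivity); nlinarith

lemma norm_pole_sub_pole' {c : ℝ} (hc : 0 < c) (hc1 : c ≤ 1 / 10) :
    2 * √c ≤ ‖pole c - pole' c‖ ∧ ‖pole c - pole' c‖ ≤ 2 := by
  obtain ⟨h1, h2⟩ := one_sub_exp_neg_bounds hc hc1
  have hs := Real.sq_sqrt hc.le
  have e1 : (pole c - pole' c) ^ 2 = (pole c - 1) * (pole' c - 1) * (-4 * (Real.exp (-c) : ℂ)) := by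
    linear_combination (pole c + pole' c - 2) * pole_add_pole' hc
      + (-4 + 4 * (Real.exp (-c) : ℂ)) * pole_mul_pole' c
  have e2 : ‖pole c - pole' c‖ ^ 2 = 4 * (1 - Real.exp (-c)) * (4 * Real.exp (-c)) := by
    rw [← norm_pow, e1, norm_mul, norm_mul, norm_pole'_sub_one, ← sq, norm_pole_sub_one_sq hc,
      norm_mul, Complex.norm_real, Real.norm_of_nonneg (Real.exp_pos _).le]
    norm_num
  constructor
  · apply le_of_pow_le_pow_left₀ two_ne_zero (norm_nonneg _)
    nlinarith
  · refine (norm_sub_le _ _).trans ?_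
    rw [norm_pole, norm_pole']; norm_num

lemma norm_slitMap_sub_one_sq {c : ℝ} (hc : 0 < c) {z : ℂ} (hz : z ∈ extDisc) :
    ‖slitMap c z - 1‖ ^ 2 * ‖z + 1‖ ^ 2
      = poleDist c z * poleFar c z * ‖slitMap c z + 1‖ ^ 2 := by
  have h := congrArg norm (slitMap_sub_one_sq hc hz)
  simpa only [norm_mul, norm_pow, poleDist_mul_poleFar] using h

lemma norm_deriv_slitMap_sq {c : ℝ} (hc : 0 < c) {z : ℂ} (hz : z ∈ extDisc) :
    ‖deriv (slitMap c) z‖ ^ 2 * ‖z‖ ^ 2 * (poleDist c z * poleFar c z)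
      = ‖slitMap c z‖ ^ 2 * ‖z - 1‖ ^ 2 := by
  have h := congrArg norm (deriv_slitMap_sq hc hz)
  simpa only [norm_mul, norm_pow, poleDist_mul_poleFar] using h

lemma abs_norm_sub_one_sub_le (c : ℝ) (z : ℂ) : |‖z - 1‖ - ‖pole c - 1‖| ≤ poleDist c z := by
  have h1 : |‖z - 1‖ - ‖pole c - 1‖| ≤ ‖z - pole c‖ := by
    refine (abs_norm_sub_norm_le _ _).trans (le_of_eq ?_); congr 1; ring
  have h2 : |‖z - 1‖ - ‖pole c - 1‖| ≤ ‖z - pole' c‖ := by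
    rw [← norm_pole'_sub_one]
    refine (abs_norm_sub_norm_le _ _).trans (le_of_eq ?_); congr 1; ring
  exact le_min h1 h2

lemma abs_norm_add_one_sub_le (c : ℝ) (z : ℂ) : |‖z + 1‖ - ‖pole c + 1‖| ≤ poleDist c z := by
  have h1 : |‖z + 1‖ - ‖pole c + 1‖| ≤ ‖z - pole c‖ := by
    refine (abs_norm_sub_norm_le _ _).trans (le_of_eq ?_); congr 1; ring
  have h2 : |‖z + 1‖ - ‖pole c + 1‖| ≤ ‖z - pole' c‖ := by
    have : ‖pole c + 1‖ = ‖pole' c + 1‖ := by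
      rw [← conj_pole, ← Complex.norm_conj (pole c + 1)]; simp
    rw [this]
    refine (abs_norm_sub_norm_le _ _).trans (le_of_eq ?_); congr 1; ring
  exact le_min h1 h2

lemma norm_le_one_add_poleDist (c : ℝ) (z : ℂ) : ‖z‖ ≤ 1 + poleDist c z := by
  have h1 : ‖z‖ - 1 ≤ ‖z - pole c‖ := by
    have := norm_sub_norm_le z (pole c); rwa [norm_pole] at this
  have h2 : ‖z‖ - 1 ≤ ‖z - pole' c‖ := by
    have := norm_sub_norm_le z (pole' c); rwa [norm_pole'] at this
  have := le_min h1 h2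
  unfold poleDist; linarith

lemma sqrt_le_poleFar {c : ℝ} (hc : 0 < c) (hc1 : c ≤ 1 / 10) (z : ℂ) : √c ≤ poleFar c z := by
  have h1 := (abs_le.1 (abs_poleFar_sub_le c z)).1
  have h2 := (norm_pole_sub_pole' hc hc1).1
  have h3 := poleDist_le_poleFar c z
  linarith

lemma poleFar_le {c : ℝ} (hc : 0 < c) (hc1 : c ≤ 1 / 10) (z : ℂ) :
    poleFar c z ≤ 2 + poleDist c z := by
  have h1 := (abs_le.1 (abs_poleFar_sub_le c z)).2
  have h2 := (norm_pole_sub_pole' hc hc1).2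
  linarith

/-- Away from the singular points the derivative of the slit map is bounded. -/
lemma norm_deriv_slitMap_le {c : ℝ} (hc : 0 < c) (hc1 : c ≤ 1 / 10) {z : ℂ} (hz : z ∈ extDisc)
    {r : ℝ} (hr : 0 < r) (hr1 : r ≤ 1) (hd : r ≤ poleDist c z) :
    ‖deriv (slitMap c) z‖ ≤ 45 / r := by
  have h := norm_deriv_slitMap_sq hc hz
  have hw := norm_slitMap_le hc (by linarith) hz
  have hz1 : 1 < ‖z‖ := hz
  have hM := poleDist_le_poleFar c z
  have h1 : ‖z - 1‖ ≤ poleDist c z + 2 := by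
    have h1 := (abs_le.1 (abs_norm_sub_one_sub_le c z)).2
    have h2 : ‖pole c - 1‖ ≤ 2 := by
      refine (norm_sub_le _ _).trans ?_
      rw [norm_pole, norm_one]; norm_num
    linarith
  set d := poleDist c z
  have hd0 : 0 < d := lt_of_lt_of_le hr hd
  have h2 : ‖z - 1‖ * r ≤ 3 * d := by nlinarith
  have h3 : (‖deriv (slitMap c) z‖ * r * (‖z‖ * d)) ^ 2 ≤ (45 * (‖z‖ * d)) ^ 2 := by
    calc (‖deriv (slitMap c) z‖ * r * (‖z‖ * d)) ^ 2
        = r ^ 2 * (‖deriv (slitMap c) z‖ ^ 2 * ‖z‖ ^ 2 * (d * d)) := by ring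
      _ ≤ r ^ 2 * (‖deriv (slitMap c) z‖ ^ 2 * ‖z‖ ^ 2 * (d * poleFar c z)) := by gcongr
      _ = (‖slitMap c z‖ * (‖z - 1‖ * r)) ^ 2 := by rw [h]; ring
      _ ≤ ((15 * ‖z‖) * (3 * d)) ^ 2 := by gcongr
      _ = (45 * (‖z‖ * d)) ^ 2 := by ring
  have h4 := le_of_pow_le_pow_left₀ two_ne_zero (by positivity) h3
  rw [le_div_iff₀ hr]
  exact le_of_mul_le_mul_right h4 (by positivity)

/-- Elementary bounds at a point close to a singular point. -/
lemma near_pole_bounds {c : ℝ} (hc : 0 < c) (hc1 : c ≤ 1 / 10 ^ 4) {z : ℂ}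
    (hd : poleDist c z ≤ c ^ 2) :
    √c ≤ 1 / 100 ∧ poleDist c z ≤ √c / 2 ∧ poleFar c z ≤ 3 ∧ √c / 2 ≤ ‖z - 1‖ ∧ ‖z - 1‖ ≤ 1 ∧
      1 ≤ ‖z + 1‖ ∧ ‖z + 1‖ ≤ 3 ∧ ‖z‖ ≤ 2 := by
  have hs : √c ≤ 1 / 100 := by
    rw [Real.sqrt_le_left (by norm_num)]; linarith
  have hs0 : 0 < √c := Real.sqrt_pos.2 hc
  have hss := Real.sq_sqrt hc.le
  have hc10 : c ≤ 1 / 10 := by linarith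
  obtain ⟨h1, h2⟩ := norm_pole_sub_one_bounds hc hc10
  obtain ⟨h3, h4⟩ := abs_le.1 (abs_norm_sub_one_sub_le c z)
  have h5 := poleFar_le hc hc10 z
  have h6 : poleDist c z ≤ √c / 2 := by
    refine hd.trans ?_
    have : c ^ 2 = √c * √c ^ 3 := by
      rw [← pow_succ', show 3 + 1 = 2 * 2 from rfl, pow_mul, hss]
    rw [this]
    have : √c ^ 3 ≤ (1 / 100) ^ 3 := by gcongr
    nlinarith
  have h7 : ‖z - 1‖ ≤ 1 := by linarith
  have h8 : (2 : ℝ) - ‖z - 1‖ ≤ ‖z + 1‖ := by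
    have := norm_sub_norm_le (2 : ℂ) (-(z - 1))
    rw [norm_neg, Complex.norm_two] at this
    refine this.trans (le_of_eq ?_); congr 1; ring
  have h9 : ‖z + 1‖ ≤ 2 + ‖z - 1‖ := by
    have := norm_add_le (2 : ℂ) (z - 1)
    rw [Complex.norm_two] at this
    refine le_trans (le_of_eq ?_) this; congr 1; ring
  have h10 := norm_le_one_add_poleDist c z
  exact ⟨hs, h6, by linarith, by linarith, h7, by linarith, by linarith, by linarith⟩

/-- Near a singular point the slit map behaves like a square root. -/
lemma norm_slitMap_sub_one_bounds {c : ℝ} (hc : 0 < c) (hc1 : c ≤ 1 / 10 ^ 4) {z : ℂ}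
    (hz : z ∈ extDisc) (hd : poleDist c z ≤ c ^ 2) :
    √c * √(poleDist c z) ≤ ‖slitMap c z - 1‖ ∧ ‖slitMap c z - 1‖ ≤ 7 * √(poleDist c z) ∧
      1 ≤ ‖slitMap c z + 1‖ := by
  obtain ⟨hs, hds, hM3, -, -, hz1, hz3, -⟩ := near_pole_bounds hc hc1 hd
  have hM := sqrt_le_poleFar hc (by linarith) z
  have h := norm_slitMap_sub_one_sq hc hz
  have hd0 := poleDist_nonneg c z
  have hdd := Real.sq_sqrt hd0
  set w := slitMap c z
  set d := poleDist c z
  have hs0 : 0 < √c := Real.sqrt_pos.2 hc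
  have hss := Real.sq_sqrt hc.le
  have hsd0 := Real.sqrt_nonneg d
  have hsd : √d ≤ 1 / 100 := by
    rw [Real.sqrt_le_left (by norm_num)]
    nlinarith
  have hw1 : ‖w + 1‖ ≤ ‖w - 1‖ + 2 := by
    have := norm_add_le (w - 1) 2
    rw [Complex.norm_two] at this
    refine le_trans (le_of_eq ?_) this; congr 1; ring
  have hw2 : 2 - ‖w - 1‖ ≤ ‖w + 1‖ := by
    have := norm_sub_norm_le (2 : ℂ) (-(w - 1))
    rw [norm_neg, Complex.norm_two] at this
    refine this.trans (le_of_eq ?_); congr 1; ring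
  have hup : ‖w - 1‖ ≤ 2 * √d * ‖w + 1‖ := by
    apply le_of_pow_le_pow_left₀ two_ne_zero (by positivity)
    calc ‖w - 1‖ ^ 2 = ‖w - 1‖ ^ 2 * 1 ^ 2 := by ring
      _ ≤ ‖w - 1‖ ^ 2 * ‖z + 1‖ ^ 2 := by gcongr
      _ = d * poleFar c z * ‖w + 1‖ ^ 2 := h
      _ ≤ d * 4 * ‖w + 1‖ ^ 2 := by gcongr; linarith
      _ = (2 * √d * ‖w + 1‖) ^ 2 := by rw [mul_pow, mul_pow, hdd]; ring
  have hup2 : ‖w - 1‖ ≤ 7 * √d := by nlinarith [norm_nonneg (w - 1)]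
  have hwp : 1 ≤ ‖w + 1‖ := by linarith
  refine ⟨?_, hup2, hwp⟩
  apply le_of_pow_le_pow_left₀ two_ne_zero (norm_nonneg _)
  have h9 : d * √c ≤ ‖w - 1‖ ^ 2 * 9 := by
    calc d * √c ≤ d * poleFar c z := by gcongr
      _ = d * poleFar c z * 1 ^ 2 := by ring
      _ ≤ d * poleFar c z * ‖w + 1‖ ^ 2 := by gcongr; exact mul_nonneg hd0 (hs0.le.trans hM)
      _ = ‖w - 1‖ ^ 2 * ‖z + 1‖ ^ 2 := h.symm
      _ ≤ ‖w - 1‖ ^ 2 * 3 ^ 2 := by gcongr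
      _ = ‖w - 1‖ ^ 2 * 9 := by ring
  rw [mul_pow, hdd]
  nlinarith [mul_nonneg hd0 hs0.le]

/-- Near a singular point the derivative of the slit map is comparable to the inverse of the
square root of the distance. -/
lemma norm_deriv_slitMap_bounds {c : ℝ} (hc : 0 < c) (hc1 : c ≤ 1 / 10 ^ 4) {z : ℂ}
    (hz : z ∈ extDisc) (hd : poleDist c z ≤ c ^ 2) :
    c ≤ ‖deriv (slitMap c) z‖ * √(poleDist c z) ∧
      ‖deriv (slitMap c) z‖ * √(poleDist c z) ≤ c⁻¹ := by
  obtain ⟨hs, hds, hM3, hzl, hz1, -, -, -⟩ := near_pole_bounds hc hc1 hd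
  have hM := sqrt_le_poleFar hc (by linarith) z
  have h := norm_deriv_slitMap_sq hc hz
  have hw := norm_slitMap_le hc (by linarith) hz
  have hw' := norm_le_norm_slitMap hc hz
  have hz0 : 1 < ‖z‖ := hz
  have hd0 := poleDist_nonneg c z
  have hdd := Real.sq_sqrt hd0
  have hs0 : 0 < √c := Real.sqrt_pos.2 hc
  have hss := Real.sq_sqrt hc.le
  set d := poleDist c z
  set W := ‖deriv (slitMap c) z‖
  have hW : 0 ≤ W := norm_nonneg _
  have e : (W * √d) ^ 2 = W ^ 2 * d := by rw [mul_pow, hdd]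
  have hzz : 0 < ‖z‖ ^ 2 := by positivity
  constructor
  · apply le_of_pow_le_pow_left₀ two_ne_zero (by positivity)
    rw [e]
    have : (√c / 2) ^ 2 * ‖z‖ ^ 2 ≤ (W ^ 2 * d * 3) * ‖z‖ ^ 2 := by
      calc (√c / 2) ^ 2 * ‖z‖ ^ 2 ≤ ‖z - 1‖ ^ 2 * ‖slitMap c z‖ ^ 2 := by gcongr
        _ = W ^ 2 * ‖z‖ ^ 2 * (d * poleFar c z) := by rw [h]; ring
        _ ≤ W ^ 2 * ‖z‖ ^ 2 * (d * 3) := by gcongr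
        _ = _ := by ring
    have := le_of_mul_le_mul_right this hzz
    nlinarith
  · apply le_of_pow_le_pow_left₀ two_ne_zero (by positivity)
    rw [e]
    have : (W ^ 2 * d * √c) * ‖z‖ ^ 2 ≤ 225 * ‖z‖ ^ 2 := by
      calc (W ^ 2 * d * √c) * ‖z‖ ^ 2 ≤ (W ^ 2 * d * poleFar c z) * ‖z‖ ^ 2 := by gcongr
        _ = ‖slitMap c z‖ ^ 2 * ‖z - 1‖ ^ 2 := by rw [← h]; ring
        _ ≤ (15 * ‖z‖) ^ 2 * 1 ^ 2 := by gcongr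
        _ = _ := by ring
    have h2 := le_of_mul_le_mul_right this hzz
    rw [inv_pow, ← one_div, le_div_iff₀ (by positivity)]
    have hsc : c ^ 2 = √c * √c ^ 3 := by rw [← pow_succ', show 3 + 1 = 2 * 2 from rfl, pow_mul, hss]
    have h3 : √c ^ 3 ≤ (1 / 100) ^ 3 := by gcongr
    rw [hsc, ← mul_assoc]
    calc W ^ 2 * d * √c * √c ^ 3 ≤ 225 * (1 / 100) ^ 3 := by gcongr
      _ ≤ 1 := by norm_num

lemma abs_log_sub_log_le {x y m : ℝ} (hm : 0 < m) (hx : m ≤ x) (hy : m ≤ y) :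
    |Real.log x - Real.log y| ≤ |x - y| / m := by
  have key : ∀ x y : ℝ, m ≤ x → m ≤ y → Real.log x - Real.log y ≤ |x - y| / m := by
    intro x y hx hy
    have hx0 : 0 < x := hm.trans_le hx
    have hy0 : 0 < y := hm.trans_le hy
    rw [← Real.log_div hx0.ne' hy0.ne']
    refine (Real.log_le_sub_one_of_pos (div_pos hx0 hy0)).trans ?_
    rw [div_sub_one hy0.ne', div_le_div_iff₀ hy0 hm]
    have h1 : x - y ≤ |x - y| := le_abs_self _
    have h2 := abs_nonneg (x - y)
    nlinarith
  rw [abs_le]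
  refine ⟨?_, key x y hx hy⟩
  have := key y x hy hx
  rw [abs_sub_comm] at this
  linarith

/-- Very close to a singular point, the logarithm of the derivative of the slit map is
`- log d / 2` plus a constant, and that of the distance of the image to the base of the slit is
`log d / 2` plus a constant, up to a very small error. -/
lemma log_slitMap_near {c : ℝ} (hc : 0 < c) (hc1 : c ≤ 1 / 10 ^ 4) :
    ∃ K₁ K₂ : ℝ, ∀ z ∈ extDisc, poleDist c z ≤ c ^ 14 →
      |Real.log ‖deriv (slitMap c) z‖ + Real.log (poleDist c z) / 2 - K₁| ≤ c ^ 5 / 4 ∧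
      |Real.log ‖slitMap c z - 1‖ - Real.log (poleDist c z) / 2 - K₂| ≤ c ^ 5 / 4 := by
  refine ⟨Real.log ‖pole c - 1‖ - Real.log ‖pole c - pole' c‖ / 2,
    Real.log ‖pole c - pole' c‖ / 2 + Real.log 2 - Real.log ‖pole c + 1‖, fun z hz hd14 => ?_⟩
  have hc10 : c ≤ 1 / 10 := by linarith
  have hcle : c ≤ 1 := by linarith
  have hd : poleDist c z ≤ c ^ 2 := hd14.trans (pow_le_pow_of_le_one hc.le hcle (by norm_num))
  obtain ⟨hs, hds, hM3, hzl, hz1, hzp, -, -⟩ := near_pole_bounds hc hc1 hd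
  have hM := sqrt_le_poleFar hc hc10 z
  obtain ⟨-, hX, hwp⟩ := norm_slitMap_sub_one_bounds hc hc1 hz hd
  have hA := norm_slitMap_sub_one_sq hc hz
  have hC := norm_deriv_slitMap_sq hc hz
  have hw' := norm_le_norm_slitMap hc hz
  have hz0 : 1 < ‖z‖ := hz
  have hw0 : 1 < ‖slitMap c z‖ := slitMap_mem_extDisc hc hz
  have hd0 := poleDist_pos (c := c) hz
  have hs0 : 0 < √c := Real.sqrt_pos.2 hc
  have hss := Real.sq_sqrt hc.le
  have hcs : c ≤ √c := by nlinarith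
  have hsd : √(poleDist c z) ≤ c ^ 7 := by
    rw [Real.sqrt_le_left (by positivity)]
    exact hd14.trans (le_of_eq (by ring))
  have hpp := (norm_pole_sub_pole' hc hc10).1
  have hp1 := (norm_pole_sub_one_bounds hc hc10).1
  have hX0 : 0 < ‖slitMap c z - 1‖ :=
    norm_pos_iff.2 (sub_one_ne_zero_of_mem_extDisc (slitMap_mem_extDisc hc hz))
  have hF := abs_poleFar_sub_le c z
  have hz1' := abs_norm_sub_one_sub_le c z
  have hzp' := abs_norm_add_one_sub_le c z
  have hzd := norm_le_one_add_poleDist c z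
  have hww : ‖slitMap c z‖ ≤ 1 + ‖slitMap c z - 1‖ := by
    have := norm_add_le 1 (slitMap c z - 1)
    simpa using this
  have hw2 : |‖slitMap c z + 1‖ - 2| ≤ ‖slitMap c z - 1‖ := by
    have := abs_norm_sub_norm_le (slitMap c z + 1) 2
    rw [Complex.norm_two] at this
    refine this.trans (le_of_eq ?_); congr 1; ring
  set d := poleDist c z
  set M := poleFar c z
  set w := slitMap c z
  have hM0 : 0 < M := hs0.trans_le hM
  have hz10 : 0 < ‖z - 1‖ := by linarith
  have hW0 : 0 < ‖deriv (slitMap c) z‖ := by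
    rcases (norm_nonneg (deriv (slitMap c) z)).eq_or_lt with h | h
    · rw [← h] at hC
      have : 0 < ‖w‖ ^ 2 * ‖z - 1‖ ^ 2 := by positivity
      rw [← hC] at this
      norm_num at this
    · exact h
  have hA' := congrArg Real.log hA
  have hC' := congrArg Real.log hC
  rw [Real.log_mul (by positivity) (by positivity), Real.log_mul (by positivity) (by positivity),
    Real.log_mul (by positivity) (by positivity), Real.log_pow, Real.log_pow, Real.log_pow] at hA'
  rw [Real.log_mul (by positivity) (by positivity), Real.log_mul (by positivity) (by positivity),
    Real.log_mul (by positivity) (by positivity), Real.log_mul (by positivity) (by positivity),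
    Real.log_pow, Real.log_pow, Real.log_pow, Real.log_pow] at hC'
  push_cast at hA' hC'
  -- each of the smooth factors varies by little
  have hdc : d / (c / 2) ≤ 2 * c ^ 13 := by
    rw [div_le_iff₀ (by positivity)]
    exact hd14.trans (le_of_eq (by ring))
  have hd7 : d ≤ c ^ 7 := hd14.trans (pow_le_pow_of_le_one hc.le hcle (by norm_num))
  have h13 : c ^ 13 ≤ c ^ 7 := pow_le_pow_of_le_one hc.le hcle (by norm_num)
  have l1 : |Real.log M - Real.log ‖pole c - pole' c‖| ≤ 2 * c ^ 7 := by
    refine (abs_log_sub_log_le (m := c / 2) (by positivity) (by linarith) (by linarith)).trans ?_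
    have : |M - ‖pole c - pole' c‖| / (c / 2) ≤ d / (c / 2) := by gcongr
    linarith
  have l2 : |Real.log ‖z - 1‖ - Real.log ‖pole c - 1‖| ≤ 2 * c ^ 7 := by
    refine (abs_log_sub_log_le (m := c / 2) (by positivity) (by linarith) (by linarith)).trans ?_
    have : |‖z - 1‖ - ‖pole c - 1‖| / (c / 2) ≤ d / (c / 2) := by gcongr
    linarith
  have l3 : |Real.log ‖z + 1‖ - Real.log ‖pole c + 1‖| ≤ 2 * c ^ 7 := by
    have hp : 1 / 2 ≤ ‖pole c + 1‖ := by
      have := (abs_le.1 hzp').2; linarith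
    refine (abs_log_sub_log_le (m := 1 / 2) (by positivity) (by linarith) hp).trans ?_
    rw [div_le_iff₀ (by norm_num)]; linarith
  have l4 : |Real.log ‖w + 1‖ - Real.log 2| ≤ 7 * c ^ 7 := by
    refine (abs_log_sub_log_le (m := 1) one_pos hwp (by norm_num)).trans ?_
    rw [div_one]; linarith
  have l5 : |Real.log ‖w‖| ≤ 7 * c ^ 7 := by
    rw [abs_of_nonneg (Real.log_nonneg hw0.le)]
    have := Real.log_le_sub_one_of_pos (zero_lt_one.trans hw0)
    linarith
  have l6 : |Real.log ‖z‖| ≤ c ^ 7 := by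
    rw [abs_of_nonneg (Real.log_nonneg hz0.le)]
    have := Real.log_le_sub_one_of_pos (zero_lt_one.trans hz0)
    linarith
  have h75 : c ^ 7 ≤ c ^ 5 / 100 := by
    have : c ^ 7 = c ^ 5 * c ^ 2 := by ring
    rw [this]
    have h2 : c ^ 2 ≤ 1 / 100 := (pow_le_pow_left₀ hc.le hc10 2).trans (by norm_num)
    calc c ^ 5 * c ^ 2 ≤ c ^ 5 * (1 / 100) := by gcongr
      _ = c ^ 5 / 100 := by ring
  clear_value d M w
  obtain ⟨m1, n1⟩ := abs_le.1 l1
  obtain ⟨m2, n2⟩ := abs_le.1 l2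
  obtain ⟨m3, n3⟩ := abs_le.1 l3
  obtain ⟨m4, n4⟩ := abs_le.1 l4
  obtain ⟨m5, n5⟩ := abs_le.1 l5
  obtain ⟨m6, n6⟩ := abs_le.1 l6
  clear hX hd14 hd hds hsd l1 l2 l3 l4 l5 l6 hF hz1' hzp' hw2 hA hC
  constructor <;> rw [abs_le] <;> constructor <;> linarith

/-! ### Angles and rotated slit maps -/

lemma norm_circlePoint (s : ℝ) (x : Torus) : ‖circlePoint s x‖ = Real.exp s := by
  rw [circlePoint, norm_mul, Complex.norm_real, Real.norm_of_nonneg (Real.exp_pos s).le,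
    Circle.norm_coe, mul_one]

lemma circlePoint_mul (s t : ℝ) (x y : Torus) :
    circlePoint s x * circlePoint t y = circlePoint (s + t) (x + y) := by
  simp only [circlePoint, AddCircle.toCircle_add, Circle.coe_mul, Real.exp_add, Complex.ofReal_mul]
  ring

lemma circlePoint_zero_zero : circlePoint 0 0 = 1 := by
  simp [circlePoint]

lemma circlePoint_coe (s t : ℝ) :
    circlePoint s (t : Torus) = (Real.exp s : ℂ) * Complex.exp (Complex.I * t) := by
  rw [circlePoint, AddCircle.toCircle_apply_mk, div_self Real.two_pi_pos.ne', one_mul,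
    Circle.coe_exp, mul_comm Complex.I]

lemma circlePoint_beta (c : ℝ) : circlePoint 0 (beta c : Torus) = pole c := by
  rw [circlePoint_coe]; simp [pole]

lemma circlePoint_neg_beta (c : ℝ) : circlePoint 0 (-(beta c : Torus)) = pole' c := by
  rw [← AddCircle.coe_neg, circlePoint_coe]; simp [pole']

lemma norm_circlePoint_zero_mul (x : Torus) (z : ℂ) : ‖circlePoint 0 x * z‖ = ‖z‖ := by
  rw [norm_mul, norm_circlePoint, Real.exp_zero, one_mul]

lemma circlePoint_mul_neg_cancel (x : Torus) (z : ℂ) :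
    circlePoint 0 x * (circlePoint 0 (-x) * z) = z := by
  rw [← mul_assoc, circlePoint_mul]; simp [circlePoint_zero_zero]

/-- Chords of the unit circle are comparable to arcs. -/
lemma chord_bounds (x : Torus) :
    2 / π * ‖x‖ ≤ ‖circlePoint 0 x - 1‖ ∧ ‖circlePoint 0 x - 1‖ ≤ ‖x‖ := by
  have hx : x ∈ ((↑) : ℝ → Torus) '' Ico (-π) (-π + 2 * π) := by
    rw [AddCircle.coe_image_Ico_eq]; trivial
  obtain ⟨t, ht, rfl⟩ := hx
  have htπ : |t| ≤ π := abs_le.2 ⟨ht.1, by linarith [ht.2]⟩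
  have hn : ‖(t : Torus)‖ = |t| := by
    rw [AddCircle.norm_coe_eq_abs_iff _ Real.two_pi_pos.ne', abs_of_pos Real.two_pi_pos]
    linarith
  have he : ‖circlePoint 0 (t : Torus) - 1‖ = 2 * |Real.sin (t / 2)| := by
    rw [circlePoint_coe]
    simp only [Real.exp_zero, Complex.ofReal_one, one_mul]
    rw [Complex.norm_exp_I_mul_ofReal_sub_one, Real.norm_eq_abs, abs_mul, abs_two]
  have h2 : |t / 2| = |t| / 2 := by rw [abs_div, abs_two]
  rw [hn, he]
  constructor
  · have := Real.mul_abs_le_abs_sin (x := t / 2) (by rw [h2]; linarith)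
    rw [h2] at this
    linarith
  · have := Real.abs_sin_le_abs (x := t / 2)
    rw [h2] at this
    linarith

lemma norm_circlePoint_sub (x y : Torus) :
    ‖circlePoint 0 x - circlePoint 0 y‖ = ‖circlePoint 0 (x - y) - 1‖ := by
  rw [← norm_circlePoint_zero_mul y (circlePoint 0 (x - y) - 1), mul_sub, circlePoint_mul]
  simp

lemma norm_circlePoint_sub_le (x y : Torus) :
    ‖circlePoint 0 x - circlePoint 0 y‖ ≤ ‖x - y‖ := by
  rw [norm_circlePoint_sub]; exact (chord_bounds _).2

/-- The distance of `z` to the two singular points of the slit map attached at the angle `x`. -/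
def poleDistAt (c : ℝ) (x : Torus) (z : ℂ) : ℝ := poleDist c (circlePoint 0 (-x) * z)

lemma norm_rot_sub_pole (c : ℝ) (x : Torus) (z : ℂ) :
    ‖circlePoint 0 (-x) * z - pole c‖ = ‖z - circlePoint 0 (x + (beta c : Torus))‖ := by
  rw [← norm_circlePoint_zero_mul x, mul_sub, circlePoint_mul_neg_cancel, ← circlePoint_beta,
    circlePoint_mul, zero_add]

lemma norm_rot_sub_pole' (c : ℝ) (x : Torus) (z : ℂ) :
    ‖circlePoint 0 (-x) * z - pole' c‖ = ‖z - circlePoint 0 (x - (beta c : Torus))‖ := by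
  rw [← norm_circlePoint_zero_mul x, mul_sub, circlePoint_mul_neg_cancel, ← circlePoint_neg_beta,
    circlePoint_mul, zero_add, ← sub_eq_add_neg]

lemma poleDistAt_eq (c : ℝ) (x : Torus) (z : ℂ) :
    poleDistAt c x z = min ‖z - circlePoint 0 (x + (beta c : Torus))‖
      ‖z - circlePoint 0 (x - (beta c : Torus))‖ := by
  rw [poleDistAt, poleDist, norm_rot_sub_pole, norm_rot_sub_pole']

lemma rot_mem_extDisc {z : ℂ} (hz : z ∈ extDisc) (x : Torus) :
    circlePoint 0 x * z ∈ extDisc := by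
  change 1 < ‖_‖
  rwa [norm_circlePoint_zero_mul]

lemma mem_extDisc_of_le {σ : ℝ} (hσ : 0 < σ) {z : ℂ} (hz : 1 + σ ≤ ‖z‖) : z ∈ extDisc := by
  change 1 < ‖z‖; linarith

lemma rotMap_mem_extDisc {c : ℝ} (hc : 0 < c) (x : Torus) {z : ℂ} (hz : z ∈ extDisc) :
    rotMap c x z ∈ extDisc :=
  rot_mem_extDisc (slitMap_mem_extDisc hc (rot_mem_extDisc hz _)) _

lemma norm_le_norm_rotMap {c : ℝ} (hc : 0 < c) (x : Torus) {z : ℂ} (hz : z ∈ extDisc) :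
    ‖z‖ ≤ ‖rotMap c x z‖ := by
  rw [rotMap, norm_circlePoint_zero_mul, ← norm_circlePoint_zero_mul (-x) z]
  exact norm_le_norm_slitMap hc (rot_mem_extDisc hz _)

lemma norm_rotMap_sub (c : ℝ) (x : Torus) (z : ℂ) :
    ‖rotMap c x z - circlePoint 0 x‖ = ‖slitMap c (circlePoint 0 (-x) * z) - 1‖ := by
  rw [rotMap, ← norm_circlePoint_zero_mul x (slitMap c (circlePoint 0 (-x) * z) - 1), mul_sub,
    mul_one]

lemma hasDerivAt_rotMap {c : ℝ} (hc : 0 < c) (x : Torus) {z : ℂ} (hz : z ∈ extDisc) :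
    HasDerivAt (rotMap c x)
      (circlePoint 0 x * (deriv (slitMap c) (circlePoint 0 (-x) * z) * circlePoint 0 (-x))) z := by
  have h1 : HasDerivAt (fun z : ℂ => circlePoint 0 (-x) * z) (circlePoint 0 (-x)) z := by
    simpa using (hasDerivAt_id z).const_mul (circlePoint 0 (-x))
  have h2 := (differentiableAt_slitMap hc (rot_mem_extDisc hz (-x))).hasDerivAt
  exact (h2.comp z h1).const_mul _

lemma differentiableAt_clusterMap {c : ℝ} (hc : 0 < c) (θ : ℕ → Torus) (n : ℕ) :
    ∀ {z : ℂ}, z ∈ extDisc → DifferentiableAt ℂ (clusterMap c θ n) z := by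
  induction n with
  | zero => intro z _; exact differentiableAt_id
  | succ n ih =>
    intro z hz
    exact (ih (rotMap_mem_extDisc hc _ hz)).comp z (hasDerivAt_rotMap hc _ hz).differentiableAt

lemma norm_deriv_clusterMap_succ {c : ℝ} (hc : 0 < c) (θ : ℕ → Torus) (n : ℕ) {z : ℂ}
    (hz : z ∈ extDisc) :
    ‖deriv (clusterMap c θ (n + 1)) z‖ =
      ‖deriv (clusterMap c θ n) (rotMap c (θ (n + 1)) z)‖ *
        ‖deriv (slitMap c) (circlePoint 0 (-θ (n + 1)) * z)‖ := by
  have h1 := (differentiableAt_clusterMap hc θ n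
    (rotMap_mem_extDisc hc (θ (n + 1)) hz)).hasDerivAt
  have h2 := (h1.comp z (hasDerivAt_rotMap hc (θ (n + 1)) hz)).deriv
  rw [show clusterMap c θ (n + 1) = clusterMap c θ n ∘ rotMap c (θ (n + 1)) from rfl, h2,
    norm_mul, norm_circlePoint_zero_mul, norm_mul (deriv (slitMap c) _), norm_circlePoint,
    Real.exp_zero, mul_one]

/-! ### Chains of slits attached at singular points -/

/-- The angles `θ 1, …, θ n` form a chain: each of them is within `D` of one of the two angles
sent by the preceding slit map to the base of its slit. -/
def IsChain (c D : ℝ) (θ : ℕ → Torus) (n : ℕ) : Prop :=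
  ∀ m, 1 ≤ m → m < n →
    min ‖θ (m + 1) - (θ m + (beta c : Torus))‖ ‖θ (m + 1) - (θ m - (beta c : Torus))‖ ≤ D

lemma IsChain.of_succ {c D : ℝ} {θ : ℕ → Torus} {n : ℕ} (h : IsChain c D θ (n + 1)) :
    IsChain c D θ n := fun m hm hmn => h m hm (hmn.trans n.lt_succ_self)

/-- If `y` is close to a singular angle of the slit at `x`, then, close to `e ^ (i y)`, the
distance to the singular points of the slit at `x` is about the distance to `e ^ (i y)`. -/
lemma abs_poleDistAt_sub_le {c D : ℝ} (hc : 0 < c) (hc1 : c ≤ 1 / 10) {x y : Torus}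
    (hxy : min ‖y - (x + (beta c : Torus))‖ ‖y - (x - (beta c : Torus))‖ ≤ D) {w : ℂ}
    (hw : ‖w - circlePoint 0 y‖ + D ≤ √c) :
    |poleDistAt c x w - ‖w - circlePoint 0 y‖| ≤ D := by
  rw [poleDistAt_eq]
  have hp : 2 * √c ≤ ‖circlePoint 0 (x + (beta c : Torus)) -
      circlePoint 0 (x - (beta c : Torus))‖ := by
    have := (norm_pole_sub_pole' hc hc1).1
    rwa [← norm_circlePoint_zero_mul x, mul_sub, ← circlePoint_beta, ← circlePoint_neg_beta,
      circlePoint_mul, circlePoint_mul, zero_add, ← sub_eq_add_neg] at this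
  set P := circlePoint 0 (x + (beta c : Torus))
  set P' := circlePoint 0 (x - (beta c : Torus))
  have h0 : ‖P - P'‖ ≤ ‖w - P‖ + ‖w - P'‖ := by
    rw [norm_sub_rev w P]; exact norm_sub_le_norm_sub_add_norm_sub _ _ _
  have key : ∀ v : Torus, ‖y - v‖ ≤ D →
      |‖w - circlePoint 0 v‖ - ‖w - circlePoint 0 y‖| ≤ D := by
    intro v hv
    refine (abs_norm_sub_norm_le _ _).trans ?_
    refine le_trans (le_of_eq ?_) ((norm_circlePoint_sub_le y v).trans hv)
    congr 1; ring
  rcases min_le_iff.1 hxy with h | h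
  · have h1 := key _ h
    have h2 := (abs_le.1 h1).2
    rwa [min_eq_left (by change ‖w - P‖ - _ ≤ _ at h2; linarith)]
  · have h1 := key _ h
    have h2 := (abs_le.1 h1).2
    rwa [min_eq_right (by change ‖w - P'‖ - _ ≤ _ at h2; linarith)]

/-- One step of the chain: a point at distance `d` from the singular points of the slit at `y` is
sent to a point whose distance to the singular points of the preceding slit is of order `√d`. -/
lemma poleDistAt_rotMap {c D σ : ℝ} (hc : 0 < c) (hc1 : c ≤ 1 / 10 ^ 4) (hσ : 0 < σ)
    (hD : D ≤ c ^ 4 * (√c * √σ)) {x y : Torus}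
    (hxy : min ‖y - (x + (beta c : Torus))‖ ‖y - (x - (beta c : Torus))‖ ≤ D) {z : ℂ}
    (hz : 1 + σ ≤ ‖z‖) (hd : poleDistAt c y z ≤ c ^ 14) :
    |poleDistAt c x (rotMap c y z) - ‖rotMap c y z - circlePoint 0 y‖|
        ≤ c ^ 4 * ‖rotMap c y z - circlePoint 0 y‖ ∧
      c * √(poleDistAt c y z) ≤ poleDistAt c x (rotMap c y z) ∧
      poleDistAt c x (rotMap c y z) ≤ c⁻¹ * √(poleDistAt c y z) := by
  have hcle : c ≤ 1 := by linarith
  have hd2 : poleDist c (circlePoint 0 (-y) * z) ≤ c ^ 2 :=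
    hd.trans (pow_le_pow_of_le_one hc.le hcle (by norm_num))
  have hu : circlePoint 0 (-y) * z ∈ extDisc := rot_mem_extDisc (mem_extDisc_of_le hσ hz) _
  obtain ⟨h1, h2, -⟩ := norm_slitMap_sub_one_bounds hc hc1 hu hd2
  have hs := (near_pole_bounds hc hc1 hd2).1
  have hdσ : σ ≤ poleDistAt c y z := le_poleDist (by rwa [norm_circlePoint_zero_mul])
  rw [← norm_rotMap_sub] at h1 h2
  change √c * √(poleDistAt c y z) ≤ _ at h1
  change _ ≤ 7 * √(poleDistAt c y z) at h2
  have hs0 : 0 < √c := Real.sqrt_pos.2 hc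
  have hss := Real.sq_sqrt hc.le
  have hsσ : √σ ≤ √(poleDistAt c y z) := Real.sqrt_le_sqrt hdσ
  have hsd : √(poleDistAt c y z) ≤ c ^ 7 := by
    rw [Real.sqrt_le_left (by positivity)]
    exact hd.trans (le_of_eq (by ring))
  set X := ‖rotMap c y z - circlePoint 0 y‖
  set s := √(poleDistAt c y z)
  have hX0 : 0 ≤ X := norm_nonneg _
  have hsn : 0 ≤ s := Real.sqrt_nonneg _
  have hDX : D ≤ c ^ 4 * X := by
    refine hD.trans ?_
    have : √c * √σ ≤ X := le_trans (by gcongr) h1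
    gcongr
  have hc4 : c ^ 4 ≤ 1 / 2 := by
    have : c ^ 4 ≤ (1 / 10 ^ 4) ^ 4 := by gcongr
    exact this.trans (by norm_num)
  have hDX2 : D ≤ X / 2 := hDX.trans (by nlinarith)
  have hsc : s ≤ √c / 100 := by
    have : c ^ 7 ≤ c ^ 1 := pow_le_pow_of_le_one hc.le hcle (by norm_num)
    nlinarith
  have hnext : |poleDistAt c x (rotMap c y z) - X| ≤ D :=
    abs_poleDistAt_sub_le hc (by linarith) hxy (by change X + D ≤ _; linarith)
  obtain ⟨h3, h4⟩ := abs_le.1 hnext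
  have hcs : c ≤ √c / 2 := by nlinarith
  refine ⟨hnext.trans hDX, ?_, ?_⟩
  · have : c * s ≤ √c / 2 * s := by gcongr
    linarith
  · have h14 : 14 ≤ c⁻¹ := by
      rw [le_inv_comm₀ (by norm_num) hc]; linarith
    have : 14 * s ≤ c⁻¹ * s := by gcongr
    linarith

/-- The radius of the discs about the singular points in which a chain of length `n` is followed
down to its start. The exponent makes `c⁻¹ * √d ≤ chainRadius c n` follow from
`d ≤ chainRadius c (n + 1)`. -/
def chainRadius (c : ℝ) (n : ℕ) : ℝ := c ^ (8 * 2 ^ n - 2)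

lemma chainRadius_le {c : ℝ} (hc : 0 < c) (hc1 : c ≤ 1) {n : ℕ} (hn : 1 ≤ n) :
    chainRadius c n ≤ c ^ 14 := by
  apply pow_le_pow_of_le_one hc.le hc1
  have : 2 ^ 1 ≤ 2 ^ n := Nat.pow_le_pow_right (by norm_num) hn
  omega

lemma inv_mul_sqrt_le_chainRadius {c : ℝ} (hc : 0 < c) {n : ℕ} {d : ℝ}
    (hd : d ≤ chainRadius c (n + 1)) : c⁻¹ * √d ≤ chainRadius c n := by
  have hpos : 1 ≤ 2 ^ n := Nat.one_le_two_pow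
  have h1 : √d ≤ c ^ (8 * 2 ^ n - 1) := by
    rw [Real.sqrt_le_left (by positivity), ← pow_mul]
    refine hd.trans (le_of_eq ?_)
    rw [chainRadius]; congr 1; rw [pow_succ]; omega
  rw [inv_mul_le_iff₀ hc, chainRadius, ← pow_succ']
  refine h1.trans (le_of_eq ?_)
  congr 1; omega

/-- The exponent `1 - 2 ^ (-n)` with which the derivative of the cluster map of a chain of `n`
slits blows up. -/
def chainExp (n : ℕ) : ℝ := 1 - (1 / 2) ^ n

lemma chainExp_nonneg (n : ℕ) : 0 ≤ chainExp n := by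
  have : (1 / 2 : ℝ) ^ n ≤ 1 := pow_le_one₀ (by norm_num) (by norm_num)
  unfold chainExp; linarith

lemma chainExp_lt_one (n : ℕ) : chainExp n < 1 := by
  have : (0 : ℝ) < (1 / 2) ^ n := by positivity
  unfold chainExp; linarith

lemma half_le_chainExp {n : ℕ} (hn : 1 ≤ n) : 1 / 2 ≤ chainExp n := by
  have : (1 / 2 : ℝ) ^ n ≤ (1 / 2) ^ 1 :=
    pow_le_pow_of_le_one (by norm_num) (by norm_num) hn
  unfold chainExp; linarith

lemma rpow_chainExp_succ {d : ℝ} (hd : 0 < d) (n : ℕ) :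
    d ^ (-chainExp (n + 1)) = √d ^ (-chainExp n) * (√d)⁻¹ := by
  rw [Real.sqrt_eq_rpow, ← Real.rpow_mul hd.le, ← Real.rpow_neg hd.le, ← Real.rpow_add hd]
  congr 1
  unfold chainExp
  rw [pow_succ]; ring

lemma rpow_neg_chainExp_bounds {c s d : ℝ} (hc : 0 < c) (hc1 : c ≤ 1) (hs : 0 < s)
    (h1 : c * s ≤ d) (h2 : d ≤ c⁻¹ * s) (n : ℕ) :
    c * s ^ (-chainExp n) ≤ d ^ (-chainExp n) ∧ d ^ (-chainExp n) ≤ c⁻¹ * s ^ (-chainExp n) := by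
  have he := chainExp_nonneg n
  have he1 := (chainExp_lt_one n).le
  have hd : 0 < d := lt_of_lt_of_le (by positivity) h1
  have hce : c ≤ c ^ chainExp n := by
    simpa using Real.rpow_le_rpow_of_exponent_ge hc hc1 he1
  constructor
  · calc c * s ^ (-chainExp n) ≤ c ^ chainExp n * s ^ (-chainExp n) := by gcongr
      _ = (c⁻¹ * s) ^ (-chainExp n) := by
        rw [Real.mul_rpow (by positivity) hs.le, Real.inv_rpow hc.le, Real.rpow_neg hc.le, inv_inv]
      _ ≤ d ^ (-chainExp n) := Real.rpow_le_rpow_of_nonpos hd h2 (by linarith)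
  · calc d ^ (-chainExp n) ≤ (c * s) ^ (-chainExp n) :=
        Real.rpow_le_rpow_of_nonpos (by positivity) h1 (by linarith)
      _ = (c ^ chainExp n)⁻¹ * s ^ (-chainExp n) := by
        rw [Real.mul_rpow hc.le hs.le, Real.rpow_neg hc.le]
      _ ≤ c⁻¹ * s ^ (-chainExp n) := by gcongr

/-- Close to a singular point of the last slit, the whole orbit stays close to the singular
points, and the derivative of the cluster map has size `d ^ (-(1 - 2 ^ (-n)))` up to powers
of `c`. -/
lemma norm_deriv_clusterMap_near {c D σ : ℝ} (hc : 0 < c) (hc1 : c ≤ 1 / 10 ^ 4) (hσ : 0 < σ)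
    (hD : D ≤ c ^ 4 * (√c * √σ)) (θ : ℕ → Torus) {n : ℕ} (hn : 1 ≤ n)
    (hθ : IsChain c D θ n) {z : ℂ} (hz : 1 + σ ≤ ‖z‖)
    (hd : poleDistAt c (θ n) z ≤ chainRadius c n) :
    c ^ (3 * n) * poleDistAt c (θ n) z ^ (-chainExp n) ≤ ‖deriv (clusterMap c θ n) z‖ ∧
      ‖deriv (clusterMap c θ n) z‖ ≤ (c ^ (3 * n))⁻¹ * poleDistAt c (θ n) z ^ (-chainExp n) := by
  have hcle : c ≤ 1 := by linarith
  induction n, hn using Nat.le_induction generalizing z with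
  | base =>
    have hze := mem_extDisc_of_le hσ hz
    have hd0 : 0 < poleDistAt c (θ 1) z := poleDist_pos (rot_mem_extDisc hze _)
    have hd2 : poleDistAt c (θ 1) z ≤ c ^ 2 := (hd.trans (chainRadius_le hc hcle le_rfl)).trans
      (pow_le_pow_of_le_one hc.le hcle (by norm_num))
    have hf := norm_deriv_slitMap_bounds hc hc1 (rot_mem_extDisc hze (-θ 1)) hd2
    have hs0 := Real.sqrt_pos.2 hd0
    have e := norm_deriv_clusterMap_succ hc θ 0 hze
    rw [show clusterMap c θ 0 = id from rfl, deriv_id, norm_one, one_mul, zero_add] at e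
    rw [e]
    have e2 : poleDistAt c (θ 1) z ^ (-chainExp 1) = (√(poleDistAt c (θ 1) z))⁻¹ := by
      have := rpow_chainExp_succ hd0 0
      rw [this, show chainExp 0 = 0 by simp [chainExp], neg_zero, Real.rpow_zero, one_mul]
    rw [e2, ← div_eq_mul_inv, ← div_eq_mul_inv, div_le_iff₀ hs0, le_div_iff₀ hs0]
    have h3 : c ^ (3 * 1) ≤ c := by
      simpa using pow_le_pow_of_le_one hc.le hcle (show 1 ≤ 3 * 1 by norm_num)
    refine ⟨h3.trans hf.1, hf.2.trans ?_⟩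
    gcongr
  | succ n hn ih =>
    have hze := mem_extDisc_of_le hσ hz
    have hd0 : 0 < poleDistAt c (θ (n + 1)) z := poleDist_pos (rot_mem_extDisc hze _)
    have hd14 := hd.trans (chainRadius_le hc hcle (by omega))
    have hd2 : poleDistAt c (θ (n + 1)) z ≤ c ^ 2 := hd14.trans
      (pow_le_pow_of_le_one hc.le hcle (by norm_num))
    obtain ⟨hf1, hf2⟩ := norm_deriv_slitMap_bounds hc hc1 (rot_mem_extDisc hze (-θ (n + 1))) hd2
    obtain ⟨-, ht1, ht2⟩ := poleDistAt_rotMap hc hc1 hσ hD (hθ n hn n.lt_succ_self) hz hd14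
    obtain ⟨i1, i2⟩ := ih hθ.of_succ (hz.trans (norm_le_norm_rotMap hc (θ (n + 1)) hze))
      (ht2.trans (inv_mul_sqrt_le_chainRadius hc hd))
    have hs0 := Real.sqrt_pos.2 hd0
    obtain ⟨j1, j2⟩ := rpow_neg_chainExp_bounds hc hcle hs0 ht1 ht2 n
    rw [norm_deriv_clusterMap_succ hc θ n hze, rpow_chainExp_succ hd0]
    change c ≤ _ * √(poleDistAt c (θ (n + 1)) z) at hf1
    change _ * √(poleDistAt c (θ (n + 1)) z) ≤ c⁻¹ at hf2
    set s := √(poleDistAt c (θ (n + 1)) z)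
    rw [← div_le_iff₀ hs0] at hf1
    rw [← le_div_iff₀ hs0] at hf2
    set F := ‖deriv (slitMap c) (circlePoint 0 (-θ (n + 1)) * z)‖
    set G := ‖deriv (clusterMap c θ n) (rotMap c (θ (n + 1)) z)‖
    set E := s ^ (-chainExp n)
    have hE : 0 < E := Real.rpow_pos_of_pos hs0 _
    constructor
    · calc c ^ (3 * (n + 1)) * (E * s⁻¹) ≤ c ^ (3 * n + 2) * (E * s⁻¹) := by
            gcongr ?_ * _
            exact pow_le_pow_of_le_one hc.le hcle (by omega)
        _ = (c ^ (3 * n) * (c * E)) * (c / s) := by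
          rw [pow_add]; field_simp
        _ ≤ G * F := by
          gcongr
          exact le_trans (by gcongr) i1
    · calc G * F ≤ ((c ^ (3 * n))⁻¹ * (c⁻¹ * E)) * (c⁻¹ / s) := by
            gcongr
            exact i2.trans (by gcongr)
        _ = (c ^ (3 * n + 2))⁻¹ * (E * s⁻¹) := by
          rw [pow_add]; field_simp
        _ ≤ (c ^ (3 * (n + 1)))⁻¹ * (E * s⁻¹) := by
          gcongr ?_ * _
          apply inv_anti₀ (by positivity)
          exact pow_le_pow_of_le_one hc.le hcle (by omega)

/-- If two points are at about the same distance from the singular points of the last slit, then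
the derivatives of the cluster map at these points have about the same modulus: along the two
orbits the discrepancy of the logarithms of the distances is halved by each slit map, which makes
up for the new error that comes with each slit. -/
lemma abs_log_norm_deriv_clusterMap_sub_le {c D σ : ℝ} (hc : 0 < c) (hc1 : c ≤ 1 / 10 ^ 4)
    (hσ : 0 < σ) (hD : D ≤ c ^ 4 * (√c * √σ)) (θ : ℕ → Torus) {n : ℕ} (hn : 1 ≤ n)
    (hθ : IsChain c D θ n) {z z' : ℂ} (hz : 1 + σ ≤ ‖z‖) (hz' : 1 + σ ≤ ‖z'‖)
    (hd : poleDistAt c (θ n) z ≤ chainRadius c n) (hd' : poleDistAt c (θ n) z' ≤ chainRadius c n)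
    (hlog : |Real.log (poleDistAt c (θ n) z) - Real.log (poleDistAt c (θ n) z')| ≤ 10 * c ^ 4) :
    |Real.log ‖deriv (clusterMap c θ n) z‖ - Real.log ‖deriv (clusterMap c θ n) z'‖|
      ≤ 6 * n * c ^ 4 := by
  have hcle : c ≤ 1 := by linarith
  have h54 : c ^ 5 ≤ c ^ 4 := pow_le_pow_of_le_one hc.le hcle (by norm_num)
  obtain ⟨K₁, K₂, hK⟩ := log_slitMap_near hc hc1
  -- the two estimates for a single slit map
  have step : ∀ (x : Torus) (z z' : ℂ), 1 + σ ≤ ‖z‖ → 1 + σ ≤ ‖z'‖ → poleDistAt c x z ≤ c ^ 14 →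
      poleDistAt c x z' ≤ c ^ 14 →
      |Real.log (poleDistAt c x z) - Real.log (poleDistAt c x z')| ≤ 10 * c ^ 4 →
      |Real.log ‖deriv (slitMap c) (circlePoint 0 (-x) * z)‖
        - Real.log ‖deriv (slitMap c) (circlePoint 0 (-x) * z')‖| ≤ 6 * c ^ 4 ∧
      |Real.log ‖rotMap c x z - circlePoint 0 x‖ - Real.log ‖rotMap c x z' - circlePoint 0 x‖|
        ≤ 5 * c ^ 4 + c ^ 5 / 2 := by
    intro x z z' hz hz' hd hd' hlog
    obtain ⟨a1, a2⟩ := hK _ (rot_mem_extDisc (mem_extDisc_of_le hσ hz) (-x)) hd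
    obtain ⟨b1, b2⟩ := hK _ (rot_mem_extDisc (mem_extDisc_of_le hσ hz') (-x)) hd'
    rw [norm_rotMap_sub, norm_rotMap_sub]
    change |_ + Real.log (poleDistAt c x z) / 2 - _| ≤ _ at a1
    change |_ + Real.log (poleDistAt c x z') / 2 - _| ≤ _ at b1
    change |_ - Real.log (poleDistAt c x z) / 2 - _| ≤ _ at a2
    change |_ - Real.log (poleDistAt c x z') / 2 - _| ≤ _ at b2
    obtain ⟨a3, a4⟩ := abs_le.1 a1
    obtain ⟨a5, a6⟩ := abs_le.1 a2
    obtain ⟨b3, b4⟩ := abs_le.1 b1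
    obtain ⟨b5, b6⟩ := abs_le.1 b2
    obtain ⟨l1, l2⟩ := abs_le.1 hlog
    constructor <;> rw [abs_le] <;> constructor <;> linarith
  induction n, hn using Nat.le_induction generalizing z z' with
  | base =>
    have h14 := chainRadius_le hc hcle le_rfl
    have h := (step (θ 1) z z' hz hz' (hd.trans h14) (hd'.trans h14) hlog).1
    have e := norm_deriv_clusterMap_succ hc θ 0 (mem_extDisc_of_le hσ hz)
    have e' := norm_deriv_clusterMap_succ hc θ 0 (mem_extDisc_of_le hσ hz')
    rw [show clusterMap c θ 0 = id from rfl, deriv_id, norm_one, one_mul, zero_add] at e e'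
    rw [e, e']
    simpa using h
  | succ n hn ih =>
    have hze := mem_extDisc_of_le hσ hz
    have hze' := mem_extDisc_of_le hσ hz'
    have h14 := chainRadius_le hc hcle (show 1 ≤ n + 1 by omega)
    obtain ⟨s1, s2⟩ := step (θ (n + 1)) z z' hz hz' (hd.trans h14) (hd'.trans h14) hlog
    have hch := hθ n hn n.lt_succ_self
    obtain ⟨t1, -, t2⟩ := poleDistAt_rotMap hc hc1 hσ hD hch hz (hd.trans h14)
    obtain ⟨t1', -, t2'⟩ := poleDistAt_rotMap hc hc1 hσ hD hch hz' (hd'.trans h14)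
    have hw := hz.trans (norm_le_norm_rotMap hc (θ (n + 1)) hze)
    have hw' := hz'.trans (norm_le_norm_rotMap hc (θ (n + 1)) hze')
    have r := t2.trans (inv_mul_sqrt_le_chainRadius hc hd)
    have r' := t2'.trans (inv_mul_sqrt_le_chainRadius hc hd')
    -- replacing the base of the slit by the singular point next to it costs little
    have base : ∀ X Y : ℝ, 0 < X → |Y - X| ≤ c ^ 4 * X →
        |Real.log Y - Real.log X| ≤ 2 * c ^ 4 := by
      intro X Y hX hY
      have h4 : c ^ 4 ≤ 1 / 2 := by
        have : c ^ 4 ≤ (1 / 10 ^ 4) ^ 4 := by gcongr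
        exact this.trans (by norm_num)
      have h5 : c ^ 4 * X ≤ 1 / 2 * X := by gcongr
      have h6 := (abs_le.1 hY).1
      refine (abs_log_sub_log_le (m := X / 2) (by positivity) (by linarith) (by linarith)).trans ?_
      rw [div_le_iff₀ (by positivity)]
      linarith
    have hpos : ∀ z ∈ extDisc, 0 < ‖rotMap c (θ (n + 1)) z - circlePoint 0 (θ (n + 1))‖ := by
      intro z hz
      rw [norm_rotMap_sub]
      exact norm_pos_iff.2 (sub_one_ne_zero_of_mem_extDisc
        (slitMap_mem_extDisc hc (rot_mem_extDisc hz _)))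
    have b := abs_le.1 (base _ _ (hpos z hze) t1)
    have b' := abs_le.1 (base _ _ (hpos z' hze') t1')
    have s2' := abs_le.1 s2
    have hlog' : |Real.log (poleDistAt c (θ n) (rotMap c (θ (n + 1)) z)) -
        Real.log (poleDistAt c (θ n) (rotMap c (θ (n + 1)) z'))| ≤ 10 * c ^ 4 := by
      rw [abs_le]; constructor <;> linarith [b.1, b.2, b'.1, b'.2, s2'.1, s2'.2]
    have hi := abs_le.1 (ih hθ.of_succ hw hw' r r' hlog')
    have hs1 := abs_le.1 s1
    have hG : ∀ w, 1 + σ ≤ ‖w‖ → poleDistAt c (θ n) w ≤ chainRadius c n →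
        ‖deriv (clusterMap c θ n) w‖ ≠ 0 := by
      intro w hw hr
      have h0 : 0 < poleDistAt c (θ n) w :=
        poleDist_pos (rot_mem_extDisc (mem_extDisc_of_le hσ hw) _)
      have := (norm_deriv_clusterMap_near hc hc1 hσ hD θ hn hθ.of_succ hw hr).1
      exact (lt_of_lt_of_le (mul_pos (by positivity) (Real.rpow_pos_of_pos h0 _)) this).ne'
    have hF : ∀ w, w ∈ extDisc → poleDistAt c (θ (n + 1)) w ≤ c ^ 14 →
        ‖deriv (slitMap c) (circlePoint 0 (-θ (n + 1)) * w)‖ ≠ 0 := by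
      intro w hw hr h0
      have := (norm_deriv_slitMap_bounds hc hc1 (rot_mem_extDisc hw (-θ (n + 1)))
        (hr.trans (pow_le_pow_of_le_one hc.le hcle (by norm_num)))).1
      rw [h0, zero_mul] at this
      linarith
    rw [norm_deriv_clusterMap_succ hc θ n hze, norm_deriv_clusterMap_succ hc θ n hze',
      Real.log_mul (hG _ hw r) (hF _ hze (hd.trans h14)),
      Real.log_mul (hG _ hw' r') (hF _ hze' (hd'.trans h14))]
    push_cast
    rw [abs_le]
    constructor <;> linarith [hi.1, hi.2, hs1.1, hs1.2]

/-! ### An upper bound for the derivative of the cluster map -/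

/-- The sum, over the slits `k ≤ n`, of the singularities `d_k ^ (-ν (1 - 2 ^ (-k)))`, where `d_k`
is the distance of the image of `z` under the slit maps `n, …, k + 1` to the singular points of the
slit `k`; with an additional summand `1`. -/
def singularSum (c ν : ℝ) (θ : ℕ → Torus) : ℕ → ℂ → ℝ
  | 0, _ => 1
  | n + 1, z => poleDistAt c (θ (n + 1)) z ^ (-(ν * chainExp (n + 1)))
      + singularSum c ν θ n (rotMap c (θ (n + 1)) z)

lemma singularSum_nonneg (c ν : ℝ) (θ : ℕ → Torus) (n : ℕ) :
    ∀ z, 0 ≤ singularSum c ν θ n z := by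
  induction n with
  | zero => intro z; exact zero_le_one
  | succ n ih =>
    intro z
    exact add_nonneg (Real.rpow_nonneg (poleDist_nonneg _ _) _) (ih _)

/-- Either the orbit of `z` stays away from the singular points, or from the first time it comes
close to one of them it follows the chain. -/
lemma norm_deriv_clusterMap_rpow_le {c D σ ν : ℝ} (hc : 0 < c) (hc1 : c ≤ 1 / 10 ^ 4) (hσ : 0 < σ)
    (hD : D ≤ c ^ 4 * (√c * √σ)) (hν : 0 < ν) (θ : ℕ → Torus) {n : ℕ}
    (hθ : IsChain c D θ n) {z : ℂ} (hz : 1 + σ ≤ ‖z‖) :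
    ‖deriv (clusterMap c θ n) z‖ ^ ν ≤ ((c ^ (8 * 4 ^ n))⁻¹) ^ ν * singularSum c ν θ n z := by
  have hcle : c ≤ 1 := by linarith
  induction n generalizing z with
  | zero =>
    rw [show clusterMap c θ 0 = id from rfl, deriv_id, norm_one, Real.one_rpow, singularSum,
      mul_one]
    apply Real.one_le_rpow _ hν.le
    exact (one_le_inv₀ (by positivity)).2 (pow_le_one₀ hc.le hcle)
  | succ n ih =>
    have hze := mem_extDisc_of_le hσ hz
    have hd0 : 0 < poleDistAt c (θ (n + 1)) z := poleDist_pos (rot_mem_extDisc hze _)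
    have h24 : 2 ^ n ≤ 4 ^ n := Nat.pow_le_pow_left (by norm_num) n
    have h1n : 1 ≤ 2 ^ n := Nat.one_le_two_pow
    have hn2 : n < 2 ^ n := Nat.lt_two_pow_self
    have hS := singularSum_nonneg c ν θ n (rotMap c (θ (n + 1)) z)
    rw [singularSum]
    rcases le_total (poleDistAt c (θ (n + 1)) z) (chainRadius c (n + 1)) with hd | hd
    · have h := (norm_deriv_clusterMap_near hc hc1 hσ hD θ (by omega) hθ hz hd).2
      calc ‖deriv (clusterMap c θ (n + 1)) z‖ ^ ν
          ≤ ((c ^ (3 * (n + 1)))⁻¹ * poleDistAt c (θ (n + 1)) z ^ (-chainExp (n + 1))) ^ ν := by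
            gcongr
        _ = ((c ^ (3 * (n + 1)))⁻¹) ^ ν *
              poleDistAt c (θ (n + 1)) z ^ (-(ν * chainExp (n + 1))) := by
            rw [Real.mul_rpow (by positivity) (by positivity), ← Real.rpow_mul hd0.le]
            congr 2; ring
        _ ≤ ((c ^ (8 * 4 ^ (n + 1)))⁻¹) ^ ν *
              (poleDistAt c (θ (n + 1)) z ^ (-(ν * chainExp (n + 1))) +
                singularSum c ν θ n (rotMap c (θ (n + 1)) z)) := by
            gcongr ?_ ^ ν * ?_
            · apply inv_anti₀ (by positivity)
              apply pow_le_pow_of_le_one hc.le hcle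
              rw [pow_succ]; omega
            · linarith
    · have hr0 : 0 < chainRadius c (n + 1) := pow_pos hc _
      have hr1 : chainRadius c (n + 1) ≤ 1 := pow_le_one₀ hc.le hcle
      have h1 := norm_deriv_slitMap_le hc (by linarith) (rot_mem_extDisc hze (-θ (n + 1)))
        hr0 hr1 hd
      have h2 := ih hθ.of_succ (hz.trans (norm_le_norm_rotMap hc (θ (n + 1)) hze))
      rw [norm_deriv_clusterMap_succ hc θ n hze, Real.mul_rpow (norm_nonneg _) (norm_nonneg _)]
      have h3 : (c ^ (8 * 4 ^ n))⁻¹ * (45 / chainRadius c (n + 1)) ≤ (c ^ (8 * 4 ^ (n + 1)))⁻¹ := by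
        have h45 : 45 ≤ c⁻¹ := by
          rw [le_inv_comm₀ (by norm_num) hc]; linarith
        calc (c ^ (8 * 4 ^ n))⁻¹ * (45 / chainRadius c (n + 1))
            ≤ (c ^ (8 * 4 ^ n))⁻¹ * (c⁻¹ / chainRadius c (n + 1)) := by gcongr
          _ = (c ^ (8 * 4 ^ n + 1 + (8 * 2 ^ (n + 1) - 2)))⁻¹ := by
            rw [chainRadius, pow_add, pow_add, pow_one]; field_simp; ring
          _ ≤ (c ^ (8 * 4 ^ (n + 1)))⁻¹ := by
            apply inv_anti₀ (by positivity)
            apply pow_le_pow_of_le_one hc.le hcle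
            rw [pow_succ, pow_succ]; omega
      calc _ ≤ (((c ^ (8 * 4 ^ n))⁻¹) ^ ν * singularSum c ν θ n (rotMap c (θ (n + 1)) z)) *
              (45 / chainRadius c (n + 1)) ^ ν := by gcongr
        _ = ((c ^ (8 * 4 ^ n))⁻¹ * (45 / chainRadius c (n + 1))) ^ ν *
              singularSum c ν θ n (rotMap c (θ (n + 1)) z) := by
            rw [Real.mul_rpow (by positivity) (by positivity)]; ring
        _ ≤ _ := by
            gcongr
            have := Real.rpow_nonneg hd0.le (-(ν * chainExp (n + 1)))
            linarith

/-! ### The Poisson kernel along an orbit -/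

/-- A self-map `g` of the exterior disc fixing `∞`: in the coordinate `1 / z` it is a holomorphic
self-map of the unit disc fixing `0`. -/
structure IsExteriorSelfMap (g : ℂ → ℂ) : Prop where
  mapsTo : MapsTo g extDisc extDisc
  exists_disc : ∃ G : ℂ → ℂ, DifferentiableOn ℂ G (Metric.ball 0 1) ∧
    MapsTo G (Metric.ball 0 1) (Metric.ball 0 1) ∧ G 0 = 0 ∧ ∀ z ∈ extDisc, G z⁻¹ = (g z)⁻¹

lemma isExteriorSelfMap_id : IsExteriorSelfMap id :=
  ⟨fun _ h => h, id, differentiableOn_id, fun _ h => h, rfl, fun _ _ => rfl⟩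

lemma IsExteriorSelfMap.rotMap_comp {c : ℝ} (hc : 0 < c) (x : Torus) {g : ℂ → ℂ}
    (hg : IsExteriorSelfMap g) : IsExteriorSelfMap (rotMap c x ∘ g) := by
  obtain ⟨hm, G, hG, hGm, hG0, hGg⟩ := hg
  have hrot : ∀ (y : Torus) (ζ : ℂ), ζ ∈ Metric.ball (0 : ℂ) 1 →
      circlePoint 0 y * ζ ∈ Metric.ball (0 : ℂ) 1 := by
    intro y ζ hζ
    rw [mem_ball_zero_iff] at hζ ⊢
    rwa [norm_circlePoint_zero_mul]
  refine ⟨fun z hz => rotMap_mem_extDisc hc x (hm hz),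
    fun ζ => circlePoint 0 (-x) * discMap c (circlePoint 0 x * G ζ), ?_, ?_, ?_, ?_⟩
  · exact ((differentiableOn_discMap hc).comp (hG.const_mul _)
      fun ζ hζ => hrot _ _ (hGm hζ)).const_mul _
  · exact fun ζ hζ => hrot _ _ (mapsTo_discMap hc (hrot _ _ (hGm hζ)))
  · simp [hG0, discMap_zero]
  · intro z hz
    have hinv : ∀ y : Torus, (circlePoint 0 y)⁻¹ = circlePoint 0 (-y) := by
      intro y
      apply inv_eq_of_mul_eq_one_right
      rw [circlePoint_mul]
      simp [circlePoint_zero_zero]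
    have h1 := discMap_inv (c := c) (rot_mem_extDisc (hm hz) (-x))
    simp only [Function.comp, rotMap]
    rw [hGg z hz, mul_inv, hinv, ← h1, mul_inv, hinv, neg_neg]

lemma IsExteriorSelfMap.norm_le {g : ℂ → ℂ} (hg : IsExteriorSelfMap g) {z : ℂ}
    (hz : z ∈ extDisc) : ‖z‖ ≤ ‖g z‖ := by
  obtain ⟨hm, G, hG, hGm, hG0, hGg⟩ := hg
  have h := Complex.norm_le_norm_of_mapsTo_ball hG
    (hGm.mono_right Metric.ball_subset_closedBall) hG0 (norm_inv_lt_one hz)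
  rw [hGg z hz, norm_inv, norm_inv] at h
  exact (inv_le_inv₀ (lt_trans one_pos (hm hz)) (lt_trans one_pos hz)).1 h

lemma IsExteriorSelfMap.continuousOn {g : ℂ → ℂ} (hg : IsExteriorSelfMap g) :
    ContinuousOn g extDisc := by
  obtain ⟨hm, G, hG, hGm, hG0, hGg⟩ := hg
  have h1 : ContinuousOn (fun z : ℂ => G z⁻¹) extDisc := by
    refine hG.continuousOn.comp ?_ fun z hz => by simpa using norm_inv_lt_one hz
    exact continuousOn_id.inv₀ fun z hz => ne_zero_of_mem_extDisc hz
  have h2 : ContinuousOn (fun z : ℂ => (G z⁻¹)⁻¹) extDisc := by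
    refine h1.inv₀ fun z hz => ?_
    rw [hGg z hz]
    exact inv_ne_zero (ne_zero_of_mem_extDisc (hm hz))
  exact h2.congr fun z hz => by simp only [hGg z hz, inv_inv]

lemma continuous_circlePoint (s : ℝ) : Continuous (circlePoint s) := by
  unfold circlePoint
  exact continuous_const.mul (continuous_subtype_val.comp AddCircle.continuous_toCircle)

lemma one_add_le_norm_circlePoint (σ : ℝ) (x : Torus) : 1 + σ ≤ ‖circlePoint σ x‖ := by
  rw [norm_circlePoint]; linarith [Real.add_one_le_exp σ]

lemma circlePoint_mem_extDisc {σ : ℝ} (hσ : 0 < σ) (x : Torus) : circlePoint σ x ∈ extDisc :=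
  mem_extDisc_of_le hσ (one_add_le_norm_circlePoint σ x)

/-- The Poisson kernel of the exterior disc with pole `p`. -/
def poissonExt (p w : ℂ) : ℝ := (‖w‖ ^ 2 - 1) / ‖w - p‖ ^ 2

/-- The mean value property at `∞` for the positive harmonic function obtained by composing the
Poisson kernel with a self-map of the exterior disc. -/
lemma IsExteriorSelfMap.integral_poissonExt {g : ℂ → ℂ} (hg : IsExteriorSelfMap g) {σ : ℝ}
    (hσ : 0 < σ) {p : ℂ} (hp : ‖p‖ = 1) :
    ∫ x : Torus, poissonExt p (g (circlePoint σ x)) = 2 * π := by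
  obtain ⟨hm, G, hG, hGm, hG0, hGg⟩ := hg
  have hne : ∀ ζ ∈ Metric.ball (0 : ℂ) 1, 1 - p * G ζ ≠ 0 := by
    intro ζ hζ h
    have h1 := hGm hζ
    rw [mem_ball_zero_iff] at h1
    have h2 : ‖p * G ζ‖ = 1 := by rw [← sub_eq_zero.1 h, norm_one]
    rw [norm_mul, hp, one_mul] at h2
    linarith
  set H : ℂ → ℂ := fun ζ => (1 + p * G ζ) / (1 - p * G ζ) with hH
  have hHd : DifferentiableOn ℂ H (Metric.ball 0 1) :=
    ((hG.const_mul p).const_add 1).div ((hG.const_mul p).const_sub 1) hne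
  have hR0 : 0 < Real.exp (-σ) := Real.exp_pos _
  have hR1 : Real.exp (-σ) < 1 := by rw [Real.exp_lt_one_iff]; linarith
  have hsub : Metric.closedBall (0 : ℂ) (Real.exp (-σ)) ⊆ Metric.ball 0 1 :=
    Metric.closedBall_subset_ball hR1
  have hcl : DiffContOnCl ℂ H (Metric.ball 0 |Real.exp (-σ)|) := by
    rw [abs_of_pos hR0]
    apply DifferentiableOn.diffContOnCl
    rw [closure_ball _ hR0.ne']
    exact hHd.mono hsub
  have havg := hcl.circleAverage
  have hH0 : H 0 = 1 := by simp [hH, hG0]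
  rw [hH0, Real.circleAverage_def] at havg
  have hcm : ∀ t : ℝ, circleMap 0 (Real.exp (-σ)) t = (circlePoint σ (-(t : Torus)))⁻¹ := by
    intro t
    rw [← AddCircle.coe_neg, circlePoint_coe, mul_inv, ← Complex.exp_neg, circleMap, zero_add,
      Real.exp_neg]
    push_cast
    congr 2
    ring
  have hcont : Continuous fun t : ℝ => H (circleMap 0 (Real.exp (-σ)) t) := by
    refine hHd.continuousOn.comp_continuous (continuous_circleMap _ _) fun t => hsub ?_
    exact circleMap_mem_closedBall _ hR0.le _
  have hint : ∫ t in (0 : ℝ)..2 * π, H (circleMap 0 (Real.exp (-σ)) t) = 2 * π := by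
    rw [inv_smul_eq_iff₀ Real.two_pi_pos.ne'] at havg
    rw [havg]
    simp
  have hre : ∫ t in (0 : ℝ)..2 * π, (H (circleMap 0 (Real.exp (-σ)) t)).re = 2 * π := by
    have := Complex.reCLM.intervalIntegral_comp_comm
      (hcont.intervalIntegrable (μ := volume) 0 (2 * π))
    simp only [Complex.reCLM_apply] at this
    rw [this, hint]
    simp
  have hval : ∀ t : ℝ, (H (circleMap 0 (Real.exp (-σ)) t)).re
      = poissonExt p (g (circlePoint σ (-(t : Torus)))) := by
    intro t
    have hz := circlePoint_mem_extDisc hσ (-(t : Torus))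
    rw [hcm, hH]
    simp only
    rw [hGg _ hz]
    have hw := hm hz
    have hw0 := ne_zero_of_mem_extDisc hw
    set w := g (circlePoint σ (-(t : Torus)))
    have e : (1 + p * w⁻¹) / (1 - p * w⁻¹) = (w + p) / (w - p) := by
      rw [← mul_div_mul_right _ _ hw0]
      congr 1 <;> field_simp
    have hpn : Complex.normSq p = 1 := by rw [Complex.normSq_eq_norm_sq, hp, one_pow]
    rw [e, poissonExt, Complex.div_re, ← add_div, ← Complex.normSq_eq_norm_sq,
      ← Complex.normSq_eq_norm_sq]
    congr 1
    rw [Complex.normSq_apply] at hpn ⊢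
    simp
    linear_combination -hpn
  rw [← integral_neg_eq_self (fun x : Torus => poissonExt p (g (circlePoint σ x))) volume,
    ← AddCircle.intervalIntegral_preimage (2 * π) 0, zero_add]
  exact (intervalIntegral.integral_congr fun t _ => (hval t).symm).trans hre

lemma continuous_integrable {f : Torus → ℝ} (hf : Continuous f) : Integrable f :=
  hf.integrable_of_hasCompactSupport (HasCompactSupport.of_compactSpace f)

lemma sub_ne_zero_of_norm_eq_one {p w : ℂ} (hp : ‖p‖ = 1) (hw : w ∈ extDisc) : w - p ≠ 0 := by
  intro h
  have h1 : 1 < ‖w‖ := hw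
  rw [sub_eq_zero.1 h, hp] at h1
  exact lt_irrefl _ h1

lemma IsExteriorSelfMap.continuous_circle {g : ℂ → ℂ} (hg : IsExteriorSelfMap g) {σ : ℝ}
    (hσ : 0 < σ) : Continuous fun x : Torus => g (circlePoint σ x) :=
  hg.continuousOn.comp_continuous (continuous_circlePoint σ) (circlePoint_mem_extDisc hσ)

lemma IsExteriorSelfMap.integrable_poissonExt {g : ℂ → ℂ} (hg : IsExteriorSelfMap g) {σ : ℝ}
    (hσ : 0 < σ) {p : ℂ} (hp : ‖p‖ = 1) :
    Integrable fun x : Torus => poissonExt p (g (circlePoint σ x)) := by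
  apply continuous_integrable
  have h := hg.continuous_circle hσ
  refine ((h.norm.pow 2).sub continuous_const).div ((h.sub continuous_const).norm.pow 2) fun x => ?_
  exact pow_ne_zero 2 (norm_ne_zero_iff.2
    (sub_ne_zero_of_norm_eq_one hp (hg.mapsTo (circlePoint_mem_extDisc hσ x))))

/-- Powers of the distance to a boundary point are dominated by the Poisson kernel, at a distance
at least `σ` from the disc. -/
lemma norm_sub_rpow_le_poissonExt {σ q τ : ℝ} (hσ : 0 < σ) (hq : 0 ≤ q)
    (h1 : σ ^ (-(q / 2)) ≤ τ) (h2 : σ ^ (1 - q) ≤ τ) {p w : ℂ} (hp : ‖p‖ = 1)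
    (hw : 1 + σ ≤ ‖w‖) : ‖w - p‖ ^ (-q) ≤ τ * (1 + poissonExt p w) := by
  have hρ : σ ≤ ‖w - p‖ := by
    have := norm_sub_norm_le w p; rw [hp] at this; linarith
  have hP : σ * (‖w - p‖ ^ 2)⁻¹ ≤ poissonExt p w := by
    rw [poissonExt, div_eq_mul_inv]
    gcongr
    nlinarith
  set ρ := ‖w - p‖
  set P := poissonExt p w
  have hρ0 : 0 < ρ := hσ.trans_le hρ
  have hP0 : 0 ≤ P := le_trans (by positivity) hP
  have hτ : 0 < τ := lt_of_lt_of_le (Real.rpow_pos_of_pos hσ _) h1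
  have hρ2 : (ρ ^ 2)⁻¹ ≤ σ⁻¹ * P := by
    rw [← div_eq_inv_mul, le_div_iff₀ hσ, mul_comm]; exact hP
  rcases le_total q 2 with hq2 | hq2
  · have e : ρ ^ (-q) = ((ρ ^ 2)⁻¹) ^ (q / 2) := by
      rw [← Real.rpow_natCast, ← Real.rpow_neg hρ0.le, ← Real.rpow_mul hρ0.le]
      congr 1; push_cast; ring
    have hPq : P ^ (q / 2) ≤ 1 + P := by
      rcases le_total P 1 with h | h
      · exact (Real.rpow_le_one hP0 h (by linarith)).trans (by linarith)
      · have := Real.rpow_le_rpow_of_exponent_le h (show q / 2 ≤ 1 by linarith)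
        rw [Real.rpow_one] at this; linarith
    calc ρ ^ (-q) = ((ρ ^ 2)⁻¹) ^ (q / 2) := e
      _ ≤ (σ⁻¹ * P) ^ (q / 2) := by gcongr
      _ = σ ^ (-(q / 2)) * P ^ (q / 2) := by
        rw [Real.mul_rpow (by positivity) hP0, Real.inv_rpow hσ.le, Real.rpow_neg hσ.le]
      _ ≤ τ * (1 + P) := by gcongr
  · calc ρ ^ (-q) = (ρ ^ 2)⁻¹ * ρ ^ (2 - q) := by
          rw [← Real.rpow_natCast, ← Real.rpow_neg hρ0.le, ← Real.rpow_add hρ0]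
          congr 1; push_cast; ring
      _ ≤ (σ⁻¹ * P) * σ ^ (2 - q) := by
          gcongr ?_ * ?_
          exact Real.rpow_le_rpow_of_nonpos hσ hρ (by linarith)
      _ = σ ^ (1 - q) * P := by
          rw [show 2 - q = 1 + (1 - q) by ring, Real.rpow_add hσ, Real.rpow_one]; field_simp
      _ ≤ τ * (1 + P) := by gcongr; linarith

lemma poleDistAt_rpow_le {c q : ℝ} (x : Torus) {w : ℂ} :
    poleDistAt c x w ^ (-q) ≤ ‖w - circlePoint 0 (x + (beta c : Torus))‖ ^ (-q)
      + ‖w - circlePoint 0 (x - (beta c : Torus))‖ ^ (-q) := by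
  rw [poleDistAt_eq]
  have h1 := Real.rpow_nonneg (norm_nonneg (w - circlePoint 0 (x + (beta c : Torus)))) (-q)
  have h2 := Real.rpow_nonneg (norm_nonneg (w - circlePoint 0 (x - (beta c : Torus)))) (-q)
  rcases min_choice ‖w - circlePoint 0 (x + (beta c : Torus))‖
    ‖w - circlePoint 0 (x - (beta c : Torus))‖ with h | h <;> rw [h] <;> linarith

lemma continuous_poleDistAt (c : ℝ) (x : Torus) : Continuous (poleDistAt c x) := by
  unfold poleDistAt poleDist
  fun_prop

lemma continuousOn_rotMap {c : ℝ} (hc : 0 < c) (x : Torus) : ContinuousOn (rotMap c x) extDisc :=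
  fun _ hz => (hasDerivAt_rotMap hc x hz).continuousAt.continuousWithinAt

lemma continuousOn_poleDistAt_rpow (c r : ℝ) (x : Torus) :
    ContinuousOn (fun z => poleDistAt c x z ^ r) extDisc :=
  (continuous_poleDistAt c x).continuousOn.rpow_const
    fun _ hz => Or.inl (poleDist_pos (rot_mem_extDisc hz _)).ne'

lemma continuousOn_singularSum {c : ℝ} (hc : 0 < c) (ν : ℝ) (θ : ℕ → Torus) (n : ℕ) :
    ContinuousOn (singularSum c ν θ n) extDisc := by
  induction n with
  | zero => exact continuousOn_const
  | succ n ih =>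
    exact (continuousOn_poleDistAt_rpow c _ _).add
      (ih.comp (continuousOn_rotMap hc _) fun z hz => rotMap_mem_extDisc hc _ hz)

lemma integral_one_torus : ∫ _ : Torus, (1 : ℝ) = 2 * π := by
  rw [← AddCircle.intervalIntegral_preimage (2 * π) 0]; simp

lemma IsExteriorSelfMap.integrable_one_add_poissonExt {g : ℂ → ℂ} (hg : IsExteriorSelfMap g)
    {σ : ℝ} (hσ : 0 < σ) {p : ℂ} (hp : ‖p‖ = 1) (τ : ℝ) :
    Integrable fun x : Torus => τ * (1 + poissonExt p (g (circlePoint σ x))) :=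
  ((integrable_const 1).add (hg.integrable_poissonExt hσ hp)).const_mul τ

lemma IsExteriorSelfMap.integral_one_add_poissonExt {g : ℂ → ℂ} (hg : IsExteriorSelfMap g)
    {σ : ℝ} (hσ : 0 < σ) {p : ℂ} (hp : ‖p‖ = 1) (τ : ℝ) :
    ∫ x : Torus, τ * (1 + poissonExt p (g (circlePoint σ x))) = 4 * π * τ := by
  rw [integral_const_mul, integral_add (integrable_const 1) (hg.integrable_poissonExt hσ hp),
    hg.integral_poissonExt hσ hp, integral_one_torus]
  ring

/-- The singularities of the slits `k ≤ n`, pulled back by an arbitrary self-map of the exterior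
disc, have integral at most of order `n τ`: each is dominated by Poisson kernels. -/
lemma integral_singularSum_le {c σ ν τ : ℝ} (hc : 0 < c) (hσ : 0 < σ) (hν : 0 ≤ ν)
    (θ : ℕ → Torus) (n : ℕ)
    (h1 : ∀ k, 1 ≤ k → k ≤ n → σ ^ (-(ν * chainExp k / 2)) ≤ τ)
    (h2 : ∀ k, 1 ≤ k → k ≤ n → σ ^ (1 - ν * chainExp k) ≤ τ) {g : ℂ → ℂ}
    (hg : IsExteriorSelfMap g) :
    ∫ x : Torus, singularSum c ν θ n (g (circlePoint σ x)) ≤ 2 * π + 8 * π * n * τ := by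
  induction n generalizing g with
  | zero =>
    simp only [singularSum]
    rw [integral_one_torus]
    simp
  | succ n ih =>
    have hi := ih (fun k hk hkn => h1 k hk (by omega)) (fun k hk hkn => h2 k hk (by omega))
      (hg.rotMap_comp hc (θ (n + 1)))
    have hcirc := circlePoint_mem_extDisc hσ
    have hint1 : Integrable fun x : Torus =>
        poleDistAt c (θ (n + 1)) (g (circlePoint σ x)) ^ (-(ν * chainExp (n + 1))) :=
      continuous_integrable ((continuousOn_poleDistAt_rpow c _ _).comp_continuous
        (hg.continuous_circle hσ) fun x => hg.mapsTo (hcirc x))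
    have hint2 : Integrable fun x : Torus =>
        singularSum c ν θ n (rotMap c (θ (n + 1)) (g (circlePoint σ x))) :=
      continuous_integrable ((continuousOn_singularSum hc ν θ n).comp_continuous
        ((hg.rotMap_comp hc (θ (n + 1))).continuous_circle hσ)
        fun x => (hg.rotMap_comp hc (θ (n + 1))).mapsTo (hcirc x))
    simp only [singularSum]
    rw [integral_add hint1 hint2]
    have hq : 0 ≤ ν * chainExp (n + 1) := mul_nonneg hν (chainExp_nonneg _)
    have hone : ∀ y : Torus, ‖circlePoint 0 y‖ = 1 := fun y => by
      rw [norm_circlePoint, Real.exp_zero]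
    set p := circlePoint 0 (θ (n + 1) + (beta c : Torus))
    set p' := circlePoint 0 (θ (n + 1) - (beta c : Torus))
    have hP := hg.integrable_one_add_poissonExt hσ (hone (θ (n + 1) + (beta c : Torus))) τ
    have hP' := hg.integrable_one_add_poissonExt hσ (hone (θ (n + 1) - (beta c : Torus))) τ
    have hmain : ∫ x : Torus,
        poleDistAt c (θ (n + 1)) (g (circlePoint σ x)) ^ (-(ν * chainExp (n + 1))) ≤ 8 * π * τ := by
      calc _ ≤ ∫ x : Torus, (τ * (1 + poissonExt p (g (circlePoint σ x)))
              + τ * (1 + poissonExt p' (g (circlePoint σ x)))) := by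
            refine integral_mono hint1 ?_ fun x => ?_
            · exact hP.add hP'
            · have hw : 1 + σ ≤ ‖g (circlePoint σ x)‖ :=
                (one_add_le_norm_circlePoint σ x).trans (hg.norm_le (hcirc x))
              have a1 := h1 (n + 1) (by omega) le_rfl
              have a2 := h2 (n + 1) (by omega) le_rfl
              exact (poleDistAt_rpow_le _).trans (add_le_add
                (norm_sub_rpow_le_poissonExt hσ hq a1 a2 (hone _) hw)
                (norm_sub_rpow_le_poissonExt hσ hq a1 a2 (hone _) hw))
        _ = 8 * π * τ := by
            rw [integral_add hP hP', hg.integral_one_add_poissonExt hσ (hone _),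
              hg.integral_one_add_poissonExt hσ (hone _)]
            ring
    have : ((n + 1 : ℕ) : ℝ) = n + 1 := by push_cast; rfl
    rw [this]
    simp only [Function.comp] at hi
    linarith

/-! ### Integrals of powers of the distance on the circle of angles -/

lemma norm_coe_torus {t : ℝ} (ht : |t| ≤ π) : ‖(t : Torus)‖ = |t| := by
  rw [AddCircle.norm_coe_eq_abs_iff _ Real.two_pi_pos.ne', abs_of_pos Real.two_pi_pos]
  linarith

/-- A truncated version of `∫ ‖u‖ ^ (-q)` over `‖u‖ ≥ D`. -/
lemma integral_max_norm_rpow_le {D q : ℝ} (hD : 0 < D) (hDπ : D ≤ π) (hq : 1 < q) :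
    ∫ u : Torus, max ‖u‖ D ^ (-q) ≤ 2 * (1 + 1 / (q - 1)) * D ^ (1 - q) := by
  have hcont : Continuous fun t : ℝ => max |t| D ^ (-q) :=
    (continuous_abs.max continuous_const).rpow_const
      fun t => Or.inl (lt_max_of_lt_right hD).ne'
  have hint : ∀ a b : ℝ, IntervalIntegrable (fun t : ℝ => max |t| D ^ (-q)) volume a b :=
    fun a b => hcont.intervalIntegrable a b
  have hπ := Real.pi_pos
  rw [← AddCircle.intervalIntegral_preimage (2 * π) (-π), show -π + 2 * π = π by ring]
  have e1 : ∫ t in (-π)..π, max ‖(t : Torus)‖ D ^ (-q) = ∫ t in (-π)..π, max |t| D ^ (-q) := by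
    apply intervalIntegral.integral_congr
    intro t ht
    rw [uIcc_of_le (by linarith)] at ht
    simp only [norm_coe_torus (abs_le.2 ht)]
  have e2 : ∫ t in (-π)..0, max |t| D ^ (-q) = ∫ t in (0 : ℝ)..π, max |t| D ^ (-q) := by
    have := intervalIntegral.integral_comp_neg (a := 0) (b := π) (fun t : ℝ => max |t| D ^ (-q))
    simp only [abs_neg, neg_zero] at this
    exact this.symm
  have e3 : ∫ t in (0 : ℝ)..D, max |t| D ^ (-q) = D ^ (1 - q) := by
    rw [intervalIntegral.integral_congr (g := fun _ => D ^ (-q))]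
    · rw [intervalIntegral.integral_const, sub_zero, smul_eq_mul, sub_eq_add_neg,
        Real.rpow_add hD, Real.rpow_one]
    · intro t ht
      rw [uIcc_of_le hD.le] at ht
      simp only [abs_of_nonneg ht.1, max_eq_right ht.2]
  have e4 : ∫ t in D..π, max |t| D ^ (-q) ≤ 1 / (q - 1) * D ^ (1 - q) := by
    rw [intervalIntegral.integral_congr (g := fun t => t ^ (-q))]
    · rw [integral_rpow (Or.inr ⟨by linarith, fun h => by
        rw [uIcc_of_le hDπ] at h; linarith [h.1]⟩)]
      have hp : 0 ≤ π ^ (1 - q) := Real.rpow_nonneg hπ.le _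
      have hq1 : 0 < q - 1 := by linarith
      have e : (π ^ (1 - q) - D ^ (1 - q)) / (1 - q) = (D ^ (1 - q) - π ^ (1 - q)) / (q - 1) := by
        rw [div_eq_div_iff (by linarith) hq1.ne']; ring
      rw [show -q + 1 = 1 - q by ring, e, div_mul_eq_mul_div, one_mul]
      gcongr
      linarith
    · intro t ht
      rw [uIcc_of_le hDπ] at ht
      simp only [abs_of_nonneg (hD.le.trans ht.1), max_eq_left ht.1]
  rw [e1, ← intervalIntegral.integral_add_adjacent_intervals (hint (-π) 0) (hint 0 π), e2,
    ← intervalIntegral.integral_add_adjacent_intervals (hint 0 D) (hint D π), e3]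
  linarith

lemma norm_sub_le_pi_mul (σ : ℝ) (hσ : 0 ≤ σ) (y v : Torus) :
    ‖y - v‖ ≤ π * ‖circlePoint σ y - circlePoint 0 v‖ := by
  have h1 := (chord_bounds (y - v)).1
  rw [← norm_circlePoint_sub] at h1
  have h2 : ‖circlePoint σ y - circlePoint 0 y‖ = ‖circlePoint σ y‖ - 1 := by
    have : circlePoint σ y - circlePoint 0 y = ((Real.exp σ - 1 : ℝ) : ℂ) * circlePoint 0 y := by
      simp only [circlePoint, Real.exp_zero]; push_cast; ring
    rw [this, norm_mul, Complex.norm_real, norm_circlePoint, norm_circlePoint, Real.exp_zero,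
      mul_one, Real.norm_of_nonneg (by linarith [Real.one_le_exp hσ])]
  have h3 : ‖circlePoint σ y‖ - 1 ≤ ‖circlePoint σ y - circlePoint 0 v‖ := by
    have := norm_sub_norm_le (circlePoint σ y) (circlePoint 0 v)
    rwa [norm_circlePoint 0 v, Real.exp_zero] at this
  have h4 : ‖circlePoint 0 y - circlePoint 0 v‖ ≤
      ‖circlePoint σ y - circlePoint 0 y‖ + ‖circlePoint σ y - circlePoint 0 v‖ := by
    rw [norm_sub_rev (circlePoint σ y) (circlePoint 0 y)]
    exact norm_sub_le_norm_sub_add_norm_sub _ _ _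
  have h5 : 2 / π * ‖y - v‖ ≤ 2 * ‖circlePoint σ y - circlePoint 0 v‖ := by linarith
  rw [div_mul_eq_mul_div, div_le_iff₀ Real.pi_pos] at h5
  linarith

lemma measurableSet_farSet (b D : ℝ) (x : Torus) : MeasurableSet (farSet b D x) := by
  apply IsClosed.measurableSet
  apply IsClosed.and <;> exact isClosed_le continuous_const (by fun_prop)

/-- The contribution of the singular points of the last slit to the far set. -/
lemma setIntegral_poleDistAt_rpow_le {c σ D q : ℝ} (hσ : 0 < σ) (hD : 0 < D) (hDπ : D ≤ π)
    (hq : 1 < q) (x : Torus) :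
    ∫ y in farSet (beta c) D x, poleDistAt c x (circlePoint σ y) ^ (-q)
      ≤ 4 * π ^ q * (1 + 1 / (q - 1)) * D ^ (1 - q) := by
  have hcm : Continuous fun u : Torus => max ‖u‖ D ^ (-q) :=
    (continuous_norm.max continuous_const).rpow_const fun t => Or.inl (lt_max_of_lt_right hD).ne'
  have hcv : ∀ v : Torus, Integrable fun y : Torus => π ^ q * max ‖y - v‖ D ^ (-q) := fun v =>
    (continuous_integrable (hcm.comp (continuous_sub_right v))).const_mul _
  have hiv : ∀ v : Torus, ∫ y : Torus, π ^ q * max ‖y - v‖ D ^ (-q)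
      ≤ π ^ q * (2 * (1 + 1 / (q - 1)) * D ^ (1 - q)) := by
    intro v
    rw [integral_const_mul, integral_sub_right_eq_self (fun u : Torus => max ‖u‖ D ^ (-q)) v]
    gcongr
    exact integral_max_norm_rpow_le hD hDπ hq
  have hpt : ∀ y v : Torus, D ≤ ‖y - v‖ →
      ‖circlePoint σ y - circlePoint 0 v‖ ^ (-q) ≤ π ^ q * max ‖y - v‖ D ^ (-q) := by
    intro y v hy
    have h1 := norm_sub_le_pi_mul σ hσ.le y v
    have h0 : 0 < ‖y - v‖ := hD.trans_le hy
    rw [max_eq_left hy]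
    calc ‖circlePoint σ y - circlePoint 0 v‖ ^ (-q) ≤ (π⁻¹ * ‖y - v‖) ^ (-q) := by
          apply Real.rpow_le_rpow_of_nonpos (mul_pos (inv_pos.2 Real.pi_pos) h0) _ (by linarith)
          rwa [inv_mul_le_iff₀ Real.pi_pos]
      _ = π ^ q * ‖y - v‖ ^ (-q) := by
          rw [Real.mul_rpow (inv_pos.2 Real.pi_pos).le h0.le, Real.inv_rpow Real.pi_pos.le,
            Real.rpow_neg Real.pi_pos.le, inv_inv]
  have hint : Integrable fun y : Torus => poleDistAt c x (circlePoint σ y) ^ (-q) :=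
    continuous_integrable ((continuousOn_poleDistAt_rpow c _ x).comp_continuous
      (continuous_circlePoint σ) (circlePoint_mem_extDisc hσ))
  have hsum := (hcv (x + (beta c : Torus))).add (hcv (x - (beta c : Torus)))
  calc _ ≤ ∫ y in farSet (beta c) D x, (π ^ q * max ‖y - (x + (beta c : Torus))‖ D ^ (-q) +
          π ^ q * max ‖y - (x - (beta c : Torus))‖ D ^ (-q)) := by
        refine setIntegral_mono_on hint.integrableOn hsum.integrableOn
          (measurableSet_farSet _ _ _) fun y hy => ?_
        exact (poleDistAt_rpow_le x).trans (add_le_add (hpt _ _ hy.1) (hpt _ _ hy.2))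
    _ ≤ ∫ y : Torus, (π ^ q * max ‖y - (x + (beta c : Torus))‖ D ^ (-q) +
          π ^ q * max ‖y - (x - (beta c : Torus))‖ D ^ (-q)) := by
        refine setIntegral_le_integral hsum (Filter.Eventually.of_forall fun y => ?_)
        have := Real.pi_pos
        change (0 : ℝ) ≤ _
        positivity
    _ ≤ π ^ q * (2 * (1 + 1 / (q - 1)) * D ^ (1 - q)) +
          π ^ q * (2 * (1 + 1 / (q - 1)) * D ^ (1 - q)) := by
        rw [integral_add (hcv _) (hcv _)]
        exact add_le_add (hiv _) (hiv _)
    _ = _ := by ring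

/-! ### The density of the next angle -/

lemma continuous_norm_deriv_rpow {c σ ν : ℝ} (hc : 0 < c) (hσ : 0 < σ) (hν : 0 < ν)
    (θ : ℕ → Torus) (n : ℕ) :
    Continuous fun y : Torus => ‖deriv (clusterMap c θ n) (circlePoint σ y)‖ ^ ν := by
  have hd : DifferentiableOn ℂ (clusterMap c θ n) extDisc :=
    fun z hz => (differentiableAt_clusterMap hc θ n hz).differentiableWithinAt
  have h1 := (hd.deriv isOpen_extDisc).continuousOn.comp_continuous (continuous_circlePoint σ)
    (circlePoint_mem_extDisc hσ)
  exact h1.norm.rpow_const fun _ => Or.inr hν.le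

lemma norm_circlePoint_sub_le_add {σ : ℝ} (hσ : 0 < σ) (hσ1 : σ ≤ 1) (y v : Torus) :
    ‖circlePoint σ y - circlePoint 0 v‖ ≤ 2 * σ + ‖y - v‖ := by
  have h2 : ‖circlePoint σ y - circlePoint 0 y‖ ≤ 2 * σ := by
    have : circlePoint σ y - circlePoint 0 y = ((Real.exp σ - 1 : ℝ) : ℂ) * circlePoint 0 y := by
      simp only [circlePoint, Real.exp_zero]; push_cast; ring
    rw [this, norm_mul, Complex.norm_real, norm_circlePoint, Real.exp_zero, mul_one]
    have := Real.abs_exp_sub_one_le (x := σ) (by rwa [abs_of_pos hσ])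
    rwa [abs_of_pos hσ] at this
  have h4 := norm_sub_le_norm_sub_add_norm_sub (circlePoint σ y) (circlePoint 0 y)
    (circlePoint 0 v)
  linarith [norm_circlePoint_sub_le y v]

/-- The normalising factor is at least the contribution of an arc of length `2 σ` about one of the
singular points of the last slit. -/
lemma le_partitionFn {c D σ ν : ℝ} (hc : 0 < c) (hc1 : c ≤ 1 / 10 ^ 4) (hσ : 0 < σ) (hσ1 : σ ≤ 1)
    (hD : D ≤ c ^ 4 * (√c * √σ)) (hν : 0 < ν) (θ : ℕ → Torus) {n : ℕ} (hn : 1 ≤ n)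
    (hθ : IsChain c D θ n) (hr : 3 * σ ≤ chainRadius c n) :
    (c ^ (3 * n)) ^ ν * 3 ^ (-ν) * σ ^ (1 - ν * chainExp n) ≤ partitionFn c (-ν) σ θ n := by
  have hcont := continuous_norm_deriv_rpow hc hσ hν θ n
  have hint := continuous_integrable hcont
  have hen := chainExp_nonneg n
  have hen1 := (chainExp_lt_one n).le
  set v : Torus := θ n + (beta c : Torus)
  rw [partitionFn, neg_neg]
  have hball : ∀ y ∈ Metric.closedBall v σ,
      (c ^ (3 * n)) ^ ν * (3 ^ (-ν) * σ ^ (-(ν * chainExp n)))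
        ≤ ‖deriv (clusterMap c θ n) (circlePoint σ y)‖ ^ ν := by
    intro y hy
    rw [mem_closedBall_iff_norm] at hy
    have hd3 : poleDistAt c (θ n) (circlePoint σ y) ≤ 3 * σ := by
      rw [poleDistAt_eq]
      refine (min_le_left _ _).trans ((norm_circlePoint_sub_le_add hσ hσ1 y v).trans ?_)
      linarith
    have hd0 : 0 < poleDistAt c (θ n) (circlePoint σ y) :=
      poleDist_pos (rot_mem_extDisc (circlePoint_mem_extDisc hσ y) _)
    have h := (norm_deriv_clusterMap_near hc hc1 hσ hD θ hn hθ
      (one_add_le_norm_circlePoint σ y) (hd3.trans hr)).1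
    have h3 : (3 : ℝ) ^ (-ν) ≤ 3 ^ (-(ν * chainExp n)) := by
      apply Real.rpow_le_rpow_of_exponent_le (by norm_num)
      nlinarith
    calc (c ^ (3 * n)) ^ ν * (3 ^ (-ν) * σ ^ (-(ν * chainExp n)))
        ≤ (c ^ (3 * n)) ^ ν * (3 ^ (-(ν * chainExp n)) * σ ^ (-(ν * chainExp n))) := by gcongr
      _ = (c ^ (3 * n)) ^ ν * (3 * σ) ^ (-(ν * chainExp n)) := by
          rw [Real.mul_rpow (by norm_num) hσ.le]
      _ ≤ (c ^ (3 * n)) ^ ν * poleDistAt c (θ n) (circlePoint σ y) ^ (-(ν * chainExp n)) := by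
          gcongr ?_ * ?_
          exact Real.rpow_le_rpow_of_nonpos hd0 hd3 (by nlinarith)
      _ = (c ^ (3 * n) * poleDistAt c (θ n) (circlePoint σ y) ^ (-chainExp n)) ^ ν := by
          rw [Real.mul_rpow (by positivity) (by positivity), ← Real.rpow_mul hd0.le]
          congr 2; ring
      _ ≤ _ := by gcongr
  have hvol : volume.real (Metric.closedBall v σ) = 2 * σ := by
    rw [Measure.real, AddCircle.volume_closedBall, min_eq_right (by linarith [Real.pi_gt_three]),
      ENNReal.toReal_ofReal (by positivity)]
  have hfin : volume (Metric.closedBall v σ) ≠ ⊤ := measure_ne_top _ _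
  calc (c ^ (3 * n)) ^ ν * 3 ^ (-ν) * σ ^ (1 - ν * chainExp n)
      = σ * ((c ^ (3 * n)) ^ ν * (3 ^ (-ν) * σ ^ (-(ν * chainExp n)))) := by
        rw [sub_eq_add_neg, Real.rpow_add hσ, Real.rpow_one]; ring
    _ ≤ (2 * σ) * ((c ^ (3 * n)) ^ ν * (3 ^ (-ν) * σ ^ (-(ν * chainExp n)))) := by
        gcongr; linarith
    _ = ∫ _ in Metric.closedBall v σ, (c ^ (3 * n)) ^ ν * (3 ^ (-ν) * σ ^ (-(ν * chainExp n))) := by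
        rw [setIntegral_const, hvol, smul_eq_mul]
    _ ≤ ∫ y in Metric.closedBall v σ, ‖deriv (clusterMap c θ n) (circlePoint σ y)‖ ^ ν :=
        setIntegral_mono_on (integrableOn_const hfin) hint.integrableOn
          Metric.isClosed_closedBall.measurableSet hball
    _ ≤ _ := setIntegral_le_integral hint
        (Filter.Eventually.of_forall fun y => Real.rpow_nonneg (norm_nonneg _) _)

/-- The mass of the far set before normalisation. -/
lemma setIntegral_norm_deriv_rpow_le {c D σ ν τ : ℝ} (hc : 0 < c) (hc1 : c ≤ 1 / 10 ^ 4)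
    (hσ : 0 < σ) (hD0 : 0 < D) (hDπ : D ≤ π) (hD : D ≤ c ^ 4 * (√c * √σ)) (hν : 0 < ν)
    (θ : ℕ → Torus) {m : ℕ} (hθ : IsChain c D θ (m + 1)) (hq : 1 < ν * chainExp (m + 1))
    (h1 : ∀ k, 1 ≤ k → k ≤ m → σ ^ (-(ν * chainExp k / 2)) ≤ τ)
    (h2 : ∀ k, 1 ≤ k → k ≤ m → σ ^ (1 - ν * chainExp k) ≤ τ) :
    ∫ y in farSet (beta c) D (θ (m + 1)),
        ‖deriv (clusterMap c θ (m + 1)) (circlePoint σ y)‖ ^ ν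
      ≤ ((c ^ (8 * 4 ^ (m + 1)))⁻¹) ^ ν *
        (4 * π ^ (ν * chainExp (m + 1)) * (1 + 1 / (ν * chainExp (m + 1) - 1)) *
          D ^ (1 - ν * chainExp (m + 1)) + (2 * π + 8 * π * m * τ)) := by
  have hcirc := circlePoint_mem_extDisc hσ
  have hg := isExteriorSelfMap_id.rotMap_comp hc (θ (m + 1))
  have hint0 := continuous_integrable (continuous_norm_deriv_rpow hc hσ hν θ (m + 1))
  have hint1 : Integrable fun y : Torus =>
      poleDistAt c (θ (m + 1)) (circlePoint σ y) ^ (-(ν * chainExp (m + 1))) :=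
    continuous_integrable ((continuousOn_poleDistAt_rpow c _ _).comp_continuous
      (continuous_circlePoint σ) hcirc)
  have hint2 : Integrable fun y : Torus =>
      singularSum c ν θ m (rotMap c (θ (m + 1)) (circlePoint σ y)) :=
    continuous_integrable ((continuousOn_singularSum hc ν θ m).comp_continuous
      (hg.continuous_circle hσ) fun x => hg.mapsTo (hcirc x))
  have hm := measurableSet_farSet (beta c) D (θ (m + 1))
  calc _ ≤ ∫ y in farSet (beta c) D (θ (m + 1)), ((c ^ (8 * 4 ^ (m + 1)))⁻¹) ^ ν *
          (poleDistAt c (θ (m + 1)) (circlePoint σ y) ^ (-(ν * chainExp (m + 1))) +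
            singularSum c ν θ m (rotMap c (θ (m + 1)) (circlePoint σ y))) := by
        refine setIntegral_mono_on hint0.integrableOn
          ((hint1.add hint2).const_mul _).integrableOn hm fun y _ => ?_
        exact norm_deriv_clusterMap_rpow_le hc hc1 hσ hD hν θ hθ (one_add_le_norm_circlePoint σ y)
    _ = ((c ^ (8 * 4 ^ (m + 1)))⁻¹) ^ ν *
          ((∫ y in farSet (beta c) D (θ (m + 1)),
            poleDistAt c (θ (m + 1)) (circlePoint σ y) ^ (-(ν * chainExp (m + 1)))) +
          ∫ y in farSet (beta c) D (θ (m + 1)),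
            singularSum c ν θ m (rotMap c (θ (m + 1)) (circlePoint σ y))) := by
        rw [integral_const_mul, integral_add hint1.integrableOn hint2.integrableOn]
    _ ≤ _ := by
        gcongr ?_ * (?_ + ?_)
        · exact setIntegral_poleDistAt_rpow_le hσ hD0 hDπ hq _
        · refine (setIntegral_le_integral hint2 (Filter.Eventually.of_forall fun y =>
            singularSum_nonneg _ _ _ _ _)).trans ?_
          exact integral_singularSum_le hc hσ hν.le θ m h1 h2 hg

/-! ### Smallness of the regularisation -/

/-- The double exponential beats `8 ^ n` for all `n ≤ T / c`. -/
lemma exists_mul_pow_le_double_exp (K T : ℝ) (hT : 0 < T) :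
    ∃ c₀ : ℝ, 0 < c₀ ∧ ∀ c, 0 < c → c < c₀ → ∀ n : ℕ, (n : ℝ) ≤ T / c →
      K * 8 ^ n ≤ (2 : ℝ) ^ ((2 : ℝ) ^ (1 / c)) := by
  obtain ⟨k, hk⟩ := exists_nat_ge K
  refine ⟨1 / (8 * (k + 3 * T) + 1), by positivity, fun c hc hcc n hn => ?_⟩
  set y := 1 / c with hy
  have hy0 : 0 < y := by positivity
  have hyl : 8 * (k + 3 * T) + 1 ≤ y := by
    rw [hy, le_div_iff₀ hc]
    rw [lt_div_iff₀ (by positivity)] at hcc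
    linarith
  have hny : (n : ℝ) ≤ T * y := by rw [hy, mul_one_div]; exact hn
  have h2y : (k : ℝ) + 3 * n ≤ (2 : ℝ) ^ y := by
    have hl : 1 / 2 ≤ Real.log 2 := by linarith [Real.log_two_gt_d9]
    have hq := Real.quadratic_le_exp_of_nonneg (show 0 ≤ Real.log 2 * y by positivity)
    rw [← Real.rpow_def_of_pos two_pos] at hq
    have h1 : 1 / 2 * y ≤ Real.log 2 * y := by gcongr
    have h3 : (1 / 2 * y) ^ 2 ≤ (Real.log 2 * y) ^ 2 := by gcongr
    have hk0 : (0 : ℝ) ≤ k := k.cast_nonneg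
    nlinarith
  have hkn : K ≤ 2 ^ k := hk.trans (by exact_mod_cast (Nat.lt_two_pow_self (n := k)).le)
  calc K * 8 ^ n ≤ 2 ^ k * 8 ^ n := by gcongr
    _ = (2 : ℝ) ^ ((k : ℝ) + 3 * n) := by
      rw [show (8 : ℝ) = 2 ^ 3 by norm_num, ← pow_mul, ← pow_add, ← Real.rpow_natCast]
      push_cast; rfl
    _ ≤ _ := Real.rpow_le_rpow_of_exponent_le (by norm_num) h2y

/-- The constant `γ` such that every other contribution is smaller than the one of the chain by a
factor `σ ^ (γ / 2 ^ n)`. -/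
def gap (ν : ℝ) : ℝ := min 1 (ν / 2 - 1)

lemma gap_pos {ν : ℝ} (hν : 2 < ν) : 0 < gap ν := lt_min one_pos (by linarith)

/-- The contributions of the slits `k ≤ m` to the integral are smaller than that of the chain of
`m + 1` slits by the factor `σ ^ (γ / 2 ^ (m + 1))`; the first bound uses `ν > 2`. -/
lemma gap_rpow_bounds {ν σ : ℝ} (hν : 2 < ν) (hσ : 0 < σ) (hσ1 : σ ≤ 1) {m k : ℕ} (hk : k ≤ m) :
    σ ^ (-(ν * chainExp k / 2)) ≤ σ ^ (1 - ν * chainExp (m + 1) + gap ν * (1 / 2) ^ (m + 1)) ∧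
      σ ^ (1 - ν * chainExp k) ≤
        σ ^ (1 - ν * chainExp (m + 1) + gap ν * (1 / 2) ^ (m + 1)) := by
  have hg1 : gap ν ≤ 1 := min_le_left _ _
  have hg2 : gap ν ≤ ν / 2 - 1 := min_le_right _ _
  have hg0 := gap_pos hν
  have hkm : (1 / 2 : ℝ) ^ m ≤ (1 / 2) ^ k :=
    pow_le_pow_of_le_one (by norm_num) (by norm_num) hk
  have hx0 : (0 : ℝ) < (1 / 2) ^ m := by positivity
  have hx1 : (1 / 2 : ℝ) ^ k ≤ 1 := pow_le_one₀ (by norm_num) (by norm_num)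
  constructor
  · apply Real.rpow_le_rpow_of_exponent_ge hσ hσ1
    unfold chainExp
    rw [pow_succ]
    nlinarith
  · apply Real.rpow_le_rpow_of_exponent_ge hσ hσ1
    unfold chainExp
    rw [pow_succ]
    nlinarith

lemma three_mul_sqrt_le_chainRadius {c σ K : ℝ} (hc : 0 < c) (hc1 : c ≤ 1 / 10 ^ 4)
    (hK : 16 ≤ K) {n : ℕ} (hσK : σ ≤ c ^ (K * 8 ^ n)) : 3 * √σ ≤ chainRadius c n := by
  have h28 : 2 ^ n ≤ 8 ^ n := Nat.pow_le_pow_left (by norm_num) n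
  have h1 : 1 ≤ 2 ^ n := Nat.one_le_two_pow
  have hs : √σ ≤ c ^ (8 * 8 ^ n) := by
    rw [Real.sqrt_le_left (by positivity)]
    refine hσK.trans ?_
    rw [← pow_mul, ← Real.rpow_natCast c (8 * 8 ^ n * 2)]
    apply Real.rpow_le_rpow_of_exponent_ge hc (by linarith)
    push_cast
    have : (0 : ℝ) < 8 ^ n := by positivity
    nlinarith
  calc 3 * √σ ≤ c⁻¹ * c ^ (8 * 8 ^ n) := by
        gcongr
        rw [le_inv_comm₀ (by norm_num) hc]; linarith
    _ = c ^ (8 * 8 ^ n - 1) := by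
        have h8 : 8 * 8 ^ n - 1 + 1 = 8 * 8 ^ n := by omega
        rw [inv_mul_eq_iff_eq_mul₀ hc.ne', ← pow_succ' c, h8]
    _ ≤ chainRadius c n := pow_le_pow_of_le_one hc.le (by linarith) (by omega)

lemma width_eq {c σ : ℝ} (hc : 0 < c) :
    c ^ (9 / 2 : ℝ) * σ ^ (1 / 2 : ℝ) = c ^ 4 * (√c * √σ) := by
  rw [Real.sqrt_eq_rpow, Real.sqrt_eq_rpow, ← mul_assoc, ← Real.rpow_natCast, ← Real.rpow_add hc]
  norm_num

/-! ### The two estimates for the density -/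

/-- The constant in the bound for the mass of the far set. -/
def farConst (ν : ℝ) : ℝ := 3 ^ ν * (4 * π ^ ν * (1 + 1 / (ν / 2 - 1)) + 10 * π)

lemma farConst_pos {ν : ℝ} (hν : 2 < ν) : 0 < farConst ν := by
  have : 0 < ν / 2 - 1 := by linarith
  have := Real.pi_pos
  unfold farConst; positivity

lemma partitionFn_pos {c D σ ν : ℝ} (hc : 0 < c) (hc1 : c ≤ 1 / 10 ^ 4) (hσ : 0 < σ)
    (hσ1 : σ ≤ 1) (hD : D ≤ c ^ 4 * (√c * √σ)) (hν : 0 < ν) (θ : ℕ → Torus) {n : ℕ} (hn : 1 ≤ n)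
    (hθ : IsChain c D θ n) (hr : 3 * σ ≤ chainRadius c n) : 0 < partitionFn c (-ν) σ θ n :=
  lt_of_lt_of_le (by positivity) (le_partitionFn hc hc1 hσ hσ1 hD hν θ hn hθ hr)

/-- The far set has small mass: in the quotient of the bounds for the numerator and for the
normalising factor, the powers of `c` are beaten by `σ ^ (γ / 2 ^ n)`. -/
lemma setIntegral_stepDensity_far_le {c D σ ν K : ℝ} (hc : 0 < c) (hc1 : c ≤ 1 / 10 ^ 4)
    (hσ : 0 < σ) (hD : D = c ^ 4 * (√c * √σ)) (hν : 2 < ν) (hK : 16 ≤ K)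
    (hKν : (20 * ν + 10) ≤ K * gap ν) (θ : ℕ → Torus) {n : ℕ} (hn : 1 ≤ n)
    (hσK : σ ≤ c ^ (K * 8 ^ n)) (hθ : IsChain c D θ n) :
    ∫ y in farSet (beta c) D (θ n), stepDensity c (-ν) σ θ n y ≤ farConst ν * c ^ 4 := by
  obtain ⟨m, rfl⟩ : ∃ m, n = m + 1 := ⟨n - 1, by omega⟩
  have hcle : c ≤ 1 := by linarith
  have hν0 : 0 < ν := by linarith
  have hπ := Real.pi_gt_three
  have hσ1 : σ ≤ 1 := hσK.trans (Real.rpow_le_one hc.le hcle (by positivity))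
  have hs1 : √σ ≤ 1 := Real.sqrt_le_one.2 hσ1
  have hσs : σ ≤ √σ := Real.le_sqrt_of_sq_le (by nlinarith)
  have hr : 3 * σ ≤ chainRadius c (m + 1) :=
    le_trans (by linarith) (three_mul_sqrt_le_chainRadius hc hc1 hK hσK)
  have hs0 : 0 < √σ := Real.sqrt_pos.2 hσ
  have hsc0 : 0 < √c := Real.sqrt_pos.2 hc
  have hD0 : 0 < D := by rw [hD]; positivity
  have hDπ : D ≤ π := by
    have h1 : c ^ 4 ≤ 1 := pow_le_one₀ hc.le hcle
    have h2 : √c ≤ 1 := Real.sqrt_le_one.2 hcle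
    have : c ^ 4 * (√c * √σ) ≤ 1 * (1 * 1) := by gcongr
    linarith
  set g : ℝ := gap ν * (1 / 2) ^ (m + 1) with hg
  set Q := ν * chainExp (m + 1) with hQ
  set τ := σ ^ (1 - Q + g) with hτ
  have hg0 : 0 < g := mul_pos (gap_pos hν) (by positivity)
  have hgν : g ≤ (ν / 2 - 1) / 2 := by
    have hx : (1 / 2 : ℝ) ^ (m + 1) ≤ 1 / 2 := by
      simpa using pow_le_pow_of_le_one (a := (1 / 2 : ℝ)) (by norm_num) (by norm_num)
        (show 1 ≤ m + 1 by omega)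
    have hg2 : gap ν ≤ ν / 2 - 1 := min_le_right _ _
    calc g ≤ gap ν * (1 / 2) := by rw [hg]; gcongr; exact (gap_pos hν).le
      _ ≤ (ν / 2 - 1) / 2 := by linarith
  have hQ2 : ν / 2 ≤ Q := by
    have := half_le_chainExp hn; rw [hQ]; nlinarith
  have hQν : Q ≤ ν := by
    have := (chainExp_lt_one (m + 1)).le; rw [hQ]; nlinarith
  have hτ1 : 1 ≤ τ := Real.one_le_rpow_of_pos_of_le_one_of_nonpos hσ hσ1 (by linarith)
  have hnum := setIntegral_norm_deriv_rpow_le (τ := τ) hc hc1 hσ hD0 hDπ hD.le hν0 θ hθ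
    (by change 1 < Q; linarith)
    (fun k _ hk => (gap_rpow_bounds hν hσ hσ1 hk).1)
    (fun k _ hk => (gap_rpow_bounds hν hσ hσ1 hk).2)
  have hden := le_partitionFn hc hc1 hσ hσ1 hD.le hν0 θ hn hθ hr
  have hZ := partitionFn_pos hc hc1 hσ hσ1 hD.le hν0 θ hn hθ hr
  -- the width `D` is much larger than `σ`
  have hDQ : D ^ (1 - Q) ≤ c ^ (-(9 / 2 * ν)) * τ := by
    rw [hD, ← width_eq hc, Real.mul_rpow (by positivity) (by positivity), ← Real.rpow_mul hc.le,
      ← Real.rpow_mul hσ.le]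
    gcongr ?_ * ?_
    · apply Real.rpow_le_rpow_of_exponent_ge hc hcle; linarith
    · apply Real.rpow_le_rpow_of_exponent_ge hσ hσ1; linarith
  have hmn : (m : ℝ) + 1 ≤ c ^ (-((m : ℝ) + 1)) := by
    have h2 : (m + 1 : ℕ) ≤ 2 ^ (m + 1) := Nat.lt_two_pow_self.le
    have h3 : ((m + 1 : ℕ) : ℝ) ≤ 2 ^ (m + 1) := by exact_mod_cast h2
    have h4 : (2 : ℝ) ^ (m + 1) ≤ (c⁻¹) ^ (m + 1) := by
      gcongr
      rw [le_inv_comm₀ (by norm_num) hc]; linarith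
    have h5 : (c⁻¹) ^ (m + 1) = c ^ (-((m : ℝ) + 1)) := by
      rw [Real.rpow_neg hc.le, inv_pow, ← Real.rpow_natCast]; push_cast; rfl
    push_cast at h3
    linarith
  set a := 9 / 2 * ν + (m + 1) with ha
  have hm0 : (0 : ℝ) ≤ m := m.cast_nonneg
  have hca1 : c ^ (-(9 / 2 * ν)) ≤ c ^ (-a) :=
    Real.rpow_le_rpow_of_exponent_ge hc hcle (by linarith)
  have hca2 : c ^ (-((m : ℝ) + 1)) ≤ c ^ (-a) :=
    Real.rpow_le_rpow_of_exponent_ge hc hcle (by linarith)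
  set B := 4 * π ^ ν * (1 + 1 / (ν / 2 - 1)) with hB
  have hν2 : 0 < ν / 2 - 1 := by linarith
  have hbr : 4 * π ^ Q * (1 + 1 / (Q - 1)) * D ^ (1 - Q) + (2 * π + 8 * π * m * τ)
      ≤ (B + 10 * π) * (c ^ (-a) * τ) := by
    have t1 : 4 * π ^ Q * (1 + 1 / (Q - 1)) * D ^ (1 - Q) ≤ B * (c ^ (-a) * τ) := by
      have e1 : π ^ Q ≤ π ^ ν := Real.rpow_le_rpow_of_exponent_le (by linarith) hQν
      have e2 : 1 / (Q - 1) ≤ 1 / (ν / 2 - 1) := one_div_le_one_div_of_le hν2 (by linarith)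
      have e3 : D ^ (1 - Q) ≤ c ^ (-a) * τ := hDQ.trans (by gcongr)
      have e4 : 0 ≤ 1 / (Q - 1) := one_div_nonneg.2 (by linarith)
      rw [hB]
      gcongr
    have t2 : 2 * π + 8 * π * m * τ ≤ 10 * π * (c ^ (-a) * τ) := by
      have hmτ : 0 ≤ m * τ := mul_nonneg hm0 (by linarith)
      calc 2 * π + 8 * π * m * τ = π * (2 + 8 * (m * τ)) := by ring
        _ ≤ π * (10 * (m * τ) + 10 * τ) :=
          mul_le_mul_of_nonneg_left (by linarith) Real.pi_pos.le
        _ = 10 * π * (((m : ℝ) + 1) * τ) := by ring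
        _ ≤ 10 * π * (c ^ (-a) * τ) := by gcongr; exact hmn.trans hca2
    linarith
  have hστ : σ ^ g ≤ c ^ ((20 * ν + 10) * 4 ^ (m + 1)) := by
    calc σ ^ g ≤ (c ^ (K * 8 ^ (m + 1))) ^ g := by gcongr
      _ = c ^ (K * 8 ^ (m + 1) * g) := by rw [← Real.rpow_mul hc.le]
      _ ≤ _ := by
        apply Real.rpow_le_rpow_of_exponent_ge hc hcle
        have : K * 8 ^ (m + 1) * g = (K * gap ν) * 4 ^ (m + 1) := by
          rw [hg, show (8 : ℝ) = 4 * 2 by norm_num, mul_pow]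
          have : (2 : ℝ) ^ (m + 1) * (1 / 2) ^ (m + 1) = 1 := by rw [← mul_pow]; norm_num
          linear_combination (K * gap ν * 4 ^ (m + 1)) * this
        rw [this]
        gcongr
  -- everything is expressed through powers of `c`
  have e1 : ((c ^ (8 * 4 ^ (m + 1)))⁻¹) ^ ν = c ^ (-(8 * 4 ^ (m + 1) * ν)) := by
    rw [← Real.rpow_natCast, ← Real.rpow_neg hc.le, ← Real.rpow_mul hc.le]
    push_cast; congr 1; ring
  have e2 : (c ^ (3 * (m + 1))) ^ ν = c ^ (3 * (m + 1) * ν) := by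
    rw [← Real.rpow_natCast, ← Real.rpow_mul hc.le]
    push_cast; rfl
  have hτe : τ = σ ^ (1 - Q) * σ ^ g := Real.rpow_add hσ _ _
  have h4n : (m : ℝ) + 1 ≤ 4 ^ (m + 1) := by
    have : m + 1 ≤ 4 ^ (m + 1) := (Nat.lt_pow_self (by norm_num)).le
    exact_mod_cast this
  simp only [stepDensity, neg_neg]
  rw [integral_div, div_le_iff₀ hZ]
  have hBp : 0 < B + 10 * π := by positivity
  have hP := Real.rpow_pos_of_pos hσ (1 - Q)
  calc _ ≤ ((c ^ (8 * 4 ^ (m + 1)))⁻¹) ^ ν * ((B + 10 * π) * (c ^ (-a) * τ)) :=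
        hnum.trans (by gcongr)
    _ = (B + 10 * π) * σ ^ (1 - Q) * (c ^ (-(8 * 4 ^ (m + 1) * ν)) * c ^ (-a) * σ ^ g) := by
        rw [e1, hτe]; ring
    _ ≤ (B + 10 * π) * σ ^ (1 - Q) *
          (c ^ (-(8 * 4 ^ (m + 1) * ν)) * c ^ (-a) * c ^ ((20 * ν + 10) * 4 ^ (m + 1))) := by gcongr
    _ ≤ (B + 10 * π) * σ ^ (1 - Q) * (c ^ (4 : ℝ) * c ^ (3 * (m + 1) * ν)) := by
        gcongr ?_ * ?_
        rw [← Real.rpow_add hc, ← Real.rpow_add hc, ← Real.rpow_add hc]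
        apply Real.rpow_le_rpow_of_exponent_ge hc hcle
        rw [ha]
        have h41 : (1 : ℝ) ≤ 4 ^ (m + 1) := one_le_pow₀ (by norm_num)
        have h42 : ((m : ℝ) + 1) * ν ≤ 4 ^ (m + 1) * ν := by gcongr
        have h43 : 1 * ν ≤ 4 ^ (m + 1) * ν := by gcongr
        linarith
    _ = farConst ν * c ^ 4 * ((c ^ (3 * (m + 1))) ^ ν * 3 ^ (-ν) * σ ^ (1 - Q)) := by
        have h3 : (3 : ℝ) ^ ν * 3 ^ (-ν) = 1 := by
          rw [← Real.rpow_add (by norm_num)]; simp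
        have h4 : c ^ (4 : ℝ) = c ^ 4 := by exact_mod_cast Real.rpow_natCast c 4
        rw [e2, farConst, h4, ← hB]
        linear_combination (-(B + 10 * π) * σ ^ (1 - Q) * c ^ 4 * c ^ (3 * (m + 1) * ν)) * h3
    _ ≤ _ := by
        have := farConst_pos hν
        gcongr

/-- The map `z ↦ conj z` exchanges the two singular points. -/
lemma poleDist_circlePoint_neg (c s : ℝ) (t : ℝ) :
    poleDist c (circlePoint s ((-t : ℝ) : Torus)) = poleDist c (circlePoint s (t : Torus)) := by
  have h : circlePoint s ((-t : ℝ) : Torus) = (starRingEnd ℂ) (circlePoint s (t : Torus)) := by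
    rw [circlePoint_coe, circlePoint_coe, map_mul, ← Complex.exp_conj,
      Complex.conj_ofReal]
    simp
  have h2 : (starRingEnd ℂ) (pole' c) = pole c := by rw [← conj_pole, Complex.conj_conj]
  rw [h, poleDist, poleDist, min_comm]
  congr 1
  · rw [← conj_pole, ← map_sub, Complex.norm_conj]
  · rw [← h2, ← map_sub, Complex.norm_conj]

lemma poleDistAt_circlePoint_add (c s : ℝ) (x y : Torus) :
    poleDistAt c x (circlePoint s (x + y)) = poleDist c (circlePoint s y) := by
  rw [poleDistAt, circlePoint_mul]; simp

lemma abs_rpow_sub_rpow_le {a b ε ν : ℝ} (ha : 0 < a) (hb : 0 < b) (hν : 0 ≤ ν)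
    (h : |Real.log a - Real.log b| ≤ ε) (hε : ν * ε ≤ 1) :
    |a ^ ν - b ^ ν| ≤ 2 * (ν * ε) * b ^ ν := by
  have hbν := Real.rpow_pos_of_pos hb ν
  have e : a ^ ν = Real.exp (ν * (Real.log a - Real.log b)) * b ^ ν := by
    rw [Real.rpow_def_of_pos ha, Real.rpow_def_of_pos hb, ← Real.exp_add]; congr 1; ring
  have h1 : |ν * (Real.log a - Real.log b)| ≤ ν * ε := by
    rw [abs_mul, abs_of_nonneg hν]; gcongr
  have h2 := Real.abs_exp_sub_one_le (h1.trans hε)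
  rw [e, ← sub_one_mul, abs_mul, abs_of_pos hbν]
  gcongr
  linarith

/-- The densities at two points that are symmetric about the last angle, close to the two
singular points, almost coincide. -/
lemma abs_stepDensity_sub_le {c D σ ν K : ℝ} (hc : 0 < c) (hc1 : c ≤ 1 / 10 ^ 4)
    (hσ : 0 < σ) (hD : D = c ^ 4 * (√c * √σ)) (hν : 0 < ν) (hK : 16 ≤ K)
    (θ : ℕ → Torus) {n : ℕ} (hn : 1 ≤ n) (hσK : σ ≤ c ^ (K * 8 ^ n)) (hθ : IsChain c D θ n)
    (hsmall : ν * (6 * n * c ^ 4) ≤ 1) {t : ℝ} (ht : t ∈ Icc (beta c - D) (beta c + D)) :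
    |stepDensity c (-ν) σ θ n (θ n + (t : Torus)) -
        stepDensity c (-ν) σ θ n (θ n + ((-t : ℝ) : Torus))|
      ≤ 2 * (ν * (6 * n * c ^ 4)) * stepDensity c (-ν) σ θ n (θ n + ((-t : ℝ) : Torus)) := by
  have hcle : c ≤ 1 := by linarith
  have hσ1 : σ ≤ 1 := hσK.trans (Real.rpow_le_one hc.le hcle (by positivity))
  have hs1 : √σ ≤ 1 := Real.sqrt_le_one.2 hσ1
  have hσs : σ ≤ √σ := Real.le_sqrt_of_sq_le (by nlinarith)
  have hr0 := three_mul_sqrt_le_chainRadius hc hc1 hK hσK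
  have hr : 3 * σ ≤ chainRadius c n := le_trans (by linarith) hr0
  have hZ := partitionFn_pos hc hc1 hσ hσ1 hD.le hν θ hn hθ hr
  have hDs : D ≤ √σ := by
    have h1 : c ^ 4 ≤ 1 := pow_le_one₀ hc.le hcle
    have h2 : √c ≤ 1 := Real.sqrt_le_one.2 hcle
    have h3 := Real.sqrt_nonneg σ
    have : c ^ 4 * (√c * √σ) ≤ 1 * (1 * √σ) := by gcongr
    linarith
  have hd : poleDist c (circlePoint σ (t : Torus)) ≤ chainRadius c n := by
    refine (min_le_left _ _).trans ?_
    rw [← circlePoint_beta]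
    refine (norm_circlePoint_sub_le_add hσ hσ1 _ _).trans (le_trans ?_ hr0)
    have : ‖(t : Torus) - (beta c : Torus)‖ ≤ D := by
      rw [← AddCircle.coe_sub]
      refine QuotientAddGroup.norm_mk_le_norm.trans ?_
      rw [Real.norm_eq_abs]
      rw [abs_le]; constructor <;> linarith [ht.1, ht.2]
    linarith
  have hd1 : poleDistAt c (θ n) (circlePoint σ (θ n + (t : Torus))) ≤ chainRadius c n := by
    rwa [poleDistAt_circlePoint_add]
  have hd2 : poleDistAt c (θ n) (circlePoint σ (θ n + ((-t : ℝ) : Torus))) ≤ chainRadius c n := by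
    rwa [poleDistAt_circlePoint_add, poleDist_circlePoint_neg]
  have hlog := abs_log_norm_deriv_clusterMap_sub_le hc hc1 hσ hD.le θ hn hθ
    (one_add_le_norm_circlePoint σ _) (one_add_le_norm_circlePoint σ _) hd1 hd2 (by
      rw [poleDistAt_circlePoint_add, poleDistAt_circlePoint_add, poleDist_circlePoint_neg,
        sub_self, abs_zero]
      positivity)
  have hpos : ∀ y : Torus, poleDistAt c (θ n) (circlePoint σ y) ≤ chainRadius c n →
      0 < ‖deriv (clusterMap c θ n) (circlePoint σ y)‖ := by
    intro y hy
    have h0 : 0 < poleDistAt c (θ n) (circlePoint σ y) :=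
      poleDist_pos (rot_mem_extDisc (circlePoint_mem_extDisc hσ y) _)
    exact lt_of_lt_of_le (by positivity) (norm_deriv_clusterMap_near hc hc1 hσ hD.le θ hn hθ
      (one_add_le_norm_circlePoint σ y) hy).1
  have h := abs_rpow_sub_rpow_le (hpos _ hd1) (hpos _ hd2) hν.le hlog hsmall
  rw [stepDensity, stepDensity, neg_neg, ← sub_div, abs_div, abs_of_pos hZ, ← mul_div_assoc]
  gcongr

lemma abs_intervalIntegral_stepDensity_sub_le {c D σ ν K : ℝ} (hc : 0 < c)
    (hc1 : c ≤ 1 / 10 ^ 4) (hσ : 0 < σ) (hD : D = c ^ 4 * (√c * √σ)) (hν : 0 < ν) (hK : 16 ≤ K)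
    (θ : ℕ → Torus) {n : ℕ} (hn : 1 ≤ n) (hσK : σ ≤ c ^ (K * 8 ^ n)) (hθ : IsChain c D θ n)
    (hsmall : ν * (6 * n * c ^ 4) ≤ 1) :
    |(∫ x in (beta c - D)..(beta c + D), stepDensity c (-ν) σ θ n (θ n + (x : Torus))) -
      (∫ x in (-beta c - D)..(-beta c + D), stepDensity c (-ν) σ θ n (θ n + (x : Torus)))|
      ≤ 2 * (ν * (6 * n * c ^ 4)) := by
  have hcle : c ≤ 1 := by linarith
  have hσ1 : σ ≤ 1 := hσK.trans (Real.rpow_le_one hc.le hcle (by positivity))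
  have hs1 : √σ ≤ 1 := Real.sqrt_le_one.2 hσ1
  have hσs : σ ≤ √σ := Real.le_sqrt_of_sq_le (by nlinarith)
  have hr : 3 * σ ≤ chainRadius c n :=
    le_trans (by linarith) (three_mul_sqrt_le_chainRadius hc hc1 hK hσK)
  have hZ := partitionFn_pos hc hc1 hσ hσ1 hD.le hν θ hn hθ hr
  have hD0 : 0 ≤ D := by rw [hD]; positivity
  have hD1 : D ≤ 1 := by
    have h1 : c ^ 4 ≤ 1 := pow_le_one₀ hc.le hcle
    have h2 : √c ≤ 1 := Real.sqrt_le_one.2 hcle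
    have : c ^ 4 * (√c * √σ) ≤ 1 * (1 * 1) := by gcongr
    linarith
  have hπ := Real.pi_gt_three
  set h := stepDensity c (-ν) σ θ n with hh
  have hhc : Continuous h := by
    have : h = fun y => ‖deriv (clusterMap c θ n) (circlePoint σ y)‖ ^ ν /
        partitionFn c (-ν) σ θ n := by
      funext y; rw [hh, stepDensity, neg_neg]
    rw [this]
    exact (continuous_norm_deriv_rpow hc hσ hν θ n).div_const _
  have hh0 : ∀ y, 0 ≤ h y := fun y =>
    div_nonneg (Real.rpow_nonneg (norm_nonneg _) _) hZ.le
  have hh1 : ∫ y : Torus, h y = 1 := by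
    have : ∫ y : Torus, h y = partitionFn c (-ν) σ θ n / partitionFn c (-ν) σ θ n := by
      rw [hh]
      simp only [stepDensity]
      rw [integral_div]
      rfl
    rw [this, div_self hZ.ne']
  have hA : Continuous fun x : ℝ => h (θ n + (x : Torus)) :=
    hhc.comp (continuous_const.add (AddCircle.continuous_mk' _))
  have hB : Continuous fun x : ℝ => h (θ n + ((-x : ℝ) : Torus)) := hA.comp continuous_neg
  have hsub : ∫ x in (-beta c - D)..(-beta c + D), h (θ n + (x : Torus))
      = ∫ x in (beta c - D)..(beta c + D), h (θ n + ((-x : ℝ) : Torus)) := by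
    have := intervalIntegral.integral_comp_neg (a := beta c - D) (b := beta c + D)
      (fun x : ℝ => h (θ n + (x : Torus)))
    rw [this]
    congr 1 <;> ring
  have hle : beta c - D ≤ beta c + D := by linarith
  -- the arc has mass at most one, being shorter than the circle
  have hmass : ∫ x in (beta c - D)..(beta c + D), h (θ n + ((-x : ℝ) : Torus)) ≤ 1 := by
    calc _ ≤ ∫ x in (beta c - D)..(beta c - D + 2 * π), h (θ n + ((-x : ℝ) : Torus)) :=
          intervalIntegral.integral_mono_interval le_rfl hle (by linarith)
            (Filter.Eventually.of_forall fun x => hh0 _) (hB.intervalIntegrable _ _)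
      _ = ∫ y : Torus, h (θ n + -y) := by
          rw [← AddCircle.intervalIntegral_preimage (2 * π) (beta c - D)]
          rfl
      _ = 1 := by
          rw [integral_neg_eq_self (fun y : Torus => h (θ n + y)) volume,
            integral_add_left_eq_self h (θ n), hh1]
  rw [hsub, ← intervalIntegral.integral_sub (hA.intervalIntegrable _ _)
    (hB.intervalIntegrable _ _)]
  have hmono := intervalIntegral.norm_integral_le_of_norm_le hle
    (f := fun x => h (θ n + (x : Torus)) - h (θ n + ((-x : ℝ) : Torus)))
    (g := fun x => 2 * (ν * (6 * n * c ^ 4)) * h (θ n + ((-x : ℝ) : Torus)))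
    (Filter.Eventually.of_forall fun x hx =>
      abs_stepDensity_sub_le hc hc1 hσ hD hν hK θ hn hσK hθ hsmall ⟨hx.1.le, hx.2⟩)
    ((hB.const_mul _).intervalIntegrable (μ := volume) _ _)
  rw [Real.norm_eq_abs, intervalIntegral.integral_const_mul] at hmono
  refine hmono.trans ?_
  have : 0 ≤ 2 * (ν * (6 * n * c ^ 4)) := by positivity
  nlinarith

lemma isChain_of_lt_stopTime {c D : ℝ} {θ : ℕ → Torus} {n : ℕ}
    (h : (n : ℕ∞) < stopTime (beta c) D θ) : IsChain c D θ n := by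
  intro m hm hmn
  by_contra! hcon
  have h1 : stopTime (beta c) D θ ≤ ((m + 1 : ℕ) : ℕ∞) :=
    sInf_le ⟨m + 1, rfl, by omega, by simpa using hcon⟩
  have h2 : ((m + 1 : ℕ) : ℕ∞) ≤ n := by exact_mod_cast hmn
  exact absurd (h.trans_le (h1.trans h2)) (lt_irrefl _)
end ALE
end

theorem theorem1p3 (ν T : ℝ) (hν : 2 < ν) (hT : 0 < T) :
    ∃ A : ℝ, 0 < A ∧ ∃ c₀ : ℝ, 0 < c₀ ∧
      ∀ c σ D : ℝ, 0 < c → c < c₀ →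
        0 < σ → σ ≤ c ^ ((2 : ℝ) ^ ((2 : ℝ) ^ (1 / c))) →
        D = c ^ (9 / 2 : ℝ) * σ ^ (1 / 2 : ℝ) →
        ∀ {Ω : Type*} [MeasurableSpace Ω] (P : Measure Ω) [IsProbabilityMeasure P]
          (θ : ℕ → Ω → ALE.Torus), ALE.IsALE P c (-ν) σ θ →
          ∀ᵐ ω ∂P, ∀ n : ℕ, 1 ≤ n → n < ⌊T / c⌋₊ →
            (n : ℕ∞) < ALE.stopTime (ALE.beta c) D (fun k => θ k ω) →
            (∫ x in ALE.farSet (ALE.beta c) D (θ n ω),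
                ALE.stepDensity c (-ν) σ (fun k => θ k ω) n x) ≤ A * c ^ 4 ∧
            |(∫ x in (ALE.beta c - D)..(ALE.beta c + D),
                ALE.stepDensity c (-ν) σ (fun k => θ k ω) n (θ n ω + (x : ALE.Torus))) -
              (∫ x in (-ALE.beta c - D)..(-ALE.beta c + D),
                ALE.stepDensity c (-ν) σ (fun k => θ k ω) n (θ n ω + (x : ALE.Torus)))|
              ≤ A * c ^ (11 / 4 : ℝ) := by
  have hν0 : 0 < ν := by linarith
  have hgap := ALE.gap_pos hν
  obtain ⟨c₁, hc₁, hK⟩ := ALE.exists_mul_pow_le_double_exp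
    (max 16 ((20 * ν + 10) / ALE.gap ν)) T hT
  have hfar := ALE.farConst_pos hν
  refine ⟨ALE.farConst ν + 12 * ν * T, by positivity,
    min c₁ (min (1 / 10 ^ 4) (1 / (6 * ν * T))), by positivity, ?_⟩
  intro c σ D hc hcc hσ hσc hD Ω _ P _ θ _
  refine Filter.Eventually.of_forall fun ω n hn hnN hlt => ?_
  obtain ⟨hcc₁, hcc'⟩ := lt_min_iff.1 hcc
  obtain ⟨hc1, hcT⟩ := lt_min_iff.1 hcc'
  have hcle : c ≤ 1 := by linarith
  have hnT : (n : ℝ) ≤ T / c :=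
    (Nat.cast_le.2 hnN.le).trans (Nat.floor_le (by positivity))
  have hσK : σ ≤ c ^ (max 16 ((20 * ν + 10) / ALE.gap ν) * 8 ^ n) :=
    hσc.trans (Real.rpow_le_rpow_of_exponent_ge hc hcle (hK c hc hcc₁ n hnT))
  rw [ALE.width_eq hc] at hD
  have hθ := ALE.isChain_of_lt_stopTime hlt
  have hKν : 20 * ν + 10 ≤ max 16 ((20 * ν + 10) / ALE.gap ν) * ALE.gap ν := by
    rw [← div_le_iff₀ hgap]; exact le_max_right _ _
  -- there are at most `T / c` slits
  have hnc : n * c ^ 4 ≤ T * c ^ 3 := by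
    rw [le_div_iff₀ hc] at hnT
    calc n * c ^ 4 = (n * c) * c ^ 3 := by ring
      _ ≤ T * c ^ 3 := by gcongr
  have hc3 : c ^ 3 ≤ c := by simpa using pow_le_pow_of_le_one hc.le hcle (show 1 ≤ 3 by norm_num)
  have hsmall : ν * (6 * n * c ^ 4) ≤ 1 := by
    rw [lt_div_iff₀ (by positivity)] at hcT
    calc ν * (6 * n * c ^ 4) = 6 * ν * (n * c ^ 4) := by ring
      _ ≤ 6 * ν * (T * c) :=
        mul_le_mul_of_nonneg_left (hnc.trans (by gcongr)) (by positivity)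
      _ ≤ 1 := by linarith
  constructor
  · refine (ALE.setIntegral_stepDensity_far_le hc hc1.le hσ hD hν (le_max_left _ _) hKν
      (fun k => θ k ω) hn hσK hθ).trans ?_
    gcongr
    have : 0 < 12 * ν * T := by positivity
    linarith
  · refine (ALE.abs_intervalIntegral_stepDensity_sub_le hc hc1.le hσ hD hν0 (le_max_left _ _)
      (fun k => θ k ω) hn hσK hθ hsmall).trans ?_
    have hc114 : c ^ 3 ≤ c ^ (11 / 4 : ℝ) := by
      rw [← Real.rpow_natCast]
      exact Real.rpow_le_rpow_of_exponent_ge hc hcle (by norm_num)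
    calc 2 * (ν * (6 * n * c ^ 4)) = 12 * ν * (n * c ^ 4) := by ring
      _ ≤ 12 * ν * (T * c ^ (11 / 4 : ℝ)) :=
        mul_le_mul_of_nonneg_left (hnc.trans (by gcongr)) (by positivity)
      _ = (12 * ν * T) * c ^ (11 / 4 : ℝ) := by ring
      _ ≤ _ := by gcongr; linarith
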